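/- **Setting.** Let $q\ge 1$, $p,m\ge 0$ be integers, $n=q+m$, $r=\min\{p,m\}$, $v=\max\{p,m\}$. Let $f:[0,\infty)\to[0,\infty)$ be measurable, $\theta\in\mathbb R^{q\times p}$, and let $\Sigma$ be a $p\times p$ positive definite matrix. Let $(Z,U)$, with $Z$ a $q\times p$ and $U$ an $m\times p$ random matrix, have the elliptically symmetric probability density $$(z,u)\mapsto|\Sigma|^{-n/2}f\big(\operatorname{tr}(z-\theta)\Sigma^{-1}(z-\theta)^\top+\operatorname{tr}u\Sigma^{-1}u^\top\big),$$ and let $E$ be the expectation under it. Put $F^*(t)=\frac12\int_t^\infty f(\nu)\,d\nu$, let $K^*$ (assumed finite) be the normalizing constant that makes $$(z,u)\mapsto\frac1{K^*}|\Sigma|^{-n/2}F^*\big(\operatorname{tr}(z-\theta)\Sigma^{-1}(z-\theta)^\top+\operatorname{tr}u\Sigma^{-1}u^\top\big)$$ a probability density ($K^*$ does not depend on $\theta,\Sigma$), and let $E^*$ be the expectation under this density. Let $S=U^\top U$, with Moore--Penrose inverse $S^+$, and $S=HLH^\top$ with $H^\top H=I_r$ and $L=\operatorname{diag}(l_1,\dots,l_r)$,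 $l_1>\dots>l_r>0$ (almost surely). For an estimator $\hat\Sigma$ of $\Sigma$ let $R(\hat\Sigma,\Sigma)=E\big[\operatorname{tr}\big(S^+\Sigma(\Sigma^{-1}\hat\Sigma-I_p)^2\big)\big]$. Put $a_o=1/(K^*v)$, $\hat\Sigma_{a_o}=a_oS$ and $$\hat\Sigma_\Psi=a_o\,(S+HL\Psi(L)H^\top),\qquad \Psi(L)=\operatorname{diag}(\psi_1(L),\dots,\psi_r(L)).$$ **Theorem.** Let $\psi_1,\dots,\psi_r$ be real functions that are differentiable on the open set $\{l_1>\dots>l_r>0\}$ and bounded on each of its subsets $\{R\ge l_1>\dots>l_r\ge\varepsilon\}$ with $0<\varepsilon<R$ (this boundedness is automatic if the $\psi_i$ are differentiable, or just continuous, on $(0,\infty)^r$). Assume that $\operatorname{tr}\Psi(L)\ge\lambda$ for all such $L$, where $\lambda>0$ is a constant, and that the expectations $E[\operatorname{tr}(\Sigma^{-1}S)]$, $E[\operatorname{tr}(\Sigma S^+)]$, $E[\|\Sigma^{-1}HL\Psi(L)H^\top\|_F^2]$ and $E[\|H\Psi(L)H^\top\|_F^2]$ are finite. Put $$g(\Psi)=\sum_{i=1}^r\Big\{2(v-r+1)\psi_i+(v-r+1)\psi_i^2+4l_i(1+\psi_i)\frac{\partial\psi_i}{\partial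 l_i}+\sum_{j\ne i}\frac{l_i(2\psi_i+\psi_i^2)-l_j(2\psi_j+\psi_j^2)}{l_i-l_j}\Big\}-2v\lambda ,$$ a function of $L$ that does not depend on $f$. Then the risks of $\hat\Sigma_\Psi$ and $\hat\Sigma_{a_o}$ are finite, and: 1. if $g(\Psi)$ is integrable under $E^*$, then $R(\hat\Sigma_\Psi,\Sigma)-R(\hat\Sigma_{a_o},\Sigma)\le a_o^2\,K^*\,E^*[g(\Psi)]$; 2. if $g(\Psi)\le 0$ for all $l_1>\dots>l_r>0$, then $\hat\Sigma_\Psi$ improves over $\hat\Sigma_{a_o}$, that is, $R(\hat\Sigma_\Psi,\Sigma)\le R(\hat\Sigma_{a_o},\Sigma)$ (here integrability of $g(\Psi)$ is not assumed). This covers both invertible $S$ ($p\le m$) and singular $S$ ($p>m$). -/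

import Mathlib

open MeasureTheory Matrix
open scoped ENNReal

noncomputable section

namespace EllipticalCov

/-- Sample space of the canonical form: pairs `(z, u)` of a `q × p` and an `m × p` real matrix.
Its `volume` is Lebesgue measure on `ℝ^{(q + m) p}`. -/
abbrev Sample (q m p : ℕ) : Type :=
  (Fin q → Fin p → ℝ) × (Fin m → Fin p → ℝ)

/-- `tr (z - θ) Σ⁻¹ (z - θ)ᵀ + tr u Σ⁻¹ uᵀ`. -/
def quadForm {q m p : ℕ} (θ : Matrix (Fin q) (Fin p) ℝ) (Sig : Matrix (Fin p) (Fin p) ℝ)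
    (ω : Sample q m p) : ℝ :=
  ((Matrix.of ω.1 - θ) * Sig⁻¹ * (Matrix.of ω.1 - θ)ᵀ).trace
    + (Matrix.of ω.2 * Sig⁻¹ * (Matrix.of ω.2)ᵀ).trace

/-- The elliptically symmetric law of `(Z, U)` with generating function `f`, that is, with density
`|Σ|^{-n/2} f (tr (z - θ) Σ⁻¹ (z - θ)ᵀ + tr u Σ⁻¹ uᵀ)`, where `n = q + m`. -/
def law {q m p : ℕ} (f : ℝ → ℝ) (θ : Matrix (Fin q) (Fin p) ℝ)
    (Sig : Matrix (Fin p) (Fin p) ℝ) : Measure (Sample q m p) :=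
  volume.withDensity fun ω =>
    ENNReal.ofReal (Sig.det ^ (-((q : ℝ) + (m : ℝ)) / 2)) * ENNReal.ofReal (f (quadForm θ Sig ω))

/-- `F*(t) = (1/2) ∫_t^∞ f(ν) dν`, as an extended nonnegative real. -/
def Fstar (f : ℝ → ℝ) (t : ℝ) : ℝ≥0∞ :=
  2⁻¹ * ∫⁻ ν in Set.Ioi t, ENNReal.ofReal (f ν)

/-- The total mass of `|Σ|^{-n/2} F*(tr (z - θ) Σ⁻¹ (z - θ)ᵀ + tr u Σ⁻¹ uᵀ)`.  By an affine change
of variables it does not depend on `(θ, Σ)`, and it is written here at `θ = 0`, `Σ = I_p`, so that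
it visibly depends on `f, q, m, p` only. -/
def KstarENN (q m p : ℕ) (f : ℝ → ℝ) : ℝ≥0∞ :=
  ∫⁻ ω : Sample q m p, Fstar f (quadForm 0 1 ω)

/-- The normalizing constant `K*` as a real number. -/
def Kstar (q m p : ℕ) (f : ℝ → ℝ) : ℝ :=
  (KstarENN q m p f).toReal

/-- The law with density
`(1/K*) |Σ|^{-n/2} F*(tr (z - θ) Σ⁻¹ (z - θ)ᵀ + tr u Σ⁻¹ uᵀ)`. -/
def lawStar {q m p : ℕ} (f : ℝ → ℝ) (θ : Matrix (Fin q) (Fin p) ℝ)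
    (Sig : Matrix (Fin p) (Fin p) ℝ) : Measure (Sample q m p) :=
  volume.withDensity fun ω =>
    (KstarENN q m p f)⁻¹ *
      (ENNReal.ofReal (Sig.det ^ (-((q : ℝ) + (m : ℝ)) / 2)) * Fstar f (quadForm θ Sig ω))

/-- `a_o = 1 / (K* v)` with `v = max {p, m}`. -/
def aOpt (q m p : ℕ) (f : ℝ → ℝ) : ℝ :=
  1 / (Kstar q m p f * (max p m : ℕ))

/-- `S = Uᵀ U`. -/
def gramMat {m p : ℕ} (u : Fin m → Fin p → ℝ) : Matrix (Fin p) (Fin p) ℝ :=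
  (Matrix.of u)ᵀ * Matrix.of u

theorem gramMat_posSemidef {m p : ℕ} (u : Fin m → Fin p → ℝ) : (gramMat u).PosSemidef := by
  have h := Matrix.posSemidef_conjTranspose_mul_self (Matrix.of u)
  rwa [Matrix.conjTranspose_eq_transpose_of_trivial] at h

theorem gramMat_isHermitian {m p : ℕ} (u : Fin m → Fin p → ℝ) : (gramMat u).IsHermitian :=
  (gramMat_posSemidef u).isHermitian

/-- The four Penrose equations for real matrices. -/
structure IsMoorePenrose {p k : ℕ} (A : Matrix (Fin p) (Fin k) ℝ)
    (B : Matrix (Fin k) (Fin p) ℝ) : Prop where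
  mul_mul_self : A * B * A = A
  mul_mul_inv : B * A * B = B
  symm_left : (A * B)ᵀ = A * B
  symm_right : (B * A)ᵀ = B * A

/-- The Moore--Penrose inverse of a real symmetric matrix: in an orthonormal eigenbasis, invert
the nonzero eigenvalues and keep the zero ones. -/
def pinv {p : ℕ} {A : Matrix (Fin p) (Fin p) ℝ} (hA : A.IsHermitian) :
    Matrix (Fin p) (Fin p) ℝ :=
  (hA.eigenvectorUnitary : Matrix (Fin p) (Fin p) ℝ) *
    Matrix.diagonal (fun i => (hA.eigenvalues i)⁻¹) *
    (hA.eigenvectorUnitary : Matrix (Fin p) (Fin p) ℝ)ᵀ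

/-- `pinv` satisfies the Penrose equations. -/
theorem pinv_isMoorePenrose {p : ℕ} {A : Matrix (Fin p) (Fin p) ℝ} (hA : A.IsHermitian) :
    IsMoorePenrose A (pinv hA) := by
  have hs := hA.spectral_theorem
  have hU : (hA.eigenvectorUnitary : Matrix (Fin p) (Fin p) ℝ)ᵀ *
      (hA.eigenvectorUnitary : Matrix (Fin p) (Fin p) ℝ) = 1 := by
    have := Unitary.coe_star_mul_self hA.eigenvectorUnitary
    rwa [Matrix.star_eq_conjTranspose, Matrix.conjTranspose_eq_transpose_of_trivial] at this
  rw [Unitary.conjStarAlgAut_apply] at hs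
  rw [Matrix.star_eq_conjTranspose, Matrix.conjTranspose_eq_transpose_of_trivial] at hs
  unfold pinv
  generalize (hA.eigenvectorUnitary : Matrix (Fin p) (Fin p) ℝ) = V at *
  have hs' : A = V * Matrix.diagonal hA.eigenvalues * Vᵀ := by simpa using hs
  generalize hA.eigenvalues = d at *
  clear hs
  subst hs'
  have key : ∀ X Y : Matrix (Fin p) (Fin p) ℝ, (V * X * Vᵀ) * (V * Y * Vᵀ) = V * (X * Y) * Vᵀ := by
    intro X Y
    calc _ = V * X * (Vᵀ * V) * Y * Vᵀ := by simp only [Matrix.mul_assoc]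
      _ = _ := by rw [hU]; simp only [Matrix.mul_assoc, Matrix.mul_one]
  refine ⟨?_, ?_, ?_, ?_⟩
  all_goals simp only [key, Matrix.diagonal_mul_diagonal]
  · congr; ext i; by_cases h : d i = 0 <;> simp [h]
  · congr; ext i; by_cases h : d i = 0 <;> simp [h]
  · simp [Matrix.transpose_mul, Matrix.mul_assoc]
  · simp [Matrix.transpose_mul, Matrix.mul_assoc]

/-- `S⁺`. -/
def gramPinv {m p : ℕ} (u : Fin m → Fin p → ℝ) : Matrix (Fin p) (Fin p) ℝ :=
  pinv (gramMat_isHermitian u)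

/-- Position, in Mathlib's indexing of the eigenvalues of a symmetric `p × p` matrix by `Fin p`,
of the `i`-th largest eigenvalue, for `i < r = min {p, m}`. -/
def topIdx (p m : ℕ) (i : Fin (min p m)) : Fin p :=
  (Fintype.equivOfCardEq (Fintype.card_fin (Fintype.card (Fin p))))
    ⟨i, by simpa using lt_of_lt_of_le i.2 (min_le_left p m)⟩

/-- `l_1 ≥ ... ≥ l_r`: the `r = min {p, m}` largest eigenvalues of `S = Uᵀ U`, in decreasing
order. -/
def eigval {m p : ℕ} (u : Fin m → Fin p → ℝ) (i : Fin (min p m)) : ℝ :=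
  (gramMat_isHermitian u).eigenvalues (topIdx p m i)

/-- The `p × r` matrix `H` of corresponding orthonormal eigenvectors. -/
def eigvec {m p : ℕ} (u : Fin m → Fin p → ℝ) : Matrix (Fin p) (Fin (min p m)) ℝ :=
  Matrix.of fun a i =>
    ((gramMat_isHermitian u).eigenvectorUnitary : Matrix (Fin p) (Fin p) ℝ) a (topIdx p m i)

/-- The `l_i` are in decreasing order. -/
theorem eigval_antitone {m p : ℕ} (u : Fin m → Fin p → ℝ) : Antitone (eigval u) := by
  intro i j hij
  unfold eigval topIdx Matrix.IsHermitian.eigenvalues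
  simp only [Equiv.symm_apply_apply]
  exact (gramMat_isHermitian u).eigenvalues₀_antitone (by simpa using hij)

theorem topIdx_inj (p m : ℕ) : Function.Injective (topIdx p m) := by
  intro i j h
  unfold topIdx at h
  have := (Equiv.injective _ h)
  simpa [Fin.ext_iff] using this

/-- `Hᵀ H = I_r`. -/
theorem eigvec_orth {m p : ℕ} (u : Fin m → Fin p → ℝ) : (eigvec u)ᵀ * eigvec u = 1 := by
  have hU := Unitary.coe_star_mul_self (gramMat_isHermitian u).eigenvectorUnitary
  rw [Matrix.star_eq_conjTranspose, Matrix.conjTranspose_eq_transpose_of_trivial] at hU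
  ext i j
  have := congrFun (congrFun hU (topIdx p m i)) (topIdx p m j)
  simpa [Matrix.mul_apply, eigvec, Matrix.one_apply, (topIdx_inj p m).eq_iff] using this

/-- `S = H L Hᵀ`. -/
theorem gramMat_eq {m p : ℕ} (u : Fin m → Fin p → ℝ) :
    gramMat u = eigvec u * Matrix.diagonal (eigval u) * (eigvec u)ᵀ := by
  classical
  set hA := gramMat_isHermitian u
  have hrk : (gramMat u).rank ≤ m := by
    unfold gramMat
    exact (Matrix.rank_mul_le_right _ _).trans (by simpa using Matrix.rank_le_height (Matrix.of u))
  rw [hA.rank_eq_card_non_zero_eigs] at hrk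
  have hzero : ∀ k, (∀ i, topIdx p m i ≠ k) → hA.eigenvalues k = 0 := by
    intro k hk
    by_contra hne
    have hpos : 0 < hA.eigenvalues k :=
      lt_of_le_of_ne ((gramMat_posSemidef u).eigenvalues_nonneg k) (Ne.symm hne)
    set e := (Fintype.equivOfCardEq (Fintype.card_fin (Fintype.card (Fin p)))) with he
    obtain ⟨k', rfl⟩ := e.surjective k
    have hk'p : (k' : ℕ) < p := by simpa using k'.2
    have hk' : m ≤ (k' : ℕ) := by
      by_contra hlt
      push Not at hlt
      exact hk ⟨k', lt_min hk'p hlt⟩ rfl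
    have : m + 1 ≤ Fintype.card {i // hA.eigenvalues i ≠ 0} := by
      have hinj : Function.Injective (fun i : Fin (m + 1) => (⟨e ⟨i, by have := i.2; simp; omega⟩, by
        apply ne_of_gt
        refine lt_of_lt_of_le hpos ?_
        unfold Matrix.IsHermitian.eigenvalues
        simp only [← he, Equiv.symm_apply_apply]
        apply hA.eigenvalues₀_antitone
        have := i.2
        show (i : ℕ) ≤ k'
        omega⟩ : {i // hA.eigenvalues i ≠ 0})) := by
        intro i j h
        simp at h
        exact Fin.ext h
      simpa using Fintype.card_le_of_injective _ hinj
    omega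
  have hs := hA.spectral_theorem
  rw [Unitary.conjStarAlgAut_apply, Matrix.star_eq_conjTranspose, Matrix.conjTranspose_eq_transpose_of_trivial] at hs
  ext a b
  rw [hs]
  rw [Matrix.mul_apply, Matrix.mul_apply]
  simp only [Matrix.mul_diagonal, Matrix.transpose_apply]
  symm
  refine Finset.sum_of_injOn (topIdx p m) (topIdx_inj p m).injOn (by simp) ?_ ?_
  · intro k _ hk
    have := hzero k (by simpa using hk)
    simp [this]
  · intro i _
    simp [eigvec, eigval]

/-- The domain of the eigenvalue functions: `l_1 > ... > l_r > 0`. -/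
def chamber (r : ℕ) : Set (Fin r → ℝ) :=
  {l | StrictAnti l ∧ ∀ i, 0 < l i}

/-- `H L Ψ(L) Hᵀ`. -/
def corr {m p : ℕ} (ψ : (Fin (min p m) → ℝ) → Fin (min p m) → ℝ) (u : Fin m → Fin p → ℝ) :
    Matrix (Fin p) (Fin p) ℝ :=
  eigvec u * Matrix.diagonal (eigval u) * Matrix.diagonal (ψ (eigval u)) * (eigvec u)ᵀ

/-- `H Ψ(L) Hᵀ`. -/
def shape {m p : ℕ} (ψ : (Fin (min p m) → ℝ) → Fin (min p m) → ℝ) (u : Fin m → Fin p → ℝ) :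
    Matrix (Fin p) (Fin p) ℝ :=
  eigvec u * Matrix.diagonal (ψ (eigval u)) * (eigvec u)ᵀ

/-- The squared Frobenius norm. -/
def frobSq {p k : ℕ} (A : Matrix (Fin p) (Fin k) ℝ) : ℝ :=
  ∑ i, ∑ j, A i j ^ 2

/-- The estimator `a_o S`. -/
def estOpt {q m p : ℕ} (f : ℝ → ℝ) (ω : Sample q m p) : Matrix (Fin p) (Fin p) ℝ :=
  aOpt q m p f • gramMat ω.2

/-- The orthogonally invariant estimator `a_o (S + H L Ψ(L) Hᵀ)`. -/
def estPsi {q m p : ℕ} (f : ℝ → ℝ) (ψ : (Fin (min p m) → ℝ) → Fin (min p m) → ℝ)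
    (ω : Sample q m p) : Matrix (Fin p) (Fin p) ℝ :=
  aOpt q m p f • (gramMat ω.2 + corr ψ ω.2)

/-- The data-based loss `tr (S⁺ Σ (Σ⁻¹ Σ̂ - I_p)²)` of an estimator at an observation. -/
def loss {q m p : ℕ} (Sig : Matrix (Fin p) (Fin p) ℝ)
    (est : Sample q m p → Matrix (Fin p) (Fin p) ℝ) (ω : Sample q m p) : ℝ :=
  (gramPinv ω.2 * Sig * (Sig⁻¹ * est ω - 1) ^ 2).trace

/-- The risk: expected loss under the elliptical law. -/
def risk {q m p : ℕ} (f : ℝ → ℝ) (θ : Matrix (Fin q) (Fin p) ℝ) (Sig : Matrix (Fin p) (Fin p) ℝ)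
    (est : Sample q m p → Matrix (Fin p) (Fin p) ℝ) : ℝ :=
  ∫ ω, loss Sig est ω ∂(law f θ Sig)

/-- `∂ψ_i / ∂l_i` at `l`. -/
def partialDiag {r : ℕ} (ψ : (Fin r → ℝ) → Fin r → ℝ) (l : Fin r → ℝ) (i : Fin r) : ℝ :=
  fderiv ℝ (fun x => ψ x i) l (Pi.single i 1)

/-- The function `g(Ψ)` evaluated at the eigenvalues `l`, with `r = min {p, m}` and
`v = max {p, m}`. -/
def gPsi (m p : ℕ) (lam : ℝ) (ψ : (Fin (min p m) → ℝ) → Fin (min p m) → ℝ)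
    (l : Fin (min p m) → ℝ) : ℝ :=
  (∑ i, (2 * (((max p m : ℕ) : ℝ) - ((min p m : ℕ) : ℝ) + 1) * ψ l i
      + (((max p m : ℕ) : ℝ) - ((min p m : ℕ) : ℝ) + 1) * ψ l i ^ 2
      + 4 * l i * (1 + ψ l i) * partialDiag ψ l i
      + ∑ j ∈ Finset.univ.erase i,
          (l i * (2 * ψ l i + ψ l i ^ 2) - l j * (2 * ψ l j + ψ l j ^ 2)) / (l i - l j)))
    - 2 * ((max p m : ℕ) : ℝ) * lam

end EllipticalCov

end

open EllipticalCov

/-! Written in the eigenbasis of `S`, the difference of the two losses is `a² tr(Σ⁻¹ H L Φ Hᵀ) - 2 a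
tr Ψ` with `Φ = 2Ψ + Ψ²` and `a = a_o`. The second term is bounded through `tr Ψ ≥ λ`. The first is
`a²` times `haffWeight`, and its expectation is controlled by a Stein–Haff inequality
(`integral_haffWeight_law_le`): `E[haffWeight] ≤ K* E*[h]` for every `E*`-integrable function `h` of
the eigenvalues that majorizes `haffDiv`, the divergence of the field `U H Φ(L) Hᵀ`. Formally this
is integration by parts in `u`: `F*' = -f/2`, and the derivative of the quadratic form along the
field is `2 haffWeight`. By `haffDiv_eq_gPsi` the divergence is `g(Ψ) + 2vλ`, and `a K* v = 1` makes
the constant `2vλ` cancel the trace term. Working with a majorant instead of the divergence gives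
the second conclusion without integrability of `g(Ψ)`: the constant `2vλ` is then an admissible `h`.

The pointwise part is perturbation theory on the open set `regular` of matrices whose `r` leading
eigenvalues are positive and distinct. Ky Fan's principle makes eigenvalues continuous, adjugates
express eigenprojections through them, and differentiating `S P = l P`, `P² = P` gives the
derivatives, hence the divergence (`sum_fderiv_spectralField`). The complement of `regular` is null:
sums of leading eigenvalues are locally Lipschitz, so differentiable almost everywhere, and a
coincidence of positive eigenvalues contradicts differentiability.

The analytic part justifies the integration by parts for a field that is only differentiable, only
on `regular`, with a divergence that need not be integrable. A gauge integral supplies the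
divergence theorem for compactly supported differentiable fields. The restrictions are then removed
in turn. Near coinciding eigenvalues the field is cut off by a function of the sum of inverse gaps;
that sum is locally integrable away from `l_i = 0` because `U` times a leading eigenprojection is a
monotone field with locally integrable divergence (`integrableOn_gapSum`). Continuous generating
functions are replaced by bounded measurable ones by `L¹` approximation. Near `l_i = 0` a
scale-invariant cutoff costs a multiple of `∑ |φ_i|`, integrable against the tail weight because
integrating out `z` dominates tails by the generating function itself
(`exists_lintegral_tail_quadForm_le`). Finally `f` is truncated in height and range and dominated
convergence concludes. -/

namespace EllipticalCov

open Finset Filter Topology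

/-! ### Spectral calculus of `S = Uᵀ U`. -/

/-- The orthogonal matrix of all eigenvectors of `Uᵀ U`. -/
noncomputable def eigBasis {m p : ℕ} (u : Fin m → Fin p → ℝ) : Matrix (Fin p) (Fin p) ℝ :=
  ((gramMat_isHermitian u).eigenvectorUnitary : Matrix (Fin p) (Fin p) ℝ)

/-- All eigenvalues of `Uᵀ U`. -/
noncomputable def allEig {m p : ℕ} (u : Fin m → Fin p → ℝ) : Fin p → ℝ :=
  (gramMat_isHermitian u).eigenvalues

/-- The matrix with eigenvalues `d` in the eigenbasis of `Uᵀ U`. -/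
noncomputable def spec {m p : ℕ} (u : Fin m → Fin p → ℝ) (d : Fin p → ℝ) : Matrix (Fin p) (Fin p) ℝ :=
  eigBasis u * Matrix.diagonal d * (eigBasis u)ᵀ

/-- The orthogonal projection on the `i`-th eigenvector of `Uᵀ U`. -/
noncomputable def eigProj {m p : ℕ} (u : Fin m → Fin p → ℝ) (i : Fin (min p m)) : Matrix (Fin p) (Fin p) ℝ :=
  spec u (Pi.single (topIdx p m i) 1)

section spec

variable {m p : ℕ} (u : Fin m → Fin p → ℝ)

theorem eigBasis_transpose_mul : (eigBasis u)ᵀ * eigBasis u = 1 := by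
  have hU := Unitary.coe_star_mul_self (gramMat_isHermitian u).eigenvectorUnitary
  rwa [Matrix.star_eq_conjTranspose, Matrix.conjTranspose_eq_transpose_of_trivial] at hU

theorem eigBasis_mul_transpose : eigBasis u * (eigBasis u)ᵀ = 1 :=
  mul_eq_one_comm.mp (eigBasis_transpose_mul u)

theorem gramMat_eq_spec : gramMat u = spec u (allEig u) := by
  have hs := (gramMat_isHermitian u).spectral_theorem
  rw [Unitary.conjStarAlgAut_apply, Matrix.star_eq_conjTranspose,
    Matrix.conjTranspose_eq_transpose_of_trivial] at hs
  simpa [spec, eigBasis, allEig] using hs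

theorem spec_mul (d e : Fin p → ℝ) : spec u d * spec u e = spec u (d * e) := by
  unfold spec
  calc _ = eigBasis u * Matrix.diagonal d * ((eigBasis u)ᵀ * eigBasis u) * Matrix.diagonal e *
        (eigBasis u)ᵀ := by simp only [Matrix.mul_assoc]
    _ = _ := by
      rw [eigBasis_transpose_mul, Matrix.mul_one, Matrix.mul_assoc (eigBasis u),
        Matrix.diagonal_mul_diagonal]
      rfl

theorem spec_transpose (d : Fin p → ℝ) : (spec u d)ᵀ = spec u d := by
  simp [spec, Matrix.transpose_mul, Matrix.mul_assoc]

theorem spec_trace (d : Fin p → ℝ) : (spec u d).trace = ∑ i, d i := by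
  unfold spec
  rw [Matrix.trace_mul_comm, ← Matrix.mul_assoc, eigBasis_transpose_mul, Matrix.one_mul,
    Matrix.trace_diagonal]

theorem spec_one : spec u 1 = 1 := by
  unfold spec
  rw [show (1 : Fin p → ℝ) = fun _ => 1 from rfl, Matrix.diagonal_one, Matrix.mul_one,
    eigBasis_mul_transpose]

theorem spec_add (d e : Fin p → ℝ) : spec u (d + e) = spec u d + spec u e := by
  unfold spec
  rw [← Matrix.add_mul, ← Matrix.mul_add, Matrix.diagonal_add]
  rfl

theorem spec_smul (c : ℝ) (d : Fin p → ℝ) : spec u (c • d) = c • spec u d := by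
  unfold spec
  rw [← Matrix.smul_mul, ← Matrix.mul_smul, Matrix.diagonal_smul]

/-- `spec` as a linear map. -/
noncomputable def specLin : (Fin p → ℝ) →ₗ[ℝ] Matrix (Fin p) (Fin p) ℝ where
  toFun := spec u
  map_add' := spec_add u
  map_smul' := spec_smul u

theorem spec_sub (d e : Fin p → ℝ) : spec u (d - e) = spec u d - spec u e :=
  (specLin u).map_sub d e

theorem spec_sum {ι : Type*} (s : Finset ι) (d : ι → Fin p → ℝ) :
    spec u (∑ i ∈ s, d i) = ∑ i ∈ s, spec u (d i) :=
  map_sum (specLin u) d s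

/-- The adjugate reverses products, and `adj V = det V • Vᵀ` for orthogonal `V`; the two scalars
`det V` multiply to one. Unlike an inverse, this applies to the singular matrix `l_i - S`. -/
theorem spec_adjugate (d : Fin p → ℝ) :
    (spec u d).adjugate = spec u fun b => ∏ c ∈ Finset.univ.erase b, d c := by
  have h1 : (eigBasis u)ᵀ.adjugate * (eigBasis u).adjugate = 1 := by
    rw [← Matrix.adjugate_mul_distrib, eigBasis_mul_transpose, Matrix.adjugate_one]
  have h2 : (eigBasis u).adjugate = (eigBasis u).det • (eigBasis u)ᵀ := by
    calc _ = (eigBasis u).adjugate * (eigBasis u * (eigBasis u)ᵀ) := by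
          rw [eigBasis_mul_transpose, Matrix.mul_one]
      _ = _ := by rw [← Matrix.mul_assoc, Matrix.adjugate_mul, Matrix.smul_mul, Matrix.one_mul]
  have h3 : (eigBasis u)ᵀ.adjugate = (eigBasis u).det • eigBasis u := by
    rw [← Matrix.adjugate_transpose, h2, Matrix.transpose_smul, Matrix.transpose_transpose]
  have h4 : (eigBasis u).det * (eigBasis u).det = 1 := by
    have := congrArg Matrix.det (eigBasis_transpose_mul u)
    simpa using this
  unfold spec
  rw [Matrix.adjugate_mul_distrib, Matrix.adjugate_mul_distrib, Matrix.adjugate_diagonal, h2, h3]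
  simp only [Matrix.smul_mul, Matrix.mul_smul, smul_smul, h4, one_smul, Matrix.mul_assoc]

theorem eigProj_apply (i : Fin (min p m)) (a b : Fin p) :
    eigProj u i a b = eigvec u a i * eigvec u b i := by
  unfold eigProj spec
  rw [Matrix.mul_apply, Finset.sum_eq_single (topIdx p m i)]
  · simp [eigvec, eigBasis]
  · intro c _ hc
    simp [hc]
  · simp

theorem eigProj_transpose (i : Fin (min p m)) : (eigProj u i)ᵀ = eigProj u i :=
  spec_transpose u _

theorem eigProj_mul_self (i : Fin (min p m)) : eigProj u i * eigProj u i = eigProj u i := by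
  unfold eigProj
  rw [spec_mul]
  congr 1
  ext b
  by_cases h : b = topIdx p m i <;> simp [h]

theorem eigProj_mul_of_ne {i j : Fin (min p m)} (h : i ≠ j) : eigProj u i * eigProj u j = 0 := by
  unfold eigProj
  rw [spec_mul]
  have : (Pi.single (topIdx p m i) 1 * Pi.single (topIdx p m j) 1 : Fin p → ℝ) = 0 := by
    ext b
    have := (topIdx_inj p m).ne h
    by_cases hb : b = topIdx p m i
    · simp [hb, this]
    · simp [Pi.single_apply, hb]
  rw [this]
  exact (specLin u).map_zero

theorem eigProj_mul (i j : Fin (min p m)) :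
    eigProj u i * eigProj u j = if i = j then eigProj u i else 0 := by
  split_ifs with h
  · rw [← h, eigProj_mul_self]
  · exact eigProj_mul_of_ne u h

theorem eigProj_trace (i : Fin (min p m)) : (eigProj u i).trace = 1 := by
  simp [eigProj, spec_trace]

theorem eigval_eq_allEig (i : Fin (min p m)) : eigval u i = allEig u (topIdx p m i) := rfl

theorem gramMat_mul_eigProj (i : Fin (min p m)) :
    gramMat u * eigProj u i = eigval u i • eigProj u i := by
  unfold eigProj
  rw [gramMat_eq_spec, spec_mul, ← spec_smul]
  congr 1
  ext b
  by_cases h : b = topIdx p m i <;> simp [h, eigval_eq_allEig]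

theorem eigProj_mul_gramMat (i : Fin (min p m)) :
    eigProj u i * gramMat u = eigval u i • eigProj u i := by
  unfold eigProj
  rw [gramMat_eq_spec, spec_mul, ← spec_smul]
  congr 1
  ext b
  by_cases h : b = topIdx p m i <;> simp [h, eigval_eq_allEig]

theorem eigvec_diagonal_mul (d : Fin (min p m) → ℝ) :
    eigvec u * Matrix.diagonal d * (eigvec u)ᵀ = ∑ i, d i • eigProj u i := by
  ext a b
  rw [Matrix.mul_apply, Matrix.sum_apply]
  refine Finset.sum_congr rfl fun i _ => ?_
  rw [Matrix.mul_diagonal, Matrix.transpose_apply, Matrix.smul_apply, eigProj_apply, smul_eq_mul]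
  ring

theorem gramMat_eq_sum : gramMat u = ∑ i, eigval u i • eigProj u i := by
  rw [gramMat_eq, eigvec_diagonal_mul]

theorem eigval_nonneg (i : Fin (min p m)) : 0 ≤ eigval u i :=
  (gramMat_posSemidef u).eigenvalues_nonneg _

theorem spec_injective : Function.Injective (spec u) := by
  intro d e h
  unfold spec at h
  have h2 := congrArg (fun M => (eigBasis u)ᵀ * M * eigBasis u) h
  simp only [Matrix.mul_assoc, eigBasis_transpose_mul, Matrix.mul_one] at h2
  simp only [← Matrix.mul_assoc, eigBasis_transpose_mul, Matrix.one_mul] at h2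
  exact Matrix.diagonal_injective h2

/-- Both sides are spectra of the same matrix in the same eigenbasis, and a spectrum is recovered
from its matrix. Hence every eigenvalue outside the top `r` positions vanishes. -/
theorem allEig_eq_sum : allEig u = ∑ i, eigval u i • Pi.single (topIdx p m i) 1 := by
  apply spec_injective u
  rw [← gramMat_eq_spec, spec_sum, gramMat_eq_sum]
  exact Finset.sum_congr rfl fun i _ => by rw [spec_smul]; rfl

theorem allEig_eq_zero {b : Fin p} (hb : ∀ i, topIdx p m i ≠ b) : allEig u b = 0 := by
  rw [allEig_eq_sum, Finset.sum_apply]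
  exact Finset.sum_eq_zero fun i _ => by simp [(hb i).symm]

/-- Sum over all eigenvalues, split into the top ones and the vanishing ones. -/
theorem sum_fun_allEig (F : ℝ → ℝ) :
    ∑ b, F (allEig u b) = ∑ i, F (eigval u i) + ((p : ℝ) - (min p m : ℕ)) * F 0 := by
  classical
  have h1 : ∑ b, F (allEig u b) - ∑ b : Fin p, F 0 = ∑ i, (F (eigval u i) - F 0) := by
    rw [← Finset.sum_sub_distrib]
    symm
    refine Finset.sum_of_injOn (topIdx p m) (topIdx_inj p m).injOn (by simp) ?_ ?_
    · intro b _ hb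
      rw [allEig_eq_zero u (b := b) (by simpa using hb), sub_self]
    · intro i _
      rfl
  simp only [Finset.sum_sub_distrib, Finset.sum_const, Finset.card_univ, Fintype.card_fin,
    nsmul_eq_mul] at h1
  linarith

end spec

/-! ### Ky Fan's principle and continuity of the eigenvalues. -/

section KyFan

theorem trace_transpose_mul_self_nonneg {n k : ℕ} (A : Matrix (Fin n) (Fin k) ℝ) :
    0 ≤ (Aᵀ * A).trace := by
  rw [Matrix.trace]
  refine Finset.sum_nonneg fun i _ => ?_
  rw [Matrix.diag_apply, Matrix.mul_apply]
  exact Finset.sum_nonneg fun j _ => by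
    rw [Matrix.transpose_apply]; exact mul_self_nonneg _

/-- For orthogonal projections, `tr (A B)` is the squared Frobenius norm of `B A`. -/
theorem trace_mul_nonneg_of_proj {p : ℕ} {A B : Matrix (Fin p) (Fin p) ℝ} (hA : Aᵀ = A)
    (hA2 : A * A = A) (hB : Bᵀ = B) (hB2 : B * B = B) : 0 ≤ (A * B).trace := by
  have h := trace_transpose_mul_self_nonneg (B * A)
  rw [Matrix.transpose_mul, hA, hB, Matrix.mul_assoc, ← Matrix.mul_assoc B, hB2,
    Matrix.trace_mul_comm, Matrix.mul_assoc, hA2, Matrix.trace_mul_comm] at h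
  exact h

/-- Idempotence and symmetry give `A a a = ∑ c, A a c ^ 2`. This forces `A a a ≤ 1`, and then bounds
every entry in the row. -/
theorem abs_apply_le_one_of_proj {p : ℕ} {A : Matrix (Fin p) (Fin p) ℝ} (hA : Aᵀ = A)
    (hA2 : A * A = A) (a b : Fin p) : |A a b| ≤ 1 := by
  have hsum : ∀ a, A a a = ∑ c, A a c ^ 2 := by
    intro a
    conv_lhs => rw [← hA2, Matrix.mul_apply]
    refine Finset.sum_congr rfl fun c _ => ?_
    rw [sq]
    conv_lhs => rw [← hA, Matrix.transpose_apply, Matrix.transpose_apply]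
    rw [← Matrix.transpose_apply A, hA]
  have hle : ∀ c, A a c ^ 2 ≤ A a a := fun c => by
    rw [hsum a]
    exact Finset.single_le_sum (f := fun c => A a c ^ 2) (fun _ _ => sq_nonneg _)
      (Finset.mem_univ c)
  have h1 := hle a
  have h2 := hle b
  rw [← sq_le_one_iff_abs_le_one]
  nlinarith [sq_nonneg (A a a - 1)]

variable {m p : ℕ} (u w : Fin m → Fin p → ℝ)

theorem sum_eigProj_transpose (s : Finset (Fin (min p m))) :
    (∑ i ∈ s, eigProj u i)ᵀ = ∑ i ∈ s, eigProj u i := by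
  rw [Matrix.transpose_sum]
  exact Finset.sum_congr rfl fun i _ => eigProj_transpose u i

theorem sum_eigProj_mul_self (s : Finset (Fin (min p m))) :
    (∑ i ∈ s, eigProj u i) * (∑ i ∈ s, eigProj u i) = ∑ i ∈ s, eigProj u i := by
  rw [Finset.sum_mul_sum]
  refine Finset.sum_congr rfl fun i hi => ?_
  rw [Finset.sum_eq_single i]
  · exact eigProj_mul_self u i
  · intro j _ hj; exact eigProj_mul_of_ne u hj.symm
  · exact fun h => absurd hi h

theorem sum_trace_mul_eigProj_le {W : Matrix (Fin p) (Fin p) ℝ} (hW : Wᵀ = W) (hW2 : W * W = W)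
    (s : Finset (Fin (min p m))) : ∑ j ∈ s, (W * eigProj u j).trace ≤ W.trace := by
  have h := trace_mul_nonneg_of_proj (A := W) (B := 1 - ∑ j ∈ s, eigProj u j) hW hW2
    (by rw [Matrix.transpose_sub, Matrix.transpose_one, sum_eigProj_transpose])
    (by
      rw [Matrix.sub_mul, Matrix.mul_sub, Matrix.mul_sub, sum_eigProj_mul_self]
      simp)
  rw [Matrix.mul_sub, Matrix.mul_one, Matrix.trace_sub, Matrix.mul_sum, Matrix.trace_sum] at h
  linarith

/-- The rearrangement step in Ky Fan's maximum principle. -/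
theorem sum_mul_le_sum_top {r : ℕ} {l a : Fin r → ℝ} (hl : Antitone l) (hl0 : ∀ i, 0 ≤ l i)
    (ha0 : ∀ i, 0 ≤ a i) (ha1 : ∀ i, a i ≤ 1) (k : ℕ) (hk : ∑ i, a i ≤ k) :
    ∑ i, l i * a i ≤ ∑ i ∈ univ.filter (fun i : Fin r => (i : ℕ) < k), l i := by
  -- The threshold `t` is the first eigenvalue left out, `l k`. If `k ≥ r` nothing is left out, and
  -- `t = 0` makes the last clause true although only `r` indices are counted.
  obtain ⟨t, ht0, ht1, ht2, ht3⟩ : ∃ t : ℝ, 0 ≤ t ∧ (∀ i : Fin r, (i : ℕ) < k → t ≤ l i) ∧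
      (∀ i : Fin r, k ≤ (i : ℕ) → l i ≤ t) ∧
      t * k = t * (univ.filter (fun i : Fin r => (i : ℕ) < k)).card := by
    by_cases h : k < r
    · refine ⟨l ⟨k, h⟩, hl0 _, fun i hi => hl (by exact hi.le), fun i hi => hl (by exact hi), ?_⟩
      rw [Fin.card_filter_val_lt]
      simp [h.le]
    · refine ⟨0, le_rfl, fun i _ => hl0 i, fun i hi => ?_, by simp⟩
      exact absurd i.2 (by omega)
  calc ∑ i, l i * a i = ∑ i, (l i - t) * a i + t * ∑ i, a i := by
        rw [Finset.mul_sum, ← Finset.sum_add_distrib]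
        exact Finset.sum_congr rfl fun i _ => by ring
    _ ≤ ∑ i : Fin r, (if (i : ℕ) < k then l i - t else 0) + t * k := by
        refine add_le_add (Finset.sum_le_sum fun i _ => ?_) (mul_le_mul_of_nonneg_left hk ht0)
        split_ifs with h
        · have := ht1 i h
          nlinarith [ha1 i]
        · have := ht2 i (not_lt.mp h)
          nlinarith [ha0 i]
    _ = _ := by
        rw [← Finset.sum_filter, Finset.sum_sub_distrib, ht3, Finset.sum_const, nsmul_eq_mul]
        ring

/-- The sum of the `k` largest eigenvalues. -/
noncomputable def topSum (k : ℕ) : ℝ := ∑ i ∈ univ.filter (fun i : Fin (min p m) => (i : ℕ) < k), eigval u i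

/-- The projection on the `k` leading eigenvectors. -/
noncomputable def topProj (k : ℕ) : Matrix (Fin p) (Fin p) ℝ :=
  ∑ i ∈ univ.filter (fun i : Fin (min p m) => (i : ℕ) < k), eigProj u i

/-- Ky Fan's maximum principle. -/
theorem trace_mul_gramMat_le {W : Matrix (Fin p) (Fin p) ℝ} (hW : Wᵀ = W) (hW2 : W * W = W)
    (k : ℕ) (hk : W.trace ≤ k) : (W * gramMat u).trace ≤ topSum u k := by
  have h1 : (W * gramMat u).trace = ∑ j, eigval u j * (W * eigProj u j).trace := by
    conv_lhs => rw [gramMat_eq_sum, Matrix.mul_sum, Matrix.trace_sum]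
    exact Finset.sum_congr rfl fun j _ => by rw [Matrix.mul_smul, Matrix.trace_smul, smul_eq_mul]
  rw [h1]
  -- The weights `tr (W P_j)` lie in `[0, 1]` and add up to at most `tr W ≤ k`.
  refine sum_mul_le_sum_top (eigval_antitone u) (eigval_nonneg u)
    (fun j => trace_mul_nonneg_of_proj hW hW2 (eigProj_transpose u j) (eigProj_mul_self u j))
    (fun j => ?_) k ((sum_trace_mul_eigProj_le u hW hW2 _).trans hk)
  have h2 := trace_mul_nonneg_of_proj (A := 1 - W) (B := eigProj u j)
    (by rw [Matrix.transpose_sub, Matrix.transpose_one, hW])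
    (by rw [Matrix.sub_mul, Matrix.mul_sub, Matrix.mul_sub, hW2]; simp)
    (eigProj_transpose u j) (eigProj_mul_self u j)
  rw [Matrix.sub_mul, Matrix.one_mul, Matrix.trace_sub, eigProj_trace] at h2
  linarith

theorem trace_sum_eigProj (s : Finset (Fin (min p m))) :
    (∑ i ∈ s, eigProj u i).trace = s.card := by
  rw [Matrix.trace_sum]
  simp [eigProj_trace]

theorem topProj_transpose (k : ℕ) : (topProj u k)ᵀ = topProj u k := sum_eigProj_transpose u _

theorem topProj_mul_self (k : ℕ) : topProj u k * topProj u k = topProj u k :=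
  sum_eigProj_mul_self u _

theorem trace_topProj_le (k : ℕ) : (topProj u k).trace ≤ k := by
  rw [topProj, trace_sum_eigProj, Fin.card_filter_val_lt]
  exact_mod_cast min_le_right _ _

theorem trace_sum_eigProj_mul_gramMat (s : Finset (Fin (min p m))) :
    ((∑ i ∈ s, eigProj u i) * gramMat u).trace = ∑ i ∈ s, eigval u i := by
  rw [Finset.sum_mul, Matrix.trace_sum]
  exact Finset.sum_congr rfl fun j _ => by
    rw [eigProj_mul_gramMat, Matrix.trace_smul, eigProj_trace, smul_eq_mul, mul_one]

theorem trace_topProj_mul_gramMat (k : ℕ) : (topProj u k * gramMat u).trace = topSum u k :=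
  trace_sum_eigProj_mul_gramMat u _

/-- The leading projection of `u` is optimal for `u` and merely admissible for `w`, so the
difference is at most its pairing with `S_u - S_w`, whose coefficients are at most one in absolute
value. -/
theorem topSum_sub_le (k : ℕ) :
    topSum u k - topSum w k ≤ ∑ a, ∑ b, |gramMat u a b - gramMat w a b| := by
  have h1 := trace_mul_gramMat_le w (topProj_transpose u k) (topProj_mul_self u k) k
    (trace_topProj_le u k)
  have h2 := trace_topProj_mul_gramMat u k
  calc topSum u k - topSum w k ≤ (topProj u k * (gramMat u - gramMat w)).trace := by
        rw [Matrix.mul_sub, Matrix.trace_sub]; linarith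
    _ = ∑ a, ∑ b, topProj u k a b * (gramMat u - gramMat w) b a := by
        rw [Matrix.trace]
        exact Finset.sum_congr rfl fun a _ => by rw [Matrix.diag_apply, Matrix.mul_apply]
    _ ≤ ∑ a, ∑ b, |gramMat u b a - gramMat w b a| := by
        refine Finset.sum_le_sum fun a _ => Finset.sum_le_sum fun b _ => ?_
        refine (le_abs_self _).trans ?_
        rw [abs_mul, Matrix.sub_apply]
        exact mul_le_of_le_one_left (abs_nonneg _)
          (abs_apply_le_one_of_proj (topProj_transpose u k) (topProj_mul_self u k) a b)
    _ = _ := Finset.sum_comm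

theorem abs_topSum_sub_le (k : ℕ) :
    |topSum u k - topSum w k| ≤ ∑ a, ∑ b, |gramMat u a b - gramMat w a b| := by
  rw [abs_sub_le_iff]
  refine ⟨topSum_sub_le u w k, ?_⟩
  simp_rw [abs_sub_comm (gramMat u _ _)]
  exact topSum_sub_le w u k

theorem continuous_gramMat_apply (a b : Fin p) :
    Continuous fun u : Fin m → Fin p → ℝ => gramMat u a b := by
  simp only [gramMat, Matrix.mul_apply, Matrix.transpose_apply, Matrix.of_apply]
  fun_prop

theorem continuous_gramMat : Continuous fun u : Fin m → Fin p → ℝ => gramMat u :=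
  continuous_matrix fun a b => continuous_gramMat_apply a b

theorem continuous_topSum (k : ℕ) : Continuous fun u : Fin m → Fin p → ℝ => topSum u k := by
  rw [continuous_iff_continuousAt]
  intro w
  rw [ContinuousAt, tendsto_iff_dist_tendsto_zero]
  have h : Tendsto (fun u : Fin m → Fin p → ℝ => ∑ a, ∑ b, |gramMat u a b - gramMat w a b|)
      (𝓝 w) (𝓝 0) := by
    have hc : Continuous fun u : Fin m → Fin p → ℝ => ∑ a, ∑ b, |gramMat u a b - gramMat w a b| := by
      have := continuous_gramMat_apply (m := m) (p := p)
      fun_prop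
    have := hc.tendsto w
    simpa using this
  exact squeeze_zero (fun _ => dist_nonneg) (fun u => abs_topSum_sub_le u w k) h

theorem eigval_eq_topSum_sub (i : Fin (min p m)) :
    eigval u i = topSum u (i + 1) - topSum u i := by
  have : univ.filter (fun j : Fin (min p m) => (j : ℕ) < i + 1) =
      insert i (univ.filter (fun j : Fin (min p m) => (j : ℕ) < i)) := by
    ext j
    simp [Fin.ext_iff]
    omega
  rw [topSum, topSum, this, Finset.sum_insert (by simp)]
  ring

/-- A single eigenvalue is a difference of consecutive Ky Fan sums, each of which is Lipschitz in
the entries of `S`. -/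
theorem continuous_eigval_apply (i : Fin (min p m)) :
    Continuous fun u : Fin m → Fin p → ℝ => eigval u i := by
  simp_rw [eigval_eq_topSum_sub]
  exact (continuous_topSum _).sub (continuous_topSum _)

theorem continuous_eigval : Continuous fun u : Fin m → Fin p → ℝ => eigval u :=
  continuous_pi continuous_eigval_apply

theorem isOpen_chamber (r : ℕ) : IsOpen (chamber r) := by
  have : chamber r = (⋂ i, ⋂ j, {l : Fin r → ℝ | i < j → l j < l i}) ∩ ⋂ i, {l | 0 < l i} := by
    ext l
    simp [chamber, StrictAnti]
  rw [this]
  refine IsOpen.inter (isOpen_iInter_of_finite fun i => isOpen_iInter_of_finite fun j => ?_)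
    (isOpen_iInter_of_finite fun i => isOpen_lt continuous_const (continuous_apply i))
  by_cases h : i < j
  · simpa [h] using isOpen_lt (continuous_apply (A := fun _ : Fin r => ℝ) j) (continuous_apply i)
  · simp [h]

variable (m p) in
/-- The matrices `U` for which the nonzero eigenvalues of `Uᵀ U` are distinct and `r` in number. -/
def regular : Set (Fin m → Fin p → ℝ) := {u | eigval u ∈ chamber (min p m)}

theorem isOpen_regular : IsOpen (regular m p) := (isOpen_chamber _).preimage continuous_eigval

end KyFan

/-! ### Eigenprojections as rational functions of `S` and its eigenvalues. -/

section adjugate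

variable {m p : ℕ} {u : Fin m → Fin p → ℝ}

theorem eigval_ne_allEig (hu : u ∈ regular m p) (i : Fin (min p m)) {b : Fin p}
    (hb : b ≠ topIdx p m i) : eigval u i ≠ allEig u b := by
  by_cases h : ∃ j, topIdx p m j = b
  · obtain ⟨j, rfl⟩ := h
    rw [← eigval_eq_allEig]
    intro h
    exact hb (by rw [hu.1.injective h])
  · rw [allEig_eq_zero u (by simpa using h)]
    exact (hu.2 i).ne'

/-- In the eigenbasis `l_i - S` is diagonal with a zero in position `i`, so only the `i`-th
complementary product can survive in its adjugate. When `l_i` is simple, normalizing by the trace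
recovers `P_i`, which thus inherits the regularity of `l_i`. -/
theorem adjugate_eigval_sub (u : Fin m → Fin p → ℝ) (i : Fin (min p m)) :
    (eigval u i • 1 - gramMat u).adjugate =
      (∏ c ∈ univ.erase (topIdx p m i), (eigval u i - allEig u c)) • eigProj u i := by
  conv_lhs => rw [gramMat_eq_spec, ← spec_one u, ← spec_smul, ← spec_sub, spec_adjugate]
  rw [eigProj, ← spec_smul]
  congr 1
  ext b
  by_cases hb : b = topIdx p m i
  · subst hb
    simp
  · rw [Pi.smul_apply, Pi.single_eq_of_ne hb, smul_zero]
    exact Finset.prod_eq_zero (i := topIdx p m i) (by simp [Ne.symm hb])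
      (by simp [eigval_eq_allEig])

theorem adjugate_trace_ne_zero (hu : u ∈ regular m p) (i : Fin (min p m)) :
    (eigval u i • 1 - gramMat u).adjugate.trace ≠ 0 := by
  rw [adjugate_eigval_sub, Matrix.trace_smul, eigProj_trace, smul_eq_mul, mul_one]
  exact Finset.prod_ne_zero_iff.mpr fun c hc =>
    sub_ne_zero.mpr (eigval_ne_allEig hu i (Finset.ne_of_mem_erase hc))

theorem eigProj_eq_adjugate (hu : u ∈ regular m p) (i : Fin (min p m)) :
    eigProj u i = ((eigval u i • 1 - gramMat u).adjugate.trace)⁻¹ •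
      (eigval u i • 1 - gramMat u).adjugate := by
  have h := adjugate_trace_ne_zero hu i
  rw [adjugate_eigval_sub, Matrix.trace_smul, eigProj_trace, smul_eq_mul, mul_one] at h ⊢
  rw [smul_smul, inv_mul_cancel₀ h, one_smul]

theorem continuousAt_eigProj (hu : u ∈ regular m p) (i : Fin (min p m)) :
    ContinuousAt (fun w => eigProj w i) u := by
  have h1 : Continuous fun w : Fin m → Fin p → ℝ => (eigval w i • 1 - gramMat w).adjugate :=
    (((continuous_eigval_apply i).smul continuous_const).sub continuous_gramMat).matrix_adjugate
  have h2 : ContinuousAt (fun w => ((eigval w i • 1 - gramMat w).adjugate.trace)⁻¹ •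
      (eigval w i • 1 - gramMat w).adjugate) u :=
    (h1.matrix_trace.continuousAt.inv₀ (adjugate_trace_ne_zero hu i)).smul h1.continuousAt
  refine h2.congr ?_
  filter_upwards [isOpen_regular.mem_nhds hu] with w hw
  exact (eigProj_eq_adjugate hw i).symm

theorem continuousAt_eigProj_apply (hu : u ∈ regular m p) (i : Fin (min p m)) (a b : Fin p) :
    ContinuousAt (fun w => eigProj w i a b) u := by
  have h := continuousAt_eigProj hu i
  exact (continuousAt_pi.mp (continuousAt_pi.mp h a) b)

end adjugate

/-! ### Differentiability and first-order perturbation of eigenvalues and eigenprojections. -/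

section matDeriv

/-- Entrywise derivative of a matrix-valued function of a real variable. -/
def HasMatDerivAt {n k : ℕ} (A : ℝ → Matrix (Fin n) (Fin k) ℝ) (A' : Matrix (Fin n) (Fin k) ℝ)
    (t : ℝ) : Prop :=
  ∀ a b, HasDerivAt (fun s => A s a b) (A' a b) t

variable {n k o : ℕ} {t : ℝ}

theorem HasMatDerivAt.mul {A : ℝ → Matrix (Fin n) (Fin k) ℝ} {A' : Matrix (Fin n) (Fin k) ℝ}
    {B : ℝ → Matrix (Fin k) (Fin o) ℝ} {B' : Matrix (Fin k) (Fin o) ℝ}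
    (hA : HasMatDerivAt A A' t) (hB : HasMatDerivAt B B' t) :
    HasMatDerivAt (fun s => A s * B s) (A' * B t + A t * B') t := by
  intro a b
  have : HasDerivAt (fun s => ∑ c, A s a c * B s c b)
      (∑ c, (A' a c * B t c b + A t a c * B' c b)) t :=
    HasDerivAt.fun_sum fun c _ => (hA a c).mul (hB c b)
  simpa [Matrix.mul_apply, Matrix.add_apply, Finset.sum_add_distrib] using this

theorem HasMatDerivAt.smul {c : ℝ → ℝ} {c' : ℝ} {A : ℝ → Matrix (Fin n) (Fin k) ℝ}
    {A' : Matrix (Fin n) (Fin k) ℝ} (hc : HasDerivAt c c' t) (hA : HasMatDerivAt A A' t) :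
    HasMatDerivAt (fun s => c s • A s) (c' • A t + c t • A') t := by
  intro a b
  exact hc.mul (hA a b)

theorem HasMatDerivAt.transpose {A : ℝ → Matrix (Fin n) (Fin k) ℝ}
    {A' : Matrix (Fin n) (Fin k) ℝ} (hA : HasMatDerivAt A A' t) :
    HasMatDerivAt (fun s => (A s)ᵀ) A'ᵀ t := fun a b => hA b a

theorem HasMatDerivAt.unique {A : ℝ → Matrix (Fin n) (Fin k) ℝ}
    {A' A'' : Matrix (Fin n) (Fin k) ℝ} (h : HasMatDerivAt A A' t) (h' : HasMatDerivAt A A'' t) :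
    A' = A'' := by
  ext a b
  exact (h a b).unique (h' a b)

theorem HasMatDerivAt.congr {A B : ℝ → Matrix (Fin n) (Fin k) ℝ}
    {A' : Matrix (Fin n) (Fin k) ℝ} (h : HasMatDerivAt A A' t) (hAB : A = B) :
    HasMatDerivAt B A' t := hAB ▸ h

end matDeriv

/-- Since `d` vanishes at `x`, the increment of `c` enters only as `o(1) · O(‖y - x‖)`, so the
derivative is `c x • d'(x)`. This upgrades continuity of eigenprojections to differentiability of
eigenvalues. -/
theorem differentiableAt_mul_of_continuousAt {E : Type*} [NormedAddCommGroup E] [NormedSpace ℝ E]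
    {c d : E → ℝ} {x : E} (hc : ContinuousAt c x) (hd : DifferentiableAt ℝ d x) (h0 : d x = 0) :
    DifferentiableAt ℝ (fun y => c y * d y) x := by
  refine ⟨c x • fderiv ℝ d x, ?_⟩
  have h1 := hd.hasFDerivAt
  rw [hasFDerivAt_iff_isLittleO] at h1 ⊢
  have h2 : (fun y => d y) =O[𝓝 x] fun y => y - x := by
    have := hd.hasFDerivAt.isBigO_sub
    simpa [h0] using this
  have h3 : (fun y => c y - c x) =o[𝓝 x] fun _ => (1 : ℝ) := by
    rw [Asymptotics.isLittleO_one_iff]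
    simpa using hc.sub_const (c x)
  have h4 : (fun y => (c y - c x) * d y) =o[𝓝 x] fun y => y - x := by
    have := h3.mul_isBigO h2.norm_right
    simpa using this
  have h5 := (h1.const_mul_left (c x)).add h4
  refine h5.congr_left fun y => ?_
  simp [h0]
  ring

theorem differentiableAt_det {E : Type*} [NormedAddCommGroup E] [NormedSpace ℝ E] {p : ℕ}
    {A : E → Matrix (Fin p) (Fin p) ℝ} {x : E}
    (h : ∀ a b, DifferentiableAt ℝ (fun y => A y a b) x) :
    DifferentiableAt ℝ (fun y => (A y).det) x := by
  simp only [Matrix.det_apply]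
  refine DifferentiableAt.fun_sum fun σ _ => ?_
  refine DifferentiableAt.const_smul ?_ _
  have := HasFDerivAt.finsetProd (u := univ) fun i _ => (h (σ i) i).hasFDerivAt
  exact this.differentiableAt

theorem differentiableAt_adjugate_apply {E : Type*} [NormedAddCommGroup E] [NormedSpace ℝ E]
    {p : ℕ} {A : E → Matrix (Fin p) (Fin p) ℝ} {x : E}
    (h : ∀ a b, DifferentiableAt ℝ (fun y => A y a b) x) (a b : Fin p) :
    DifferentiableAt ℝ (fun y => (A y).adjugate a b) x := by
  simp only [Matrix.adjugate_apply]
  refine differentiableAt_det fun c d => ?_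
  by_cases hc : c = b
  · simp [hc]
  · simpa [Matrix.updateRow_apply, hc] using h c d

section

variable {m p : ℕ} {u : Fin m → Fin p → ℝ}

theorem differentiable_gramMat_apply (a b : Fin p) :
    Differentiable ℝ fun u : Fin m → Fin p → ℝ => gramMat u a b := by
  simp only [gramMat, Matrix.mul_apply, Matrix.transpose_apply, Matrix.of_apply]
  fun_prop

/-- The exact identity `(l_i(w) - l_i(u)) tr(P_w P_u) = tr(P_w P_u (S_w - S_u))` holds because `P_w`
and `P_u` are eigenprojections of `S_w` and `S_u`. Near `u` the trace on the left is close to one,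
and on the right a continuous factor multiplies a differentiable one vanishing at `u`. No implicit
function theorem is needed. -/
theorem differentiableAt_eigval_apply (hu : u ∈ regular m p) (i : Fin (min p m)) :
    DifferentiableAt ℝ (fun w => eigval w i) u := by
  let τ : (Fin m → Fin p → ℝ) → ℝ := fun w => (eigProj w i * eigProj u i).trace
  have hcP : ∀ a b, ContinuousAt (fun w => (eigProj w i * eigProj u i) a b) u := by
    intro a b
    simp only [Matrix.mul_apply]
    have := continuousAt_eigProj_apply hu i
    exact tendsto_finsetSum _ fun c _ => (this a c).mul continuousAt_const
  have hτ : ContinuousAt τ u := tendsto_finsetSum _ fun a _ => hcP a a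
  have hτu : τ u = 1 := by simp [τ, eigProj_mul_self, eigProj_trace]
  have hτ0 : ∀ᶠ w in 𝓝 u, τ w ≠ 0 := hτ.eventually_ne (by rw [hτu]; exact one_ne_zero)
  have hd : DifferentiableAt ℝ (fun w => eigval u i + ∑ a, ∑ b,
      ((τ w)⁻¹ * (eigProj w i * eigProj u i) a b) * (gramMat w b a - gramMat u b a)) u := by
    refine (differentiableAt_const _).add ?_
    refine DifferentiableAt.fun_sum fun a _ => DifferentiableAt.fun_sum fun b _ => ?_
    refine differentiableAt_mul_of_continuousAt ?_ ?_ (by simp)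
    · exact (hτ.inv₀ (by rw [hτu]; exact one_ne_zero)).mul (hcP a b)
    · exact (differentiable_gramMat_apply b a u).sub_const _
  refine hd.congr_of_eventuallyEq ?_
  filter_upwards [hτ0] with w hw
  have h1 : ∑ a, ∑ b, (eigProj w i * eigProj u i) a b * (gramMat w b a - gramMat u b a) =
      (eigval w i - eigval u i) * τ w := by
    calc _ = (eigProj w i * eigProj u i * (gramMat w - gramMat u)).trace := by
          rw [Matrix.trace]
          exact Finset.sum_congr rfl fun a _ => by rw [Matrix.diag_apply, Matrix.mul_apply]; rfl
      _ = _ := by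
          rw [Matrix.mul_sub, Matrix.trace_sub, Matrix.mul_assoc _ _ (gramMat u),
            eigProj_mul_gramMat, Matrix.trace_mul_comm _ (gramMat w), ← Matrix.mul_assoc,
            gramMat_mul_eigProj]
          simp only [Matrix.smul_mul, Matrix.mul_smul, Matrix.trace_smul, smul_eq_mul, τ]
          ring
  simp only [mul_assoc, ← Finset.mul_sum, h1]
  field_simp
  ring

theorem differentiableAt_eigval (hu : u ∈ regular m p) :
    DifferentiableAt ℝ (fun w : Fin m → Fin p → ℝ => eigval w) u :=
  differentiableAt_pi.mpr fun i => differentiableAt_eigval_apply hu i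

theorem differentiableAt_eigProj_apply (hu : u ∈ regular m p) (i : Fin (min p m)) (a b : Fin p) :
    DifferentiableAt ℝ (fun w => eigProj w i a b) u := by
  have hA : ∀ a b, DifferentiableAt ℝ
      (fun w => (eigval w i • (1 : Matrix (Fin p) (Fin p) ℝ) - gramMat w) a b) u := by
    intro a b
    simp only [Matrix.sub_apply, Matrix.smul_apply, smul_eq_mul]
    exact ((differentiableAt_eigval_apply hu i).mul_const _).sub (differentiable_gramMat_apply a b u)
  have hadj := fun a b => differentiableAt_adjugate_apply hA a b
  have htr : DifferentiableAt ℝ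
      (fun w => (eigval w i • (1 : Matrix (Fin p) (Fin p) ℝ) - gramMat w).adjugate.trace) u := by
    simp only [Matrix.trace, Matrix.diag_apply]
    exact DifferentiableAt.fun_sum fun c _ => hadj c c
  refine ((htr.inv (adjugate_trace_ne_zero hu i)).mul (hadj a b)).congr_of_eventuallyEq ?_
  filter_upwards [isOpen_regular.mem_nhds hu] with w hw
  rw [eigProj_eq_adjugate hw i]
  rfl

/-- The reduced resolvent of `Uᵀ U` at its `i`-th eigenvalue. -/
noncomputable def reducedResolvent {m p : ℕ} (u : Fin m → Fin p → ℝ) (i : Fin (min p m)) :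
    Matrix (Fin p) (Fin p) ℝ :=
  spec u fun b => (eigval u i - allEig u b)⁻¹

/-- The convention `0⁻¹ = 0` puts a zero in position `i` of the spectrum, which makes
`reducedResolvent` the pseudo-inverse of `l_i - S` when `l_i` is simple. -/
theorem reducedResolvent_mul_eigProj (u : Fin m → Fin p → ℝ) (i : Fin (min p m)) :
    reducedResolvent u i * eigProj u i = 0 := by
  rw [reducedResolvent, eigProj, spec_mul]
  refine Eq.trans (congrArg (spec u) ?_) (specLin u).map_zero
  ext b
  by_cases h : b = topIdx p m i <;> simp [h, eigval_eq_allEig]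

theorem reducedResolvent_mul_gramMat (hu : u ∈ regular m p) (i : Fin (min p m)) :
    reducedResolvent u i * gramMat u =
      eigval u i • reducedResolvent u i - 1 + eigProj u i := by
  rw [reducedResolvent, eigProj, ← spec_one u, gramMat_eq_spec, spec_mul, ← spec_smul, ← spec_sub,
    ← spec_add]
  congr 1
  ext b
  by_cases h : b = topIdx p m i
  · simp [h, eigval_eq_allEig]
  · have := sub_ne_zero.mpr (eigval_ne_allEig hu i h)
    simp [h]
    field_simp
    ring

theorem reducedResolvent_transpose (u : Fin m → Fin p → ℝ) (i : Fin (min p m)) :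
    (reducedResolvent u i)ᵀ = reducedResolvent u i := spec_transpose u _

/-- The term `j = i` is `0⁻¹ = 0`; each of the `p - r` eigenvalues outside the top positions is zero
and contributes `l_i⁻¹`. -/
theorem trace_reducedResolvent (u : Fin m → Fin p → ℝ) (i : Fin (min p m)) :
    (reducedResolvent u i).trace =
      ∑ j, (eigval u i - eigval u j)⁻¹ + ((p : ℝ) - (min p m : ℕ)) * (eigval u i)⁻¹ := by
  rw [reducedResolvent, spec_trace, sum_fun_allEig u fun x => (eigval u i - x)⁻¹]
  simp

variable (B : Fin m → Fin p → ℝ)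

/-- The derivative of `Uᵀ U` in the direction `B`. -/
def gramDeriv {m p : ℕ} (u B : Fin m → Fin p → ℝ) : Matrix (Fin p) (Fin p) ℝ :=
  (Matrix.of B)ᵀ * Matrix.of u + (Matrix.of u)ᵀ * Matrix.of B

theorem gramDeriv_transpose (u B : Fin m → Fin p → ℝ) : (gramDeriv u B)ᵀ = gramDeriv u B := by
  simp [gramDeriv, Matrix.transpose_mul, add_comm]

theorem hasMatDerivAt_line (u B : Fin m → Fin p → ℝ) :
    HasMatDerivAt (fun t : ℝ => Matrix.of (u + t • B)) (Matrix.of B) 0 := by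
  intro k a
  simpa using ((hasDerivAt_id (0 : ℝ)).mul_const (B k a)).const_add (u k a)

theorem hasMatDerivAt_gramMat (u B : Fin m → Fin p → ℝ) :
    HasMatDerivAt (fun t : ℝ => gramMat (u + t • B)) (gramDeriv u B) 0 := by
  have := (hasMatDerivAt_line u B).transpose.mul (hasMatDerivAt_line u B)
  simpa [gramDeriv, gramMat] using this

/-- The derivative of the `i`-th eigenvalue in the direction `B`. -/
noncomputable def eigvalDeriv {m p : ℕ} (u B : Fin m → Fin p → ℝ) (i : Fin (min p m)) : ℝ :=
  (eigProj u i * gramDeriv u B).trace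

/-- The derivative of the `i`-th eigenprojection in the direction `B`. -/
noncomputable def eigProjDeriv {m p : ℕ} (u B : Fin m → Fin p → ℝ) (i : Fin (min p m)) :
    Matrix (Fin p) (Fin p) ℝ :=
  reducedResolvent u i * gramDeriv u B * eigProj u i +
    eigProj u i * gramDeriv u B * reducedResolvent u i

theorem hasDerivAt_line_of_differentiableAt {F : (Fin m → Fin p → ℝ) → ℝ}
    (hF : DifferentiableAt ℝ F u) (B : Fin m → Fin p → ℝ) :
    HasDerivAt (fun t : ℝ => F (u + t • B)) (fderiv ℝ F u B) 0 :=
  hF.hasFDerivAt.hasLineDerivAt B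

/-- Differentiate `S P = l P`, `P P = P` and `Pᵀ = P`. Multiplying the first relation by `P` and
taking the trace isolates `l' = tr(P S')`. Multiplying it by the reduced resolvent `R` gives `R S' P
= P' P`, whose transpose is `P S' R = P P'`; the two add up to `P'`. -/
theorem eigen_derivs (hu : u ∈ regular m p) (B : Fin m → Fin p → ℝ) (i : Fin (min p m)) :
    HasDerivAt (fun t : ℝ => eigval (u + t • B) i) (eigvalDeriv u B i) 0 ∧
      HasMatDerivAt (fun t : ℝ => eigProj (u + t • B) i) (eigProjDeriv u B i) 0 := by
  have hl := hasDerivAt_line_of_differentiableAt (differentiableAt_eigval_apply hu i) B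
  set l' := fderiv ℝ (fun w => eigval w i) u B
  have hP : HasMatDerivAt (fun t : ℝ => eigProj (u + t • B) i)
      (fun a b => fderiv ℝ (fun w => eigProj w i a b) u B) 0 := fun a b =>
    hasDerivAt_line_of_differentiableAt (differentiableAt_eigProj_apply hu i a b) B
  set P' : Matrix (Fin p) (Fin p) ℝ := fun a b => fderiv ℝ (fun w => eigProj w i a b) u B
  have hS := hasMatDerivAt_gramMat u B
  set S' := gramDeriv u B with hS'
  have e1 := (((hS.mul hP).congr (funext fun t => gramMat_mul_eigProj (u + t • B) i))).unique
    (HasMatDerivAt.smul hl hP)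
  have e2 := ((hP.mul hP).congr (funext fun t => eigProj_mul_self (u + t • B) i)).unique hP
  have e3 := (hP.transpose.congr (funext fun t => eigProj_transpose (u + t • B) i)).unique hP
  simp only [zero_smul, add_zero] at e1 e2
  have k1 : (eigProj u i * S').trace = l' := by
    have := congrArg (fun M => (eigProj u i * M).trace) e1
    simp only [Matrix.mul_add, ← Matrix.mul_assoc, Matrix.trace_add, Matrix.mul_smul,
      Matrix.trace_smul, eigProj_mul_gramMat, eigProj_mul_self, eigProj_trace, Matrix.smul_mul,
      smul_eq_mul, mul_one] at this
    rw [Matrix.trace_mul_comm (eigProj u i * S'), ← Matrix.mul_assoc, eigProj_mul_self] at this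
    linarith
  have k2 : reducedResolvent u i * S' * eigProj u i = P' * eigProj u i := by
    have := congrArg (fun M => reducedResolvent u i * M) e1
    simp only [Matrix.mul_add, ← Matrix.mul_assoc, Matrix.mul_smul, reducedResolvent_mul_gramMat hu,
      reducedResolvent_mul_eigProj, smul_zero, zero_add, Matrix.add_mul, Matrix.sub_mul,
      Matrix.one_mul, Matrix.smul_mul] at this
    have h3 : reducedResolvent u i * S' * eigProj u i = P' - eigProj u i * P' := by
      have := sub_eq_zero.mpr this
      rw [← sub_eq_zero, ← this]
      abel
    rw [h3]
    rw [sub_eq_iff_eq_add, e2]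
  have k3 : eigProj u i * S' * reducedResolvent u i = eigProj u i * P' := by
    have := congrArg Matrix.transpose k2
    simpa [Matrix.transpose_mul, eigProj_transpose, reducedResolvent_transpose, e3, hS',
      gramDeriv_transpose, Matrix.mul_assoc] using this
  refine ⟨by rwa [eigvalDeriv, k1], ?_⟩
  rwa [eigProjDeriv, k2, k3, e2]

/-! ### The divergence of `U H Φ(L) Hᵀ`. -/

/-- The vector field `U H Φ(L) Hᵀ`. -/
noncomputable def spectralField {m p : ℕ} (φ : (Fin (min p m) → ℝ) → Fin (min p m) → ℝ)
    (u : Fin m → Fin p → ℝ) : Fin m → Fin p → ℝ :=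
  fun k a => ∑ i, φ (eigval u) i * (Matrix.of u * eigProj u i) k a

theorem differentiableAt_mul_eigProj_apply (hu : u ∈ regular m p) (i : Fin (min p m)) (k : Fin m)
    (a : Fin p) :
    DifferentiableAt ℝ (fun w : Fin m → Fin p → ℝ => (Matrix.of w * eigProj w i) k a) u := by
  simp only [Matrix.mul_apply, Matrix.of_apply]
  refine DifferentiableAt.fun_sum fun b _ => DifferentiableAt.mul ?_
    (differentiableAt_eigProj_apply hu i b a)
  fun_prop

theorem differentiableAt_spectralField {φ : (Fin (min p m) → ℝ) → Fin (min p m) → ℝ}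
    (hu : u ∈ regular m p) (hφ : DifferentiableAt ℝ φ (eigval u)) :
    DifferentiableAt ℝ (spectralField φ) u := by
  refine differentiableAt_pi.mpr fun k => differentiableAt_pi.mpr fun a => ?_
  refine DifferentiableAt.fun_sum fun i _ => DifferentiableAt.mul ?_
    (differentiableAt_mul_eigProj_apply hu i k a)
  have h1 : DifferentiableAt ℝ (fun l => φ l i) (eigval u) := differentiableAt_pi.mp hφ i
  exact h1.comp u (differentiableAt_eigval hu)

/-- The divergence of `U H Φ(L) Hᵀ` as a function of the eigenvalues. -/
noncomputable def haffDiv (m p : ℕ) (φ : (Fin (min p m) → ℝ) → Fin (min p m) → ℝ)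
    (l : Fin (min p m) → ℝ) : ℝ :=
  ∑ i, ((((max p m : ℕ) : ℝ) - ((min p m : ℕ) : ℝ) + 1) * φ l i + 2 * l i * partialDiag φ l i +
    ∑ j ∈ univ.erase i, (l i * φ l i - l j * φ l j) / (l i - l j))

theorem of_single_single (k : Fin m) (a : Fin p) :
    (Matrix.of (Pi.single k (Pi.single a (1 : ℝ))) : Matrix (Fin m) (Fin p) ℝ) =
      Matrix.single k a 1 :=
  Matrix.single_eq_of_single_single k a 1 |>.symm

theorem sum_mul_apply_mul_apply (u : Fin m → Fin p → ℝ) (A C : Matrix (Fin p) (Fin p) ℝ) :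
    ∑ k, ∑ a, (Matrix.of u * A) k a * (Matrix.of u * C) k a = (Aᵀ * gramMat u * C).trace := by
  have : Aᵀ * gramMat u * C = (Matrix.of u * A)ᵀ * (Matrix.of u * C) := by
    simp [gramMat, Matrix.transpose_mul, Matrix.mul_assoc]
  rw [this, Matrix.trace, Finset.sum_comm]
  exact Finset.sum_congr rfl fun a _ => by
    rw [Matrix.diag_apply, Matrix.mul_apply]
    rfl

theorem mul_gramDeriv_mul_apply (u : Fin m → Fin p → ℝ) (A C : Matrix (Fin p) (Fin p) ℝ)
    (k : Fin m) (a : Fin p) :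
    (Matrix.of u * (A * gramDeriv u (Pi.single k (Pi.single a 1)) * C)) k a =
      (Matrix.of u * A) k a * (Matrix.of u * C) k a +
        (Matrix.of u * A * (Matrix.of u)ᵀ) k k * C a a := by
  rw [gramDeriv, of_single_single, Matrix.mul_add, Matrix.add_mul, Matrix.mul_add,
    Matrix.add_apply, Matrix.transpose_single]
  congr 1
  · calc _ = ((Matrix.of u * A) * (Matrix.single a k (1 : ℝ) * (Matrix.of u * C))) k a := by
          simp only [Matrix.mul_assoc]
      _ = _ := by
          rw [Matrix.mul_apply, Finset.sum_eq_single a]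
          · simp
          · intro b _ hb
            simp [hb]
          · simp
  · calc _ = ((Matrix.of u * A * (Matrix.of u)ᵀ) * (Matrix.single k a (1 : ℝ) * C)) k a := by
          simp only [Matrix.mul_assoc]
      _ = _ := by
          rw [Matrix.mul_apply, Finset.sum_eq_single k]
          · simp
          · intro b _ hb
            simp [hb]
          · simp

theorem trace_mul_eq_of_gram (u : Fin m → Fin p → ℝ) (A : Matrix (Fin p) (Fin p) ℝ) :
    ∑ k, (Matrix.of u * A * (Matrix.of u)ᵀ) k k = (A * gramMat u).trace := by
  rw [gramMat, ← Matrix.mul_assoc, Matrix.trace_mul_comm, ← Matrix.mul_assoc]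
  rfl

/-- This is the part of the divergence of `U A S C` coming from the variation of `S` alone. One half
of the derivative of `S` yields a trace of a product, the other a product of traces. -/
theorem sum_mul_gramDeriv_mul (u : Fin m → Fin p → ℝ) (A C : Matrix (Fin p) (Fin p) ℝ) :
    ∑ k, ∑ a, (Matrix.of u * (A * gramDeriv u (Pi.single k (Pi.single a 1)) * C)) k a =
      (Aᵀ * gramMat u * C).trace + (A * gramMat u).trace * C.trace := by
  simp only [mul_gramDeriv_mul_apply, Finset.sum_add_distrib, sum_mul_apply_mul_apply,
    ← Finset.mul_sum, ← Finset.sum_mul, trace_mul_eq_of_gram]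
  rfl

/-- In both halves of `P'` the trace of the product vanishes because `R P = P R = 0`. The products
of traces are `tr(R S) tr P = l_i tr R - p + 1` and `tr(P S) tr R = l_i tr R`. -/
theorem sum_mul_eigProjDeriv (hu : u ∈ regular m p) (i : Fin (min p m)) :
    ∑ k, ∑ a, (Matrix.of u * eigProjDeriv u (Pi.single k (Pi.single a 1)) i) k a =
      2 * eigval u i * (reducedResolvent u i).trace - p + 1 := by
  simp only [eigProjDeriv, Matrix.mul_add, Matrix.add_apply, Finset.sum_add_distrib,
    sum_mul_gramDeriv_mul, reducedResolvent_transpose, eigProj_transpose, eigProj_trace]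
  have h1 : eigProj u i * reducedResolvent u i = 0 := by
    have := congrArg Matrix.transpose (reducedResolvent_mul_eigProj u i)
    simpa [Matrix.transpose_mul, eigProj_transpose, reducedResolvent_transpose] using this
  rw [Matrix.mul_assoc, gramMat_mul_eigProj, eigProj_mul_gramMat, Matrix.mul_smul, Matrix.smul_mul,
    reducedResolvent_mul_eigProj, h1, reducedResolvent_mul_gramMat hu]
  simp [eigProj_trace]
  ring

theorem eigvalDeriv_single (u : Fin m → Fin p → ℝ) (k : Fin m) (a : Fin p) (i : Fin (min p m)) :
    eigvalDeriv u (Pi.single k (Pi.single a 1)) i = 2 * (Matrix.of u * eigProj u i) k a := by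
  have h1 : (eigProj u i * ((Matrix.single k a (1 : ℝ))ᵀ * Matrix.of u)).trace =
      (Matrix.of u * eigProj u i) k a := by
    rw [Matrix.trace_mul_comm, Matrix.mul_assoc, Matrix.transpose_single]
    rw [Matrix.trace_mul_comm, Matrix.trace, Finset.sum_eq_single k]
    · simp
    · intro b _ hb
      rw [Matrix.diag_apply, Matrix.mul_single_apply_of_ne _ _ _ _ _ hb]
    · simp
  rw [eigvalDeriv, gramDeriv, of_single_single, Matrix.mul_add, Matrix.trace_add, two_mul]
  congr 1
  rw [← h1, ← Matrix.trace_transpose]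
  rw [Matrix.transpose_mul, Matrix.transpose_mul, Matrix.transpose_transpose, eigProj_transpose,
    Matrix.trace_mul_comm]

theorem fderiv_apply_eq_sum {r : ℕ} (F : (Fin r → ℝ) →L[ℝ] ℝ) (x : Fin r → ℝ) :
    F x = ∑ j, x j * F (Pi.single j 1) := by
  conv_lhs => rw [pi_eq_sum_univ' x, map_sum]
  simp [Pi.single]

/-- Three variations contribute. The coefficients give `2 l_i ∂_i φ_i`, the off-diagonal partial
derivatives disappearing by orthogonality of the projections; the factor `U` gives `m φ_i`; the
projection gives `φ_i (2 l_i tr R - p + 1)`. The zero eigenvalues inside `tr R` add `2 (p - r) φ_i`,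
so the total constant is `m + p - 2r + 1 = v - r + 1`. -/
theorem sum_fderiv_spectralField {φ : (Fin (min p m) → ℝ) → Fin (min p m) → ℝ}
    (hu : u ∈ regular m p) (hφ : DifferentiableAt ℝ φ (eigval u)) :
    ∑ k, ∑ a, fderiv ℝ (spectralField φ) u (Pi.single k (Pi.single a 1)) k a =
      haffDiv m p φ (eigval u) := by
  have key : ∀ k a, fderiv ℝ (spectralField φ) u (Pi.single k (Pi.single a 1)) k a =
      ∑ i, ((∑ j, 2 * (Matrix.of u * eigProj u j) k a *
          fderiv ℝ (fun l => φ l i) (eigval u) (Pi.single j 1)) * (Matrix.of u * eigProj u i) k a +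
        φ (eigval u) i * (eigProj u i a a +
          (Matrix.of u * eigProjDeriv u (Pi.single k (Pi.single a 1)) i) k a)) := by
    intro k a
    set B : Fin m → Fin p → ℝ := Pi.single k (Pi.single a 1) with hB
    have hX := differentiableAt_spectralField hu hφ
    have h1 : HasDerivAt (fun t : ℝ => spectralField φ (u + t • B) k a)
        (fderiv ℝ (spectralField φ) u B k a) 0 :=
      hasDerivAt_pi.mp (hasDerivAt_pi.mp (hX.hasFDerivAt.hasLineDerivAt B) k) a
    refine h1.unique ?_
    have h2 : ∀ i, HasDerivAt (fun t : ℝ => φ (eigval (u + t • B)) i)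
        (∑ j, 2 * (Matrix.of u * eigProj u j) k a *
          fderiv ℝ (fun l => φ l i) (eigval u) (Pi.single j 1)) 0 := by
      intro i
      have hφi : DifferentiableAt ℝ (fun l => φ l i) (eigval u) := differentiableAt_pi.mp hφ i
      have he : HasDerivAt (fun t : ℝ => eigval (u + t • B)) (eigvalDeriv u B) 0 :=
        hasDerivAt_pi.mpr fun j => (eigen_derivs hu B j).1
      have hφi' : HasFDerivAt (fun l => φ l i) (fderiv ℝ (fun l => φ l i) (eigval u))
          (eigval (u + (0 : ℝ) • B)) := by simpa using hφi.hasFDerivAt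
      have := hφi'.comp_hasDerivAt (0 : ℝ) he
      rw [fderiv_apply_eq_sum] at this
      simp only [hB, eigvalDeriv_single] at this
      exact this
    have h3 : ∀ i, HasDerivAt
        (fun t : ℝ => (Matrix.of (u + t • B) * eigProj (u + t • B) i) k a)
        (eigProj u i a a + (Matrix.of u * eigProjDeriv u B i) k a) 0 := by
      intro i
      have := (hasMatDerivAt_line u B).mul (eigen_derivs hu B i).2 k a
      simpa [hB, of_single_single] using this
    have := HasDerivAt.fun_sum (u := univ) fun i _ => (h2 i).mul (h3 i)
    simpa [spectralField] using this
  simp only [key, haffDiv]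
  have e1 : ∀ i, ∑ k, ∑ a, (∑ j, 2 * (Matrix.of u * eigProj u j) k a *
      fderiv ℝ (fun l => φ l i) (eigval u) (Pi.single j 1)) * (Matrix.of u * eigProj u i) k a =
      2 * eigval u i * partialDiag φ (eigval u) i := by
    intro i
    have : ∀ j, (eigProj u j * gramMat u * eigProj u i).trace =
        if j = i then eigval u i else 0 := by
      intro j
      rw [Matrix.mul_assoc, gramMat_mul_eigProj, Matrix.mul_smul, eigProj_mul]
      split_ifs with h
      · rw [h, Matrix.trace_smul, eigProj_trace, smul_eq_mul, mul_one]
      · simp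
    calc _ = ∑ j, 2 * fderiv ℝ (fun l => φ l i) (eigval u) (Pi.single j 1) *
          ∑ k, ∑ a, (Matrix.of u * eigProj u j) k a * (Matrix.of u * eigProj u i) k a := by
          simp only [Finset.sum_mul, Finset.mul_sum]
          rw [Finset.sum_congr rfl fun k _ => Finset.sum_comm, Finset.sum_comm]
          refine Finset.sum_congr rfl fun j _ => Finset.sum_congr rfl fun k _ =>
            Finset.sum_congr rfl fun a _ => by ring
      _ = _ := by
          simp only [sum_mul_apply_mul_apply, eigProj_transpose, this]
          simp [partialDiag]
          ring
  have e2 : ∀ i, ∑ k : Fin m, ∑ a, eigProj u i a a = m := by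
    intro i
    have : ∑ a, eigProj u i a a = 1 := eigProj_trace u i
    simp [this]
  have e3 : ∑ k, ∑ a, ∑ i, ((∑ j, 2 * (Matrix.of u * eigProj u j) k a *
          fderiv ℝ (fun l => φ l i) (eigval u) (Pi.single j 1)) * (Matrix.of u * eigProj u i) k a +
        φ (eigval u) i * (eigProj u i a a +
          (Matrix.of u * eigProjDeriv u (Pi.single k (Pi.single a 1)) i) k a)) =
      ∑ i, (2 * eigval u i * partialDiag φ (eigval u) i + φ (eigval u) i *
        (m + (2 * eigval u i * (reducedResolvent u i).trace - p + 1))) := by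
    rw [Finset.sum_congr rfl fun k _ => Finset.sum_comm, Finset.sum_comm]
    refine Finset.sum_congr rfl fun i _ => ?_
    simp only [Finset.sum_add_distrib, e1, ← Finset.mul_sum, e2, sum_mul_eigProjDeriv hu]
  rw [e3]
  have hmm : ((max p m : ℕ) : ℝ) + ((min p m : ℕ) : ℝ) = p + m := by
    exact_mod_cast max_add_min p m
  set l := eigval u with hl
  -- Symmetrizing over ordered pairs turns the one-sided sums from `tr R` into the divided
  -- differences of `haffDiv`; the diagonal may be included since `0⁻¹ = 0`.
  have hpair : ∑ i, ∑ j ∈ univ.erase i, (l i * φ l i - l j * φ l j) / (l i - l j) =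
      ∑ i, ∑ j, 2 * (l i * φ l i * (l i - l j)⁻¹) := by
    have h1 : ∀ i, ∑ j ∈ univ.erase i, (l i * φ l i - l j * φ l j) / (l i - l j) =
        ∑ j, (l i * φ l i * (l i - l j)⁻¹ + l j * φ l j * (l j - l i)⁻¹) := by
      intro i
      rw [← Finset.add_sum_erase univ _ (Finset.mem_univ i)]
      simp only [sub_self, _root_.inv_zero, mul_zero, add_zero, zero_add]
      refine Finset.sum_congr rfl fun j _ => ?_
      rw [← neg_sub (l i) (l j), inv_neg]
      ring
    simp only [h1, Finset.sum_add_distrib, two_mul]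
    congr 1
    exact Finset.sum_comm
  rw [Finset.sum_add_distrib, Finset.sum_add_distrib, Finset.sum_add_distrib, hpair,
    ← Finset.sum_add_distrib, ← Finset.sum_add_distrib, ← Finset.sum_add_distrib]
  refine Finset.sum_congr rfl fun i _ => ?_
  rw [trace_reducedResolvent, ← hl, ← Finset.mul_sum, ← Finset.mul_sum]
  have hli : l i ≠ 0 := (hu.2 i).ne'
  field_simp
  linear_combination (-φ l i) * hmm
end

/-! ### Almost every `U` is regular. -/

section

variable {m p : ℕ}

theorem abs_gramMat_sub_le {R : ℝ} {u w : Fin m → Fin p → ℝ} (hu : ‖u‖ ≤ R) (hw : ‖w‖ ≤ R)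
    (a b : Fin p) : |gramMat u a b - gramMat w a b| ≤ m * (2 * R) * ‖u - w‖ := by
  have hent : ∀ (v : Fin m → Fin p → ℝ) k a, |v k a| ≤ ‖v‖ := fun v k a =>
    (norm_le_pi_norm (v k) a).trans (norm_le_pi_norm v k)
  simp only [gramMat, Matrix.mul_apply, Matrix.transpose_apply, Matrix.of_apply]
  rw [← Finset.sum_sub_distrib]
  refine (Finset.abs_sum_le_sum_abs _ _).trans ?_
  have : ∀ k ∈ (univ : Finset (Fin m)), |u k a * u k b - w k a * w k b| ≤ 2 * R * ‖u - w‖ := by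
    intro k _
    have e : u k a * u k b - w k a * w k b = u k a * (u - w) k b + (u - w) k a * w k b := by
      simp only [Pi.sub_apply]; ring
    rw [e]
    refine (abs_add_le _ _).trans ?_
    rw [abs_mul, abs_mul]
    have h1 := mul_le_mul ((hent u k a).trans hu) (hent (u - w) k b) (abs_nonneg _)
      ((norm_nonneg u).trans hu)
    have h2 := mul_le_mul (hent (u - w) k a) ((hent w k b).trans hw) (abs_nonneg _)
      (norm_nonneg _)
    linarith
  refine (Finset.sum_le_sum this).trans ?_
  simp [mul_assoc]

/-- `S` is Lipschitz in `u` on bounded sets and the Ky Fan sums are Lipschitz in `S`, so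
Rademacher's theorem applies on each ball. -/
theorem ae_differentiableAt_topSum (k : ℕ) :
    ∀ᵐ u : Fin m → Fin p → ℝ, DifferentiableAt ℝ (fun w : Fin m → Fin p → ℝ => topSum w k) u := by
  have h : ∀ n : ℕ, ∀ᵐ u : Fin m → Fin p → ℝ, u ∈ Metric.ball (0 : Fin m → Fin p → ℝ) n →
      DifferentiableWithinAt ℝ (fun w : Fin m → Fin p → ℝ => topSum w k)
        (Metric.ball (0 : Fin m → Fin p → ℝ) n) u := by
    intro n
    have hL : LipschitzOnWith (Real.toNNReal (∑ _ : Fin p, ∑ _ : Fin p, m * (2 * (n : ℝ))))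
        (fun w : Fin m → Fin p → ℝ => topSum w k) (Metric.ball 0 n) := by
      refine LipschitzOnWith.of_dist_le_mul fun u hu w hw => ?_
      rw [Real.coe_toNNReal _ (by positivity), Real.dist_eq, dist_eq_norm]
      refine (abs_topSum_sub_le u w k).trans ?_
      rw [Finset.sum_mul]
      refine Finset.sum_le_sum fun a _ => ?_
      rw [Finset.sum_mul]
      refine Finset.sum_le_sum fun b _ => ?_
      exact abs_gramMat_sub_le (by simpa using (mem_ball_zero_iff.mp hu).le)
        (by simpa using (mem_ball_zero_iff.mp hw).le) a b
    exact hL.ae_differentiableWithinAt_of_mem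
  filter_upwards [ae_all_iff.mpr h] with u hu
  obtain ⟨n, hn⟩ := exists_nat_gt ‖u‖
  have hmem : u ∈ Metric.ball (0 : Fin m → Fin p → ℝ) n := mem_ball_zero_iff.mpr hn
  exact (hu n hmem).differentiableAt (Metric.isOpen_ball.mem_nhds hmem)

/-- Envelope argument: for a fixed competitor `W` the Ky Fan sum dominates `tr(W S)`, with equality
at `u`, so the two derivatives agree there. -/
theorem topSum_deriv_eq {u : Fin m → Fin p → ℝ} {k : ℕ}
    (hd : DifferentiableAt ℝ (fun w : Fin m → Fin p → ℝ => topSum w k) u)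
    {W : Matrix (Fin p) (Fin p) ℝ} (hW : Wᵀ = W) (hW2 : W * W = W) (hk : W.trace ≤ k)
    (hmax : (W * gramMat u).trace = topSum u k) (B : Fin m → Fin p → ℝ) :
    fderiv ℝ (fun w : Fin m → Fin p → ℝ => topSum w k) u B = (W * gramDeriv u B).trace := by
  have h1 := hasDerivAt_line_of_differentiableAt hd B
  have h2 : HasDerivAt (fun t : ℝ => (W * gramMat (u + t • B)).trace) (W * gramDeriv u B).trace 0 := by
    simp only [Matrix.trace, Matrix.diag_apply, Matrix.mul_apply]
    exact HasDerivAt.fun_sum fun a _ => HasDerivAt.fun_sum fun b _ =>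
      (hasMatDerivAt_gramMat u B b a).const_mul (W a b)
  have h3 : IsLocalMin (fun t : ℝ => topSum (u + t • B) k - (W * gramMat (u + t • B)).trace) 0 := by
    refine Filter.Eventually.of_forall fun t => ?_
    simp only [zero_smul, add_zero, hmax, sub_self, sub_nonneg]
    exact trace_mul_gramMat_le _ hW hW2 k hk
  exact sub_eq_zero.mp (h3.hasDerivAt_eq_zero (h1.sub h2))

/-- If `l_i = l_j`, the Ky Fan sum of order `i + 1` (indices start at zero) has two maximizers: the
first `i` projections completed by `P_i` or by `P_j`. In the direction `U P_i` the derivative of `S`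
is `2 l_i P_i`, so their envelope derivatives differ by `2 l_i`; differentiability forces this to be
zero. -/
theorem eigval_eq_zero_of_differentiableAt {u : Fin m → Fin p → ℝ}
    (hd : ∀ k : ℕ, DifferentiableAt ℝ (fun w : Fin m → Fin p → ℝ => topSum w k) u)
    {i j : Fin (min p m)} (hij : i < j) (h : eigval u i = eigval u j) : eigval u i = 0 := by
  set s := univ.filter (fun a : Fin (min p m) => (a : ℕ) < i) with hs
  have hi : i ∉ s := by simp [hs]
  have hj : j ∉ s := by simp [hs]; omega
  have htop : topSum u ((i : ℕ) + 1) = ∑ a ∈ insert i s, eigval u a := by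
    rw [topSum]
    congr 1
    ext a
    simp [hs, Fin.ext_iff]
    omega
  have hcard : ∀ b, b ∉ s → ((insert b s).card : ℝ) ≤ ((i : ℕ) + 1 : ℕ) := by
    intro b hb
    rw [Finset.card_insert_of_notMem hb, hs, Fin.card_filter_val_lt]
    exact_mod_cast Nat.succ_le_succ (min_le_right _ _)
  let B : Fin m → Fin p → ℝ := Matrix.of.symm (Matrix.of u * eigProj u i)
  have hB : gramDeriv u B = (2 * eigval u i) • eigProj u i := by
    have : Matrix.of B = Matrix.of u * eigProj u i := rfl
    rw [gramDeriv, this, Matrix.transpose_mul, eigProj_transpose, Matrix.mul_assoc,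
      ← Matrix.mul_assoc _ _ (eigProj u i)]
    change eigProj u i * gramMat u + gramMat u * eigProj u i = _
    rw [eigProj_mul_gramMat, gramMat_mul_eigProj, two_mul, add_smul]
  have key : ∀ b, b ∉ s → eigval u b = eigval u i →
      fderiv ℝ (fun w : Fin m → Fin p → ℝ => topSum w ((i : ℕ) + 1)) u B =
        ((∑ a ∈ insert b s, eigProj u a) * gramDeriv u B).trace := by
    intro b hb hbi
    refine topSum_deriv_eq (hd _) (sum_eigProj_transpose u _) (sum_eigProj_mul_self u _) ?_ ?_ B
    · rw [trace_sum_eigProj]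
      exact hcard b hb
    · rw [trace_sum_eigProj_mul_gramMat, htop, Finset.sum_insert hb, Finset.sum_insert hi, hbi]
  have e := (key i hi rfl).symm.trans (key j hj h.symm)
  rw [Finset.sum_insert hi, Finset.sum_insert hj, Matrix.add_mul, Matrix.add_mul, Matrix.trace_add,
    Matrix.trace_add, add_left_inj, hB, Matrix.mul_smul, Matrix.mul_smul, eigProj_mul_self,
    eigProj_mul_of_ne u hij.ne', Matrix.trace_smul, eigProj_trace, smul_zero, Matrix.trace_zero,
    smul_eq_mul] at e
  linarith

/-- The leading `r × r` block of a matrix, `r = min {p, m}`. -/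
def corner (u : Fin m → Fin p → ℝ) : Matrix (Fin (min p m)) (Fin (min p m)) ℝ :=
  (Matrix.of u).submatrix (Fin.castLE (min_le_right p m)) (Fin.castLE (min_le_left p m))

/-- A vanishing eigenvalue among the top `r` brings the rank of `S`, hence of `U`, below `r`. -/
theorem det_corner_eq_zero {u : Fin m → Fin p → ℝ} {i : Fin (min p m)} (hi : eigval u i = 0) :
    (corner u).det = 0 := by
  by_contra hdet
  have h1 : (corner u).rank = min p m := by
    have := Matrix.rank_of_isUnit (corner u)
      ((Matrix.isUnit_iff_isUnit_det _).mpr (isUnit_iff_ne_zero.mpr hdet))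
    simpa using this
  have h2 : (corner u).rank ≤ (Matrix.of u).rank :=
    Matrix.rank_submatrix_le _ _ _
  have h3 : (gramMat u).rank = (Matrix.of u).rank := Matrix.rank_transpose_mul_self _
  have h4 : (gramMat u).rank ≤ Fintype.card {a // eigval u a ≠ 0} := by
    rw [gramMat_eq u, ← Matrix.rank_diagonal]
    exact (Matrix.rank_mul_le_left _ _).trans (Matrix.rank_mul_le_right _ _)
  have h5 : Fintype.card {a // eigval u a ≠ 0} < min p m := by
    have := Fintype.card_subtype_lt (p := fun a => eigval u a ≠ 0) (x := i) (by simpa using hi)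
    simpa using this
  omega

/-- Along each line in the direction of the rectangular identity `J`, the corner determinant is the
characteristic polynomial of minus the corner. It is monic, so it has finitely many zeros, and a
Fubini argument over parallel lines concludes. -/
theorem ae_det_corner_ne_zero : ∀ᵐ u : Fin m → Fin p → ℝ, (corner u).det ≠ 0 := by
  have hcont : Continuous fun u : Fin m → Fin p → ℝ => (corner u).det := by
    refine Continuous.matrix_det (continuous_matrix fun a b => ?_)
    simp only [corner, Matrix.submatrix_apply, Matrix.of_apply]
    fun_prop
  have hmeas : MeasurableSet {u : Fin m → Fin p → ℝ | (corner u).det ≠ 0} :=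
    (isOpen_ne_fun hcont continuous_const).measurableSet
  let J : Fin m → Fin p → ℝ := fun k a => if (k : ℕ) = a then 1 else 0
  let L : ℝ →ₗ[ℝ] (Fin m → Fin p → ℝ) := LinearMap.toSpanSingleton ℝ _ J
  refine ae_mem_of_ae_add_linearMap_mem L volume volume hmeas fun y => ?_
  have hfin : {x : ℝ | (-corner y).charpoly.IsRoot x}.Finite :=
    Polynomial.finite_setOfPred_isRoot (Matrix.charpoly_monic _).ne_zero
  refine (hfin.countable.ae_notMem volume).mono fun x hx => ?_
  have e : corner (y + L x) = Matrix.scalar _ x - -corner y := by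
    ext a b
    simp [corner, L, J, Matrix.diagonal_apply, Fin.ext_iff, add_comm]
  rw [Set.mem_ofPred_eq, Polynomial.IsRoot, Matrix.eval_charpoly] at hx
  change (corner (y + L x)).det ≠ 0
  rw [e]
  exact hx

variable (m p) in
theorem ae_mem_regular : ∀ᵐ u : Fin m → Fin p → ℝ, u ∈ regular m p := by
  filter_upwards [ae_all_iff.mpr fun k => ae_differentiableAt_topSum (m := m) (p := p) k,
    ae_det_corner_ne_zero (m := m) (p := p)] with u hd hdet
  have hpos : ∀ i, 0 < eigval u i := fun i =>
    lt_of_le_of_ne (eigval_nonneg u i) fun h => hdet (det_corner_eq_zero h.symm)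
  refine ⟨fun i j hij => lt_of_le_of_ne (eigval_antitone u hij.le) fun h => ?_, hpos⟩
  exact (hpos i).ne' (eigval_eq_zero_of_differentiableAt hd hij h.symm)

end

/-! ### A divergence theorem for fields whose divergence need not be integrable. -/

/-- A compactly supported differentiable vector field has nonnegative integral of any integrable
majorant of its divergence.  The divergence itself need not be integrable. -/
theorem integral_nonneg_of_divergence_le_fin {n : ℕ}
    {X : (Fin (n + 1) → ℝ) → Fin (n + 1) → ℝ} (hX : Differentiable ℝ X)
    (hc : HasCompactSupport X) {k : (Fin (n + 1) → ℝ) → ℝ} (hk : Integrable k)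
    (hle : ∀ x, ∑ i, fderiv ℝ X x (Pi.single i 1) i ≤ k x) : 0 ≤ ∫ x, k x := by
  obtain ⟨R, hR0, hR⟩ := hc.isCompact.isBounded.subset_closedBall_lt 0 0
  have hzero : ∀ x, R < ‖x‖ → X x = 0 := fun x hx => by
    by_contra h
    have := hR (subset_tsupport X h)
    rw [mem_closedBall_zero_iff] at this
    linarith
  -- The margin of one around the support makes the field vanish on all faces.
  let I : BoxIntegral.Box (Fin (n + 1)) :=
    ⟨fun _ => -(R + 1), fun _ => R + 1, fun _ => by linarith⟩
  -- The gauge integral `GP` integrates the divergence of any pointwise differentiable field, with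
  -- no integrability or continuity of the derivative. The Lebesgue integrable majorant `k` is also
  -- `GP`-integrable, so the two can be compared in that theory.
  have hdiv := BoxIntegral.hasIntegral_GP_divergence_of_forall_hasDerivWithinAt I X (fderiv ℝ X) ∅
    Set.countable_empty (by simp) (fun x _ => (hX x).hasFDerivAt.hasFDerivWithinAt)
  have hface : ∀ i (c : ℝ), |c| = R + 1 → ∀ x : Fin n → ℝ, X (i.insertNth c x) i = 0 := by
    intro i c hc x
    rw [hzero _ ?_]
    · rfl
    have := norm_le_pi_norm (i.insertNth c x : Fin (n + 1) → ℝ) i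
    rw [Fin.insertNth_apply_same, Real.norm_eq_abs, hc] at this
    linarith
  have hsum : (∑ i, (BoxIntegral.integral (I.face i) BoxIntegral.IntegrationParams.GP
        (fun x => X (i.insertNth (I.upper i) x) i) BoxIntegral.BoxAdditiveMap.volume -
      BoxIntegral.integral (I.face i) BoxIntegral.IntegrationParams.GP
        (fun x => X (i.insertNth (I.lower i) x) i) BoxIntegral.BoxAdditiveMap.volume)) = 0 := by
    refine Finset.sum_eq_zero fun i _ => ?_
    have h1 : (fun x => X (i.insertNth (I.upper i) x) i) = fun _ => (0 : ℝ) :=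
      funext fun x => hface i _ (by simp only [I]; rw [abs_of_pos]; linarith) x
    have h2 : (fun x => X (i.insertNth (I.lower i) x) i) = fun _ => (0 : ℝ) :=
      funext fun x => hface i _ (by simp only [I]; rw [abs_neg, abs_of_pos]; linarith) x
    simp only [h1, h2, BoxIntegral.integral_zero, sub_zero]
  rw [hsum] at hdiv
  have hkI := (hk.integrableOn (s := (I : Set (Fin (n + 1) → ℝ)))).hasBoxIntegral
    BoxIntegral.IntegrationParams.GP rfl
  have hsub := (hkI.sub hdiv).integral_eq
  have hnn : 0 ≤ BoxIntegral.integral I BoxIntegral.IntegrationParams.GP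
      (k - fun x => ∑ i, fderiv ℝ X x (Pi.single i 1) i)
      (volume : Measure (Fin (n + 1) → ℝ)).toBoxAdditive.toSMul :=
    BoxIntegral.integral_nonneg (fun x _ => sub_nonneg.mpr (hle x)) _
  rw [hsub, sub_zero] at hnn
  rw [← integral_add_compl I.measurableSet_coe hk]
  refine add_nonneg hnn (setIntegral_nonneg I.measurableSet_coe.compl fun x hx => ?_)
  have hx' : R < ‖x‖ := by
    by_contra hle
    refine hx (show x ∈ I from fun i => ?_)
    have := (norm_le_pi_norm x i).trans (not_lt.mp hle)
    rw [Real.norm_eq_abs, abs_le] at this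
    exact ⟨by simp only [I]; linarith [this.1], by simp only [I]; linarith [this.2]⟩
  have hnear : X =ᶠ[𝓝 x] fun _ => 0 := by
    filter_upwards [(isOpen_lt continuous_const continuous_norm).mem_nhds hx'] with y hy
    exact hzero y hy
  refine (hle x).trans' ?_
  rw [hnear.fderiv_eq]
  simp

/-- The divergence is the trace of the derivative, which is invariant under conjugation by a
coordinate isomorphism, and Haar measures agree up to a nonnegative factor. Dimension zero is
separate because the coordinate version needs at least one variable. -/
theorem integral_nonneg_of_trace_fderiv_le {E : Type*} [NormedAddCommGroup E] [NormedSpace ℝ E]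
    [FiniteDimensional ℝ E] [MeasurableSpace E] [BorelSpace E] {μ : Measure E} [μ.IsAddHaarMeasure]
    {X : E → E} (hX : Differentiable ℝ X) (hc : HasCompactSupport X) {k : E → ℝ}
    (hk : Integrable k μ) (hle : ∀ x, LinearMap.trace ℝ E (fderiv ℝ X x) ≤ k x) :
    0 ≤ ∫ x, k x ∂μ := by
  rcases Nat.eq_zero_or_pos (Module.finrank ℝ E) with h0 | hpos
  · have : Subsingleton E := Module.finrank_zero_iff.mp h0
    refine integral_nonneg fun x => (hle x).trans' ?_
    have : (fderiv ℝ X x : E →ₗ[ℝ] E) = 0 := LinearMap.ext fun y => Subsingleton.elim _ _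
    rw [this, map_zero, Pi.zero_apply]
  obtain ⟨n, hn⟩ := Nat.exists_eq_succ_of_ne_zero hpos.ne'
  have e : E ≃L[ℝ] (Fin (n + 1) → ℝ) := ContinuousLinearEquiv.ofFinrankEq (by simpa using hn)
  let ν : Measure E := Measure.map e.symm (volume : Measure (Fin (n + 1) → ℝ))
  have : ν.IsAddHaarMeasure := e.symm.isAddHaarMeasure_map volume
  have h1 : ν = ν.addHaarScalarFactor μ • μ := Measure.isAddLeftInvariant_eq_smul ν μ
  have h2 : μ = μ.addHaarScalarFactor ν • ν := Measure.isAddLeftInvariant_eq_smul μ ν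
  have hkν : Integrable k ν := by
    rw [h1]
    exact hk.smul_measure_nnreal
  have hme : MeasurableEmbedding e.symm := e.symm.toHomeomorph.measurableEmbedding
  have hk' : Integrable (k ∘ e.symm) := hme.integrable_map_iff.mp hkν
  have hX' : Differentiable ℝ (fun y => e (X (e.symm y))) :=
    e.differentiable.comp (hX.comp e.symm.differentiable)
  have hfd : ∀ y, fderiv ℝ (fun y => e (X (e.symm y))) y =
      (e : E →L[ℝ] (Fin (n + 1) → ℝ)).comp ((fderiv ℝ X (e.symm y)).comp
        (e.symm : (Fin (n + 1) → ℝ) →L[ℝ] E)) := fun y =>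
    (e.hasFDerivAt.comp y ((hX (e.symm y)).hasFDerivAt.comp y e.symm.hasFDerivAt)).fderiv
  have hc' : HasCompactSupport (fun y => e (X (e.symm y))) := by
    have := (hc.comp_homeomorph e.symm.toHomeomorph).comp_left (g := e) (map_zero e)
    exact this
  have key := integral_nonneg_of_divergence_le_fin hX' hc' hk' fun y => ?_
  · rw [h2, integral_smul_nnreal_measure]
    refine smul_nonneg NNReal.zero_le_coe ?_
    rwa [hme.integral_map]
  · refine le_trans (le_of_eq ?_) (hle (e.symm y))
    rw [hfd, ← LinearMap.trace_conj' (fderiv ℝ X (e.symm y) : E →ₗ[ℝ] E) e.toLinearEquiv,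
      LinearMap.trace_eq_matrix_trace ℝ (Pi.basisFun ℝ (Fin (n + 1)))]
    simp [Matrix.trace, LinearEquiv.conj_apply]

theorem trace_pi_pi {m p : ℕ} (L : (Fin m → Fin p → ℝ) →ₗ[ℝ] (Fin m → Fin p → ℝ)) :
    LinearMap.trace ℝ _ L = ∑ k, ∑ a, L (Pi.single k (Pi.single a 1)) k a := by
  rw [LinearMap.trace_eq_matrix_trace ℝ (Pi.basis fun _ : Fin m => Pi.basisFun ℝ (Fin p)),
    Matrix.trace, Fintype.sum_sigma]
  simp [LinearMap.toMatrix_apply]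

theorem integral_nonneg_of_divergence_le {m p : ℕ}
    {X : (Fin m → Fin p → ℝ) → Fin m → Fin p → ℝ} (hX : Differentiable ℝ X)
    (hc : HasCompactSupport X) {k : (Fin m → Fin p → ℝ) → ℝ} (hk : Integrable k)
    (hle : ∀ x, ∑ i, ∑ a, fderiv ℝ X x (Pi.single i (Pi.single a 1)) i a ≤ k x) :
    0 ≤ ∫ x, k x :=
  integral_nonneg_of_trace_fderiv_le hX hc hk fun x => by
    rw [trace_pi_pi]; exact hle x

/-! ### Local integrability of the inverse eigenvalue gaps. -/

/-- The derivative of a locally bounded function which is monotone in the direction `e` is locally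
integrable. -/
theorem lintegral_deriv_lt_top_of_monotone {E : Type*} [NormedAddCommGroup E] [NormedSpace ℝ E]
    [FiniteDimensional ℝ E] [MeasurableSpace E] [BorelSpace E] {μ : Measure E} [μ.IsAddHaarMeasure]
    {G d : E → ℝ} {e : E} {A : Set E} {R C : ℝ} (hG : AEStronglyMeasurable G μ)
    (hC : ∀ u, ‖u‖ ≤ R + 1 + ‖e‖ → |G u| ≤ C) (hmono : ∀ u, ∀ t : ℝ, 0 < t → G u ≤ G (u + t • e))
    (hA : MeasurableSet A) (hAR : ∀ u ∈ A, ‖u‖ ≤ R)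
    (hd : ∀ u ∈ A, HasDerivAt (fun t : ℝ => G (u + t • e)) (d u) 0) :
    ∫⁻ u in A, ENNReal.ofReal (d u) ∂μ < ∞ := by
  -- A `1`-Lipschitz cutoff, equal to one on `A` and to zero outside the ball of radius `R + 1`.
  let ρ : E → ℝ := fun u => max 0 (min 1 (R + 1 - ‖u‖))
  have hρc : Continuous ρ := by fun_prop
  have hρ0 : ∀ u, 0 ≤ ρ u := fun u => le_max_left _ _
  have hρ1 : ∀ u, ρ u ≤ 1 := fun u => max_le zero_le_one (min_le_left _ _)
  have hρA : ∀ u ∈ A, ρ u = 1 := fun u hu => by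
    have := hAR u hu
    simp only [ρ]
    rw [min_eq_left (by linarith), max_eq_right zero_le_one]
  have hρs : ∀ u, R + 1 < ‖u‖ → ρ u = 0 := fun u hu => by
    simp only [ρ]
    exact max_eq_left ((min_le_right _ _).trans (by linarith))
  have hρL : ∀ u w, |ρ u - ρ w| ≤ ‖u - w‖ := by
    intro u w
    simp only [ρ]
    refine (abs_max_sub_max_le_max 0 _ 0 _).trans (max_le (by simp) ?_)
    refine (abs_min_sub_min_le_max 1 _ 1 _).trans (max_le (by simp) ?_)
    rw [sub_sub_sub_cancel_left, abs_sub_comm]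
    exact abs_norm_sub_norm_le u w
  set K : Set E := Metric.closedBall 0 (R + 1 + ‖e‖)
  have hKfin : μ K ≠ ∞ := (isCompact_closedBall _ _).measure_lt_top.ne
  let t : ℕ → ℝ := fun n => 1 / ((n : ℝ) + 1)
  have ht0 : ∀ n, 0 < t n := fun n => by positivity
  have ht1 : ∀ n, t n ≤ 1 := fun n => by
    simp only [t]
    rw [div_le_one (by positivity)]
    linarith [Nat.cast_nonneg (α := ℝ) n]
  let q : ℕ → E → ℝ := fun n u => ρ u * ((G (u + t n • e) - G u) / t n)
  have hq0 : ∀ n u, 0 ≤ q n u := fun n u =>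
    mul_nonneg (hρ0 u) (div_nonneg (sub_nonneg.mpr (hmono u _ (ht0 n))) (ht0 n).le)
  have hGt : ∀ n, AEStronglyMeasurable (fun u => G (u + t n • e)) μ := fun n =>
    hG.comp_measurePreserving (measurePreserving_add_right μ (t n • e))
  have hqm : ∀ n, AEStronglyMeasurable (q n) μ := fun n =>
    (hρc.measurable.aemeasurable.mul (((hGt n).aemeasurable.sub
      hG.aemeasurable).div_const _)).aestronglyMeasurable
  have hlim : ∀ u ∈ A, Tendsto (fun n => q n u) atTop (𝓝 (d u)) := by
    intro u hu
    have h1 := (hd u hu).tendsto_slope_zero_right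
    have h2 : Tendsto t atTop (𝓝[>] 0) := tendsto_nhdsWithin_iff.mpr
      ⟨tendsto_one_div_add_atTop_nhds_zero_nat, Eventually.of_forall ht0⟩
    refine (h1.comp h2).congr fun n => ?_
    simp only [q, hρA u hu, Function.comp_apply, zero_add, zero_smul, add_zero, smul_eq_mul]
    ring
  have hint : ∀ {F g : E → ℝ}, AEStronglyMeasurable F μ → Continuous g →
      (∀ u, R + 1 + ‖e‖ < ‖u‖ → g u = 0) → (∀ u, ‖u‖ ≤ R + 1 + ‖e‖ → |g u| ≤ 1) →
      (∀ u, g u ≠ 0 → |F u| ≤ C) → Integrable (fun u => g u * F u) μ := by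
    intro F g hF hg hg0 hg1 hFC
    have hCi : Integrable (K.indicator fun _ => |C|) μ :=
      (integrable_indicator_iff Metric.isClosed_closedBall.measurableSet).mpr
        (integrableOn_const hKfin)
    refine hCi.mono' (hg.aestronglyMeasurable.mul hF) (Eventually.of_forall fun u => ?_)
    by_cases hgu : g u = 0
    · simp only [hgu, zero_mul, norm_zero]
      exact Set.indicator_nonneg (fun _ _ => abs_nonneg _) _
    · have hu : ‖u‖ ≤ R + 1 + ‖e‖ := not_lt.mp fun h => hgu (hg0 u h)
      rw [Set.indicator_of_mem (mem_closedBall_zero_iff.mpr hu), norm_mul, Real.norm_eq_abs,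
        Real.norm_eq_abs]
      exact (mul_le_of_le_one_left (abs_nonneg _) (hg1 u hu)).trans
        ((hFC u hgu).trans (le_abs_self C))
  have hte : ∀ n, ‖t n • e‖ ≤ ‖e‖ := fun n => by
    rw [norm_smul, Real.norm_of_nonneg (ht0 n).le]
    exact mul_le_of_le_one_left (norm_nonneg _) (ht1 n)
  have hρabs : ∀ u, |ρ u| ≤ 1 := fun u => by rw [abs_of_nonneg (hρ0 u)]; exact hρ1 u
  have hρne : ∀ u, ρ u ≠ 0 → ‖u‖ ≤ R + 1 := fun u h => not_lt.mp fun h' => h (hρs u h')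
  have hI1 : ∀ n, Integrable (fun u => ρ u * G (u + t n • e)) μ := fun n =>
    hint (hGt n) hρc (fun u hu => hρs u (by linarith [norm_nonneg e])) (fun u _ => hρabs u)
      fun u hu => hC _ ((norm_add_le _ _).trans (add_le_add (hρne u hu) (hte n)))
  have hI2 : Integrable (fun u => ρ u * G u) μ :=
    hint hG hρc (fun u hu => hρs u (by linarith [norm_nonneg e])) (fun u _ => hρabs u)
      fun u hu => hC _ ((hρne u hu).trans (by linarith [norm_nonneg e]))
  have hI3 : ∀ n, Integrable (fun u => ρ (u - t n • e) * G u) μ := fun n =>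
    (by simpa using (hI1 n).comp_sub_right (t n • e))
  have hqi : ∀ n, Integrable (q n) μ := fun n => by
    have : q n = fun u => (t n)⁻¹ * (ρ u * G (u + t n • e) - ρ u * G u) := by
      funext u; simp only [q]; ring
    rw [this]
    exact ((hI1 n).sub hI2).const_mul _
  -- Translation invariance moves the difference quotient from `G` to `ρ`. Since `ρ` is
  -- `1`-Lipschitz, the integrand is then at most `‖e‖ |C|` on a ball containing the support of `ρ`
  -- and of its translate, uniformly in `n`.
  have hbound : ∀ n, ∫ u, q n u ∂μ ≤ ∫ u in K, ‖e‖ * |C| ∂μ := by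
    intro n
    have e1 : ∫ u, q n u ∂μ = ∫ u, (t n)⁻¹ * ((ρ (u - t n • e) - ρ u) * G u) ∂μ := by
      have h1 : ∫ u, q n u ∂μ = (t n)⁻¹ * (∫ u, ρ u * G (u + t n • e) ∂μ - ∫ u, ρ u * G u ∂μ) := by
        rw [← integral_sub (hI1 n) hI2, ← integral_const_mul]
        congr 1
        funext u; simp only [q]; ring
      have h2 : ∫ u, ρ u * G (u + t n • e) ∂μ = ∫ u, ρ (u - t n • e) * G u ∂μ := by
        have := integral_add_right_eq_self (μ := μ) (fun u => ρ (u - t n • e) * G u) (t n • e)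
        simpa only [add_sub_cancel_right] using this
      rw [h1, h2, ← integral_sub (hI3 n) hI2, ← integral_const_mul]
      congr 1
      funext u; ring
    rw [e1, ← integral_indicator Metric.isClosed_closedBall.measurableSet]
    refine integral_mono ?_ ((integrable_indicator_iff
      Metric.isClosed_closedBall.measurableSet).mpr (integrableOn_const hKfin)) fun u => ?_
    · have : (fun u => (t n)⁻¹ * ((ρ (u - t n • e) - ρ u) * G u)) =
        fun u => (t n)⁻¹ * (ρ (u - t n • e) * G u - ρ u * G u) := by funext u; ring
      rw [this]
      exact ((hI3 n).sub hI2).const_mul _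
    · by_cases hu : ‖u‖ ≤ R + 1 + ‖e‖
      · rw [Set.indicator_of_mem (mem_closedBall_zero_iff.mpr hu)]
        refine (le_abs_self _).trans ?_
        rw [abs_mul, abs_mul, abs_of_pos (inv_pos.mpr (ht0 n))]
        have h1 := hρL (u - t n • e) u
        rw [sub_sub_cancel_left, norm_neg, norm_smul, Real.norm_of_nonneg (ht0 n).le] at h1
        have h2 := (hC u hu).trans (le_abs_self C)
        calc (t n)⁻¹ * (|ρ (u - t n • e) - ρ u| * |G u|) ≤ (t n)⁻¹ * ((t n * ‖e‖) * |C|) := by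
              have := inv_pos.mpr (ht0 n)
              gcongr
          _ = ‖e‖ * |C| := by
              have := (ht0 n).ne'
              field_simp
      · rw [Set.indicator_of_notMem (by rwa [mem_closedBall_zero_iff])]
        rw [not_le] at hu
        have h1 : ρ u = 0 := hρs u (by linarith [norm_nonneg e])
        have h2 : ρ (u - t n • e) = 0 := hρs _ (by
          have := norm_sub_norm_le u (t n • e)
          linarith [hte n])
        rw [h1, h2]
        simp
  -- Fatou's lemma, available because monotonicity of `G` makes the difference quotients
  -- nonnegative.
  calc ∫⁻ u in A, ENNReal.ofReal (d u) ∂μ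
      = ∫⁻ u in A, liminf (fun n => ENNReal.ofReal (q n u)) atTop ∂μ := by
        refine setLIntegral_congr_fun hA fun u hu => ?_
        exact ((ENNReal.continuous_ofReal.tendsto _).comp (hlim u hu)).liminf_eq.symm
    _ ≤ ∫⁻ u, liminf (fun n => ENNReal.ofReal (q n u)) atTop ∂μ := setLIntegral_le_lintegral _ _
    _ ≤ liminf (fun n => ∫⁻ u, ENNReal.ofReal (q n u) ∂μ) atTop :=
        lintegral_liminf_le' fun n => (hqm n).aemeasurable.ennreal_ofReal
    _ ≤ liminf (fun _ : ℕ => ENNReal.ofReal (∫ u in K, ‖e‖ * |C| ∂μ)) atTop := by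
        refine liminf_le_liminf (Eventually.of_forall fun n => ?_)
        rw [← ofReal_integral_eq_lintegral_ofReal (hqi n) (Eventually.of_forall (hq0 n))]
        exact ENNReal.ofReal_le_ofReal (hbound n)
    _ < ∞ := by rw [liminf_const]; exact ENNReal.ofReal_lt_top

theorem ofReal_sum_le {ι : Type*} {s : Finset ι} {F : ι → ℝ} :
    ENNReal.ofReal (∑ i ∈ s, F i) ≤ ∑ i ∈ s, ENNReal.ofReal (F i) := by
  classical
  induction s using Finset.induction_on with
  | empty => simp
  | insert a s ha ih =>
    rw [Finset.sum_insert ha, Finset.sum_insert ha]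
    exact ENNReal.ofReal_add_le.trans (add_le_add le_rfl ih)

section

variable {m p : ℕ}

/-- The field `U P`, with `P` the projection on leading eigenvectors, is monotone. -/
theorem topProj_field_monotone (u w : Fin m → Fin p → ℝ) (k : ℕ) :
    0 ≤ ∑ a, ∑ b, ((Matrix.of w * topProj w k) a b - (Matrix.of u * topProj u k) a b) *
      (w a b - u a b) := by
  have inner_eq : ∀ x y : Fin m → Fin p → ℝ, ∑ a, ∑ b, (Matrix.of x * topProj x k) a b * y a b =
      (topProj x k * ((Matrix.of x)ᵀ * Matrix.of y)).trace := by
    intro x y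
    have : topProj x k * ((Matrix.of x)ᵀ * Matrix.of y) =
        (Matrix.of x * topProj x k)ᵀ * Matrix.of y := by
      rw [Matrix.transpose_mul, topProj_transpose, Matrix.mul_assoc]
    rw [this, Matrix.trace, Finset.sum_comm]
    exact Finset.sum_congr rfl fun a _ => by
      rw [Matrix.diag_apply, Matrix.mul_apply]
      rfl
  -- Expanding `‖(x - y) P_x‖² ≥ 0` bounds twice the mixed trace by `tr(P_x S_x) + tr(P_x S_y)`; the
  -- second trace is at most the Ky Fan sum of `y`. Exchanging `x` and `y` and adding gives
  -- monotonicity, as for a subgradient of half the Ky Fan sum.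
  have half : ∀ x y : Fin m → Fin p → ℝ,
      2 * (topProj x k * ((Matrix.of x)ᵀ * Matrix.of y)).trace ≤ topSum x k + topSum y k := by
    intro x y
    have h1 := trace_transpose_mul_self_nonneg ((Matrix.of x - Matrix.of y) * topProj x k)
    rw [Matrix.transpose_mul, topProj_transpose, Matrix.mul_assoc, ← Matrix.mul_assoc _ _
      (topProj x k), ← Matrix.mul_assoc, Matrix.trace_mul_comm, ← Matrix.mul_assoc,
      topProj_mul_self, Matrix.transpose_sub, Matrix.sub_mul, Matrix.mul_sub, Matrix.mul_sub,
      Matrix.mul_sub, Matrix.mul_sub, Matrix.mul_sub, Matrix.trace_sub, Matrix.trace_sub,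
      Matrix.trace_sub] at h1
    have h2 : (topProj x k * ((Matrix.of x)ᵀ * Matrix.of x)).trace = topSum x k :=
      trace_topProj_mul_gramMat x k
    have h3 : (topProj x k * ((Matrix.of y)ᵀ * Matrix.of y)).trace ≤ topSum y k :=
      trace_mul_gramMat_le y (topProj_transpose x k) (topProj_mul_self x k) k (trace_topProj_le x k)
    have h4 : (topProj x k * ((Matrix.of y)ᵀ * Matrix.of x)).trace =
        (topProj x k * ((Matrix.of x)ᵀ * Matrix.of y)).trace := by
      rw [← Matrix.trace_transpose, Matrix.transpose_mul, Matrix.transpose_mul,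
        Matrix.transpose_transpose, topProj_transpose, Matrix.trace_mul_comm]
    linarith
  have self_eq : ∀ x : Fin m → Fin p → ℝ,
      (topProj x k * ((Matrix.of x)ᵀ * Matrix.of x)).trace = topSum x k :=
    fun x => trace_topProj_mul_gramMat x k
  simp only [sub_mul, mul_sub, Finset.sum_sub_distrib, inner_eq, self_eq]
  linarith [half u w, half w u]

theorem measurable_eigval_apply (i : Fin (min p m)) :
    Measurable fun u : Fin m → Fin p → ℝ => eigval u i := (continuous_eigval_apply i).measurable

theorem aestronglyMeasurable_of_continuousOn_regular {F : (Fin m → Fin p → ℝ) → ℝ}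
    (hF : ContinuousOn F (regular m p)) : AEStronglyMeasurable F volume := by
  have h : AEStronglyMeasurable F (volume.restrict (regular m p)) :=
    hF.aestronglyMeasurable isOpen_regular.measurableSet
  rwa [Measure.restrict_eq_self_of_ae_mem (ae_mem_regular m p)] at h

theorem continuousOn_eigProj_apply (i : Fin (min p m)) (a b : Fin p) :
    ContinuousOn (fun u : Fin m → Fin p → ℝ => eigProj u i a b) (regular m p) := fun _ hu =>
  (continuousAt_eigProj_apply hu i a b).continuousWithinAt

/-- For this indicator `φ` the spectral field is `U` times the leading projection. Testing its
monotonicity along a coordinate direction shows that each entry increases in its own variable, so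
the diagonal derivatives, which sum to the divergence, are integrable on bounded sets. -/
theorem lintegral_haffDiv_top_lt_top (k : ℕ) (R : ℝ) :
    ∫⁻ u in {u : Fin m → Fin p → ℝ | u ∈ regular m p ∧ ‖u‖ ≤ R},
      ENNReal.ofReal (haffDiv m p (fun _ i => if (i : ℕ) < k then 1 else 0) (eigval u)) < ∞ := by
  let φ : (Fin (min p m) → ℝ) → Fin (min p m) → ℝ := fun _ i => if (i : ℕ) < k then 1 else 0
  have hφ : ∀ l, DifferentiableAt ℝ φ l := fun l => differentiableAt_const _
  have hfield : ∀ u : Fin m → Fin p → ℝ, ∀ a b, spectralField φ u a b =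
      (Matrix.of u * topProj u k) a b := by
    intro u a b
    simp only [spectralField, φ, topProj, Matrix.mul_sum, Matrix.sum_apply, Finset.sum_filter]
    exact Finset.sum_congr rfl fun i _ => by split_ifs <;> simp
  set A : Set (Fin m → Fin p → ℝ) := {u | u ∈ regular m p ∧ ‖u‖ ≤ R} with hA
  have hAm : MeasurableSet A := isOpen_regular.measurableSet.inter
    (isClosed_le continuous_norm continuous_const).measurableSet
  have hab : ∀ a b, ∫⁻ u in A, ENNReal.ofReal
      (fderiv ℝ (spectralField φ) u (Pi.single a (Pi.single b 1)) a b) < ∞ := by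
    intro a b
    set e : Fin m → Fin p → ℝ := Pi.single a (Pi.single b 1) with he
    refine lintegral_deriv_lt_top_of_monotone (G := fun u => spectralField φ u a b) (e := e)
      (R := R) (C := p * (R + 1 + ‖e‖)) ?_ ?_ ?_ hAm (fun u hu => hu.2) ?_
    · refine aestronglyMeasurable_of_continuousOn_regular fun u hu => ?_
      exact ((differentiableAt_pi.mp (differentiableAt_pi.mp
        (differentiableAt_spectralField hu (hφ _)) a) b)).continuousAt.continuousWithinAt
    · intro u hu
      rw [hfield, Matrix.mul_apply]
      refine (Finset.abs_sum_le_sum_abs _ _).trans ?_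
      have : ∀ c ∈ (univ : Finset (Fin p)), |Matrix.of u a c * topProj u k c b| ≤
          R + 1 + ‖e‖ := by
        intro c _
        rw [abs_mul]
        refine (mul_le_of_le_one_right (abs_nonneg _) (abs_apply_le_one_of_proj
          (topProj_transpose u k) (topProj_mul_self u k) c b)).trans ?_
        exact ((norm_le_pi_norm (u a) c).trans (norm_le_pi_norm u a)).trans hu
      refine (Finset.sum_le_sum this).trans (le_of_eq ?_)
      rw [Finset.sum_const, Finset.card_univ, Fintype.card_fin, nsmul_eq_mul]
    · intro u t ht
      have h := topProj_field_monotone u (u + t • e) k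
      rw [Finset.sum_eq_single a, Finset.sum_eq_single b] at h
      · rw [hfield, hfield]
        have h2 : (u + t • e) a b - u a b = t := by simp [he]
        rw [h2] at h
        exact sub_nonneg.mp (nonneg_of_mul_nonneg_left h ht)
      · intro c _ hc
        simp [he, hc]
      · simp
      · intro c _ hc
        refine Finset.sum_eq_zero fun d _ => ?_
        simp [he, hc]
      · simp
    · intro u hu
      exact hasDerivAt_pi.mp (hasDerivAt_pi.mp
        ((differentiableAt_spectralField hu.1 (hφ _)).hasFDerivAt.hasLineDerivAt e) a) b
  have hle : ∀ u ∈ A, ENNReal.ofReal (haffDiv m p φ (eigval u)) ≤ ∑ a, ∑ b, ENNReal.ofReal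
      (fderiv ℝ (spectralField φ) u (Pi.single a (Pi.single b 1)) a b) := by
    intro u hu
    rw [← sum_fderiv_spectralField hu.1 (hφ _)]
    refine (ofReal_sum_le).trans (Finset.sum_le_sum fun a _ => ofReal_sum_le)
  have hm : ∀ a b, Measurable fun u : Fin m → Fin p → ℝ => ENNReal.ofReal
      (fderiv ℝ (spectralField φ) u (Pi.single a (Pi.single b 1)) a b) := fun a b =>
    (measurable_pi_iff.mp (measurable_pi_iff.mp (measurable_fderiv_apply_const ℝ _ _) a)
      b).ennreal_ofReal
  refine (setLIntegral_mono' hAm hle).trans_lt ?_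
  rw [lintegral_finsetSum _ fun a _ => Finset.measurable_fun_sum _ fun b _ => hm a b]
  refine ENNReal.sum_lt_top.mpr fun a _ => ?_
  rw [lintegral_finsetSum _ fun b _ => hm a b]
  exact ENNReal.sum_lt_top.mpr fun b _ => hab a b

/-- The sum of the inverse gaps. -/
noncomputable def gapSum {r : ℕ} (l : Fin r → ℝ) : ℝ :=
  ∑ i, ∑ j ∈ univ.filter (fun j => i < j), (l i - l j)⁻¹

theorem measurable_gapSum : Measurable fun u : Fin m → Fin p → ℝ => gapSum (eigval u) := by
  unfold gapSum
  have := measurable_eigval_apply (m := m) (p := p)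
  fun_prop

/-- When `φ` is the indicator of the first `i + 1` indices, `l_a φ_a` decreases in `a`, so every
term of the divergence is nonnegative. The pair `(i, j)` straddles the jump and contributes exactly
`l_i / (l_i - l_j)`. -/
theorem div_gap_le_haffDiv {l : Fin (min p m) → ℝ} (hl : l ∈ chamber (min p m))
    {i j : Fin (min p m)} (hij : i < j) :
    l i * (l i - l j)⁻¹ ≤
      haffDiv m p (fun _ a => if (a : ℕ) < (i : ℕ) + 1 then 1 else 0) l := by
  set φ : Fin (min p m) → ℝ := fun a => if (a : ℕ) < (i : ℕ) + 1 then 1 else 0 with hφ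
  have hpart : ∀ a, partialDiag (fun _ => φ) l a = 0 := fun a => by simp [partialDiag]
  have hφ0 : ∀ a, 0 ≤ φ a := fun a => by simp only [hφ]; split_ifs <;> norm_num
  have hv : (0 : ℝ) ≤ ((max p m : ℕ) : ℝ) - ((min p m : ℕ) : ℝ) + 1 := by
    have : ((min p m : ℕ) : ℝ) ≤ ((max p m : ℕ) : ℝ) := by exact_mod_cast min_le_max
    linarith
  have hpair : ∀ a, ∀ b ∈ univ.erase a, 0 ≤ (l a * φ a - l b * φ b) / (l a - l b) := by
    intro a b hb
    have hne : b ≠ a := Finset.ne_of_mem_erase hb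
    have la := hl.2 a
    have lb := hl.2 b
    rcases lt_or_gt_of_ne hne with h | h
    · have h1 := hl.1 h
      have h' := Fin.lt_def.mp h
      have h2 : φ a ≤ φ b := by
        simp only [hφ]
        split_ifs <;> first | (exfalso; omega) | norm_num
      rw [← neg_sub (l b * φ b), ← neg_sub (l b), neg_div_neg_eq]
      exact div_nonneg (sub_nonneg.mpr (mul_le_mul h1.le h2 (hφ0 a) lb.le)) (sub_nonneg.mpr h1.le)
    · have h1 := hl.1 h
      have h' := Fin.lt_def.mp h
      have h2 : φ b ≤ φ a := by
        simp only [hφ]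
        split_ifs <;> first | (exfalso; omega) | norm_num
      exact div_nonneg (sub_nonneg.mpr (mul_le_mul h1.le h2 (hφ0 b) la.le)) (sub_nonneg.mpr h1.le)
  have hterm : ∀ a, 0 ≤ (((max p m : ℕ) : ℝ) - ((min p m : ℕ) : ℝ) + 1) * φ a +
      2 * l a * partialDiag (fun _ => φ) l a := fun a => by
    rw [hpart, mul_zero, add_zero]
    exact mul_nonneg hv (hφ0 a)
  calc l i * (l i - l j)⁻¹ = (l i * φ i - l j * φ j) / (l i - l j) := by
        have h1 : φ i = 1 := by simp [hφ]
        have h2 : φ j = 0 := by simp only [hφ]; rw [if_neg]; omega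
        rw [h1, h2]
        ring
    _ ≤ ∑ b ∈ univ.erase i, (l i * φ i - l b * φ b) / (l i - l b) :=
        Finset.single_le_sum (hpair i) (by simp [hij.ne'])
    _ ≤ _ := le_add_of_nonneg_left (hterm i)
    _ ≤ haffDiv m p (fun _ => φ) l :=
        Finset.single_le_sum (f := fun a => (((max p m : ℕ) : ℝ) - ((min p m : ℕ) : ℝ) + 1) * φ a +
          2 * l a * partialDiag (fun _ => φ) l a +
          ∑ b ∈ univ.erase a, (l a * φ a - l b * φ b) / (l a - l b))
          (fun a _ => add_nonneg (hterm a) (Finset.sum_nonneg (hpair a))) (Finset.mem_univ i)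

/-- Where `l_i ≥ ε`, each inverse gap is at most `ε⁻¹` times the divergence of a leading-projection
field. This replaces any appeal to the joint density of the eigenvalues, and it dominates the error
made by cutting off near coinciding eigenvalues. -/
theorem integrableOn_gapSum (R : ℝ) {ε : ℝ} (hε : 0 < ε) :
    IntegrableOn (fun u : Fin m → Fin p → ℝ => gapSum (eigval u))
      {u | u ∈ regular m p ∧ ‖u‖ ≤ R ∧ ∀ i, ε ≤ eigval u i} := by
  set A : Set (Fin m → Fin p → ℝ) := {u | u ∈ regular m p ∧ ‖u‖ ≤ R ∧ ∀ i, ε ≤ eigval u i}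
  have hAm : MeasurableSet A := by
    have : A = regular m p ∩ ({u | ‖u‖ ≤ R} ∩ ⋂ i, {u | ε ≤ eigval u i}) := by
      ext u
      simp only [A, Set.mem_inter_iff, Set.mem_iInter]
      rfl
    rw [this]
    exact isOpen_regular.measurableSet.inter
      ((isClosed_le continuous_norm continuous_const).measurableSet.inter
      (MeasurableSet.iInter fun i => measurableSet_le measurable_const (measurable_eigval_apply i)))
  simp only [gapSum, IntegrableOn]
  refine integrable_finsetSum _ fun i _ => integrable_finsetSum _ fun j hj => ?_
  have hij : i < j := by simpa using hj
  refine ⟨((measurable_eigval_apply i).sub (measurable_eigval_apply j)).inv.aestronglyMeasurable,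
    ?_⟩
  rw [hasFiniteIntegral_iff_norm]
  calc ∫⁻ u in A, ENNReal.ofReal ‖(eigval u i - eigval u j)⁻¹‖
      ≤ ∫⁻ u in A, ENNReal.ofReal ε⁻¹ * ENNReal.ofReal (haffDiv m p
          (fun _ a => if (a : ℕ) < (i : ℕ) + 1 then 1 else 0) (eigval u)) := by
        refine setLIntegral_mono' hAm fun u hu => ?_
        rw [← ENNReal.ofReal_mul (inv_pos.mpr hε).le]
        refine ENNReal.ofReal_le_ofReal ?_
        have h1 := div_gap_le_haffDiv hu.1 hij
        have h2 : 0 < (eigval u i - eigval u j)⁻¹ := inv_pos.mpr (sub_pos.mpr (hu.1.1 hij))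
        rw [Real.norm_of_nonneg h2.le]
        have h3 := mul_le_mul_of_nonneg_right (hu.2.2 i) h2.le
        calc _ = ε⁻¹ * (ε * (eigval u i - eigval u j)⁻¹) := by field_simp
          _ ≤ _ := mul_le_mul_of_nonneg_left (h3.trans h1) (inv_pos.mpr hε).le
    _ ≤ ∫⁻ u in {u : Fin m → Fin p → ℝ | u ∈ regular m p ∧ ‖u‖ ≤ R}, ENNReal.ofReal ε⁻¹ *
          ENNReal.ofReal (haffDiv m p
          (fun _ a => if (a : ℕ) < (i : ℕ) + 1 then 1 else 0) (eigval u)) :=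
        lintegral_mono_set fun u hu => ⟨hu.1, hu.2.1⟩
    _ < ∞ := by
        rw [lintegral_const_mul' _ _ ENNReal.ofReal_ne_top]
        exact ENNReal.mul_lt_top ENNReal.ofReal_lt_top (lintegral_haffDiv_top_lt_top _ R)

end

/-! ### Cutoff functions of the eigenvalues. -/

section cutoff

/-- A smooth cutoff, equal to `1` on `(-∞, 1]` and to `0` on `[2, ∞)`. -/
noncomputable def cut (x : ℝ) : ℝ := Real.smoothTransition (2 - x)

theorem cut_nonneg (x : ℝ) : 0 ≤ cut x := Real.smoothTransition.nonneg _

theorem cut_le_one (x : ℝ) : cut x ≤ 1 := Real.smoothTransition.le_one _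

theorem cut_eq_one {x : ℝ} (h : x ≤ 1) : cut x = 1 :=
  Real.smoothTransition.one_of_one_le (by linarith)

theorem cut_eq_zero {x : ℝ} (h : 2 ≤ x) : cut x = 0 :=
  Real.smoothTransition.zero_of_nonpos (by linarith)

theorem contDiff_cut : ContDiff ℝ 1 cut :=
  Real.smoothTransition.contDiff.comp (contDiff_const.sub contDiff_id)

theorem continuous_cut : Continuous cut := contDiff_cut.continuous

theorem differentiable_cut : Differentiable ℝ cut := contDiff_cut.differentiable one_ne_zero

theorem deriv_cut_of_lt {x : ℝ} (h : x < 1) : deriv cut x = 0 := by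
  have : cut =ᶠ[𝓝 x] fun _ => 1 := by
    filter_upwards [Iio_mem_nhds h] with y hy
    exact cut_eq_one (le_of_lt hy)
  rw [this.deriv_eq, deriv_const]

theorem deriv_cut_of_gt {x : ℝ} (h : 2 < x) : deriv cut x = 0 := by
  have : cut =ᶠ[𝓝 x] fun _ => 0 := by
    filter_upwards [Ioi_mem_nhds h] with y hy
    exact cut_eq_zero (le_of_lt hy)
  rw [this.deriv_eq, deriv_const]

theorem exists_abs_deriv_cut_le : ∃ C : ℝ, 0 ≤ C ∧ ∀ x, |deriv cut x| ≤ C := by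
  have hc : Continuous (deriv cut) := contDiff_cut.continuous_deriv le_rfl
  obtain ⟨C, hC⟩ := (isCompact_Icc (a := (1 : ℝ)) (b := 2)).exists_bound_of_continuousOn
    hc.continuousOn
  refine ⟨max C 0, le_max_right _ _, fun x => ?_⟩
  by_cases h1 : x < 1
  · rw [deriv_cut_of_lt h1, abs_zero]; exact le_max_right _ _
  by_cases h2 : 2 < x
  · rw [deriv_cut_of_gt h2, abs_zero]; exact le_max_right _ _
  exact (hC x ⟨not_lt.mp h1, not_lt.mp h2⟩).trans (le_max_left _ _)

/-- The derivative of `cut (δ F)` is controlled by that of `F`, on the region where `δ F ≥ 1`. -/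
theorem exists_abs_fderiv_cut_le : ∃ C : ℝ, 0 ≤ C ∧ ∀ (r : ℕ) (F : (Fin r → ℝ) → ℝ) (δ : ℝ)
    (l e : Fin r → ℝ), 0 < δ → DifferentiableAt ℝ F l →
    |fderiv ℝ (fun x => cut (δ * F x)) l e| ≤
      if 1 ≤ δ * F l ∧ δ * F l ≤ 2 then C * δ * |fderiv ℝ F l e| else 0 := by
  obtain ⟨C, hC0, hC⟩ := exists_abs_deriv_cut_le
  refine ⟨C, hC0, fun r F δ l e hδ hF => ?_⟩
  have h1 : HasFDerivAt (fun x => cut (δ * F x)) (deriv cut (δ * F l) • (δ • fderiv ℝ F l)) l :=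
    (differentiable_cut _).hasDerivAt.comp_hasFDerivAt l (hF.hasFDerivAt.const_mul δ)
  rw [h1.fderiv, _root_.smul_apply, _root_.smul_apply, smul_eq_mul,
    smul_eq_mul, abs_mul, abs_mul, abs_of_pos hδ]
  split_ifs with h
  · rw [mul_assoc]
    exact mul_le_mul_of_nonneg_right (hC _) (by positivity)
  · rw [not_and_or, not_le, not_le] at h
    rcases h with h | h
    · rw [deriv_cut_of_lt h, abs_zero, zero_mul]
    · rw [deriv_cut_of_gt h, abs_zero, zero_mul]

variable {r : ℕ}

theorem gapSum_nonneg {l : Fin r → ℝ} (hl : l ∈ chamber r) : 0 ≤ gapSum l :=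
  Finset.sum_nonneg fun i _ => Finset.sum_nonneg fun j hj =>
    inv_nonneg.mpr (sub_nonneg.mpr (hl.1 (by simpa using hj)).le)

theorem inv_gap_le_gapSum {l : Fin r → ℝ} (hl : l ∈ chamber r) {i j : Fin r} (hij : i < j) :
    (l i - l j)⁻¹ ≤ gapSum l := by
  have h0 : ∀ i, ∀ j ∈ univ.filter (fun j => i < j), 0 ≤ (l i - l j)⁻¹ := fun i j hj =>
    inv_nonneg.mpr (sub_nonneg.mpr (hl.1 (by simpa using hj)).le)
  calc (l i - l j)⁻¹ ≤ ∑ j ∈ univ.filter (fun j => i < j), (l i - l j)⁻¹ :=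
        Finset.single_le_sum (f := fun j => (l i - l j)⁻¹) (h0 i) (by simpa using hij)
    _ ≤ gapSum l := Finset.single_le_sum
        (f := fun i => ∑ j ∈ univ.filter (fun j => i < j), (l i - l j)⁻¹)
        (fun i _ => Finset.sum_nonneg (h0 i)) (Finset.mem_univ i)

theorem sum_sq_le_sq_sum_of_nonneg {ι : Type*} {s : Finset ι} {F : ι → ℝ}
    (h : ∀ i ∈ s, 0 ≤ F i) : ∑ i ∈ s, F i ^ 2 ≤ (∑ i ∈ s, F i) ^ 2 := by
  rw [sq (∑ i ∈ s, F i), Finset.sum_mul]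
  refine Finset.sum_le_sum fun i hi => ?_
  rw [sq]
  exact mul_le_mul_of_nonneg_left (Finset.single_le_sum h hi) (h i hi)

/-- The quadratic bound is what the cutoff needs: where `1 ≤ δ γ ≤ 2`, with `γ` the sum of inverse
gaps, the derivative of `cut (δ γ)` is at most a constant times `δ γ² ≤ 2 γ`, an integrable bound
free of `δ`. -/
theorem hasFDerivAt_gapSum {l : Fin r → ℝ} (hl : l ∈ chamber r) :
    DifferentiableAt ℝ (gapSum (r := r)) l ∧
      ∀ k, |fderiv ℝ (gapSum (r := r)) l (Pi.single k 1)| ≤ gapSum l ^ 2 := by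
  have hne : ∀ i, ∀ j ∈ univ.filter (fun j => i < j), l i - l j ≠ 0 := fun i j hj =>
    (sub_pos.mpr (hl.1 (by simpa using hj))).ne'
  have hterm : ∀ i, ∀ j ∈ univ.filter (fun j => i < j), HasFDerivAt
      (fun l : Fin r → ℝ => (l i - l j)⁻¹)
      ((-((l i - l j) ^ 2)⁻¹) • (ContinuousLinearMap.proj (R := ℝ) (φ := fun _ : Fin r => ℝ) i -
        ContinuousLinearMap.proj (R := ℝ) (φ := fun _ : Fin r => ℝ) j)) l := fun i j hj =>
    (hasDerivAt_inv (hne i j hj)).comp_hasFDerivAt l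
      ((hasFDerivAt_apply i l).sub (hasFDerivAt_apply j l))
  have hsum : HasFDerivAt (gapSum (r := r)) (∑ i, ∑ j ∈ univ.filter (fun j => i < j),
      (-((l i - l j) ^ 2)⁻¹) • (ContinuousLinearMap.proj (R := ℝ) (φ := fun _ : Fin r => ℝ) i -
        ContinuousLinearMap.proj (R := ℝ) (φ := fun _ : Fin r => ℝ) j)) l :=
    HasFDerivAt.fun_sum fun i _ => HasFDerivAt.fun_sum fun j hj => hterm i j hj
  refine ⟨hsum.differentiableAt, fun k => ?_⟩
  rw [hsum.fderiv]
  simp only [_root_.sum_apply, _root_.smul_apply,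
    _root_.sub_apply, ContinuousLinearMap.proj_apply, smul_eq_mul]
  have h0 : ∀ i, ∀ j ∈ univ.filter (fun j => i < j), 0 ≤ (l i - l j)⁻¹ := fun i j hj =>
    inv_nonneg.mpr (sub_nonneg.mpr (hl.1 (by simpa using hj)).le)
  calc _ ≤ ∑ i, ∑ j ∈ univ.filter (fun j => i < j), ((l i - l j)⁻¹) ^ 2 := by
        refine (Finset.abs_sum_le_sum_abs _ _).trans (Finset.sum_le_sum fun i _ => ?_)
        refine (Finset.abs_sum_le_sum_abs _ _).trans (Finset.sum_le_sum fun j hj => ?_)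
        have hij : i < j := by simpa using hj
        rw [abs_mul, abs_neg, abs_of_nonneg (inv_nonneg.mpr (sq_nonneg _)), inv_pow]
        refine mul_le_of_le_one_right (inv_nonneg.mpr (sq_nonneg _)) ?_
        by_cases hi : i = k
        · have hj : j ≠ k := by rw [← hi]; exact hij.ne'
          simp [hi, hj]
        · by_cases hj : j = k <;> simp [hi, hj]
    _ ≤ ∑ i, (∑ j ∈ univ.filter (fun j => i < j), (l i - l j)⁻¹) ^ 2 :=
        Finset.sum_le_sum fun i _ => sum_sq_le_sq_sum_of_nonneg (h0 i)
    _ ≤ _ := sum_sq_le_sq_sum_of_nonneg fun i _ => Finset.sum_nonneg (h0 i)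

/-- The sum of the inverse eigenvalues. -/
noncomputable def invSum (l : Fin r → ℝ) : ℝ := ∑ i, (l i)⁻¹

theorem inv_le_invSum {l : Fin r → ℝ} (hl : ∀ i, 0 < l i) (i : Fin r) : (l i)⁻¹ ≤ invSum l :=
  Finset.single_le_sum (f := fun i => (l i)⁻¹) (fun i _ => (inv_pos.mpr (hl i)).le)
    (Finset.mem_univ i)

/-- Since `l_k⁻¹` is at most the sum of inverses, `l_k |∂_k cut (ε · invSum)|` stays bounded
uniformly in `ε`; the divergence contains precisely this weighted derivative. -/
theorem hasFDerivAt_invSum {l : Fin r → ℝ} (hl : ∀ i, 0 < l i) :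
    DifferentiableAt ℝ (invSum (r := r)) l ∧
      ∀ k, |fderiv ℝ (invSum (r := r)) l (Pi.single k 1)| = (l k)⁻¹ ^ 2 := by
  have hsum : HasFDerivAt (invSum (r := r)) (∑ i, (-((l i) ^ 2)⁻¹) •
      (ContinuousLinearMap.proj (R := ℝ) (φ := fun _ : Fin r => ℝ) i)) l :=
    HasFDerivAt.fun_sum fun i _ => (hasDerivAt_inv (hl i).ne').comp_hasFDerivAt l
      (hasFDerivAt_apply i l)
  refine ⟨hsum.differentiableAt, fun k => ?_⟩
  rw [hsum.fderiv]
  simp [Pi.single_apply, inv_pow]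

end cutoff

/-! ### Cutoffs inside the divergence, and the quadratic form `tr x Σ⁻¹ xᵀ`. -/

section

variable {m p : ℕ}

/-- Multiplying `φ` by a scalar function of the eigenvalues adds a first order term. -/
theorem haffDiv_smul {χ : (Fin (min p m) → ℝ) → ℝ}
    {φ : (Fin (min p m) → ℝ) → Fin (min p m) → ℝ} {l : Fin (min p m) → ℝ}
    (hχ : DifferentiableAt ℝ χ l) (hφ : DifferentiableAt ℝ φ l) :
    haffDiv m p (fun x => χ x • φ x) l = χ l * haffDiv m p φ l +
      ∑ i, 2 * l i * φ l i * fderiv ℝ χ l (Pi.single i 1) := by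
  have hpart : ∀ i, partialDiag (fun x => χ x • φ x) l i =
      χ l * partialDiag φ l i + φ l i * fderiv ℝ χ l (Pi.single i 1) := by
    intro i
    have h := hχ.hasFDerivAt.mul (differentiableAt_pi.mp hφ i).hasFDerivAt
    have e : (fun x => (χ x • φ x) i) = fun x => χ x * φ x i := rfl
    rw [partialDiag, e]
    change fderiv ℝ (χ * fun x => φ x i) l _ = _
    rw [h.fderiv]
    simp [partialDiag]
  simp only [haffDiv, hpart, Finset.mul_sum, ← Finset.sum_add_distrib, Pi.smul_apply, smul_eq_mul]
  refine Finset.sum_congr rfl fun i _ => ?_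
  have : ∑ j ∈ univ.erase i, (l i * (χ l * φ l i) - l j * (χ l * φ l j)) / (l i - l j) =
      χ l * ∑ j ∈ univ.erase i, (l i * φ l i - l j * φ l j) / (l i - l j) := by
    rw [Finset.mul_sum]
    exact Finset.sum_congr rfl fun j _ => by ring
  rw [this]
  ring

/-- The quadratic form `tr x Σ⁻¹ xᵀ`. -/
noncomputable def rowForm {n p : ℕ} (Sig : Matrix (Fin p) (Fin p) ℝ) (x : Fin n → Fin p → ℝ) : ℝ :=
  (Matrix.of x * Sig⁻¹ * (Matrix.of x)ᵀ).trace

/-- `tr (Σ⁻¹ H L Φ(L) Hᵀ)`. -/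
noncomputable def haffWeight (Sig : Matrix (Fin p) (Fin p) ℝ)
    (φ : (Fin (min p m) → ℝ) → Fin (min p m) → ℝ) (u : Fin m → Fin p → ℝ) : ℝ :=
  ∑ i, φ (eigval u) i * (eigval u i * (Sig⁻¹ * eigProj u i).trace)

variable {Sig : Matrix (Fin p) (Fin p) ℝ}

theorem rowForm_eq_sum {n : ℕ} (x : Fin n → Fin p → ℝ) :
    rowForm Sig x = ∑ k, ∑ b, (∑ a, x k a * Sig⁻¹ a b) * x k b := by
  simp [rowForm, Matrix.trace, Matrix.mul_apply]

theorem rowForm_eq_sum_row {n : ℕ} (x : Fin n → Fin p → ℝ) :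
    rowForm Sig x = ∑ k, x k ⬝ᵥ Sig⁻¹ *ᵥ x k := by
  simp only [rowForm, Matrix.trace, Matrix.diag_apply]
  refine Finset.sum_congr rfl fun k _ => ?_
  rw [Matrix.mul_apply, Matrix.dotProduct_mulVec]
  rfl

theorem continuous_rowForm {n : ℕ} : Continuous fun x : Fin n → Fin p → ℝ => rowForm Sig x := by
  simp only [rowForm_eq_sum]
  fun_prop

theorem rowForm_nonneg {n : ℕ} (hSig : Sig.PosDef) (x : Fin n → Fin p → ℝ) : 0 ≤ rowForm Sig x := by
  rw [rowForm_eq_sum_row]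
  exact Finset.sum_nonneg fun k _ => by
    simpa using hSig.inv.posSemidef.dotProduct_mulVec_nonneg (x k)

theorem rowForm_pos {n : ℕ} (hSig : Sig.PosDef) {x : Fin n → Fin p → ℝ} (hx : x ≠ 0) :
    0 < rowForm Sig x := by
  rw [rowForm_eq_sum_row]
  obtain ⟨k, hk⟩ := Function.ne_iff.mp hx
  refine Finset.sum_pos' (fun k _ => by
    simpa using hSig.inv.posSemidef.dotProduct_mulVec_nonneg (x k)) ⟨k, Finset.mem_univ k, ?_⟩
  simpa using hSig.inv.dotProduct_mulVec_pos hk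

theorem rowForm_smul {n : ℕ} (c : ℝ) (x : Fin n → Fin p → ℝ) :
    rowForm Sig (c • x) = c ^ 2 * rowForm Sig x := by
  simp only [rowForm_eq_sum, Finset.mul_sum, Finset.sum_mul, Pi.smul_apply, smul_eq_mul]
  exact Finset.sum_congr rfl fun k _ => Finset.sum_congr rfl fun b _ =>
    Finset.sum_congr rfl fun a _ => by ring

theorem exists_mul_sq_norm_le_rowForm {n : ℕ} (hSig : Sig.PosDef) :
    ∃ κ : ℝ, 0 < κ ∧ ∀ x : Fin n → Fin p → ℝ, κ * ‖x‖ ^ 2 ≤ rowForm Sig x := by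
  rcases (Metric.sphere (0 : Fin n → Fin p → ℝ) 1).eq_empty_or_nonempty with h | h
  · refine ⟨1, one_pos, fun x => ?_⟩
    have hx : x = 0 := by
      by_contra hx
      have : ‖x‖⁻¹ • x ∈ Metric.sphere (0 : Fin n → Fin p → ℝ) 1 := by
        rw [mem_sphere_zero_iff_norm, norm_smul, norm_inv, norm_norm,
          inv_mul_cancel₀ (norm_ne_zero_iff.mpr hx)]
      rw [h] at this
      exact this
    rw [hx, norm_zero]
    simpa using rowForm_nonneg hSig (0 : Fin n → Fin p → ℝ)
  · obtain ⟨y, hy, hmin⟩ := (isCompact_sphere (0 : Fin n → Fin p → ℝ) 1).exists_isMinOn h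
      (continuous_rowForm (Sig := Sig)).continuousOn
    have hy0 : y ≠ 0 := by
      rintro rfl
      simp at hy
    refine ⟨rowForm Sig y, rowForm_pos hSig hy0, fun x => ?_⟩
    by_cases hx : x = 0
    · rw [hx, norm_zero]
      simpa using rowForm_nonneg hSig (0 : Fin n → Fin p → ℝ)
    have hn := norm_ne_zero_iff.mpr hx
    have hmem : ‖x‖⁻¹ • x ∈ Metric.sphere (0 : Fin n → Fin p → ℝ) 1 := by
      rw [mem_sphere_zero_iff_norm, norm_smul, norm_inv, norm_norm, inv_mul_cancel₀ hn]
    have := isMinOn_iff.mp hmin _ hmem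
    rw [rowForm_smul] at this
    calc rowForm Sig y * ‖x‖ ^ 2 ≤ (‖x‖⁻¹ ^ 2 * rowForm Sig x) * ‖x‖ ^ 2 := by gcongr
      _ = rowForm Sig x := by field_simp

theorem exists_norm_le_of_rowForm_le {n : ℕ} (hSig : Sig.PosDef) (T : ℝ) :
    ∃ R : ℝ, 0 ≤ R ∧ ∀ x : Fin n → Fin p → ℝ, rowForm Sig x ≤ T → ‖x‖ ≤ R := by
  obtain ⟨κ, hκ, h⟩ := exists_mul_sq_norm_le_rowForm (n := n) hSig
  refine ⟨Real.sqrt (T / κ), Real.sqrt_nonneg _, fun x hx => Real.le_sqrt_of_sq_le ?_⟩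
  rw [le_div_iff₀ hκ, mul_comm]
  exact (h x).trans hx

theorem hasFDerivAt_rowForm {n : ℕ} (hSig : Sig.PosDef) (u : Fin n → Fin p → ℝ) :
    DifferentiableAt ℝ (fun x : Fin n → Fin p → ℝ => rowForm Sig x) u ∧
      ∀ B, fderiv ℝ (fun x : Fin n → Fin p → ℝ => rowForm Sig x) u B =
        2 * (Matrix.of u * Sig⁻¹ * (Matrix.of B)ᵀ).trace := by
  have hd : DifferentiableAt ℝ (fun x : Fin n → Fin p → ℝ => rowForm Sig x) u := by
    simp only [rowForm_eq_sum]
    fun_prop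
  refine ⟨hd, fun B => ?_⟩
  have h1 : HasDerivAt (fun t : ℝ => rowForm Sig (u + t • B)) _ 0 :=
    hd.hasFDerivAt.hasLineDerivAt B
  have hconst : HasMatDerivAt (fun _ : ℝ => Sig⁻¹) 0 0 := fun a b => hasDerivAt_const _ _
  have h2 := ((hasMatDerivAt_line u B).mul hconst).mul (hasMatDerivAt_line u B).transpose
  have h3 : HasDerivAt (fun t : ℝ => rowForm Sig (u + t • B))
      ((Matrix.of B * Sig⁻¹ * (Matrix.of u)ᵀ + Matrix.of u * Sig⁻¹ * (Matrix.of B)ᵀ).trace) 0 := by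
    have := HasDerivAt.fun_sum (u := univ) fun k _ => h2 k k
    simpa [rowForm, Matrix.trace] using this
  rw [h1.unique h3, Matrix.trace_add, two_mul]
  congr 1
  have hsymm : (Sig⁻¹)ᵀ = Sig⁻¹ := by
    have := hSig.inv.isHermitian.eq
    rwa [Matrix.conjTranspose_eq_transpose_of_trivial] at this
  rw [← Matrix.trace_transpose, Matrix.transpose_mul, Matrix.transpose_mul,
    Matrix.transpose_transpose, hsymm, Matrix.mul_assoc]

/-- The gradient is `2 U Σ⁻¹`; pairing it with `U P_i` produces `2 tr(Σ⁻¹ P_i S) = 2 l_i tr(Σ⁻¹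
P_i)`. This is how `haffWeight` enters the integration by parts. -/
theorem fderiv_rowForm_spectralField (hSig : Sig.PosDef)
    (φ : (Fin (min p m) → ℝ) → Fin (min p m) → ℝ) (u : Fin m → Fin p → ℝ) :
    fderiv ℝ (fun x : Fin m → Fin p → ℝ => rowForm Sig x) u (spectralField φ u) =
      2 * haffWeight Sig φ u := by
  rw [(hasFDerivAt_rowForm hSig u).2]
  congr 1
  have : Matrix.of (spectralField φ u) =
      ∑ i, φ (eigval u) i • (Matrix.of u * eigProj u i) := by
    ext k a
    simp [spectralField, Matrix.sum_apply]
  rw [this, Matrix.transpose_sum, Matrix.mul_sum, Matrix.trace_sum, haffWeight]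
  refine Finset.sum_congr rfl fun i _ => ?_
  rw [Matrix.transpose_smul, Matrix.mul_smul, Matrix.trace_smul, Matrix.transpose_mul,
    eigProj_transpose, smul_eq_mul, Matrix.mul_assoc, Matrix.trace_mul_comm, ← Matrix.mul_assoc,
    Matrix.mul_assoc _ _ (Matrix.of u)]
  change _ * (Sig⁻¹ * eigProj u i * gramMat u).trace = _
  rw [Matrix.mul_assoc, eigProj_mul_gramMat, Matrix.mul_smul, Matrix.trace_smul, smul_eq_mul]

end

/-! ### Stein's inequality in `u`, with a smooth weight. -/

section

variable {m p : ℕ} {Sig : Matrix (Fin p) (Fin p) ℝ}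

/-- Stein's inequality for a field supported away from the singular set, with a smooth weight. -/
theorem integral_nonneg_of_haffDiv_le (hSig : Sig.PosDef)
    {φ : (Fin (min p m) → ℝ) → Fin (min p m) → ℝ}
    (hφ : DifferentiableOn ℝ φ (chamber (min p m)))
    (hvan : ∀ u ∉ regular m p, ∀ᶠ w in 𝓝 u, w ∈ regular m p → φ (eigval w) = 0)
    {η η' : ℝ → ℝ} (hη : ∀ t, HasDerivAt η (η' t) t) {T : ℝ} (hT : ∀ t, T ≤ t → η t = 0) (c : ℝ)
    {k : (Fin m → Fin p → ℝ) → ℝ} (hk : Integrable k)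
    (hle : ∀ u ∈ regular m p, η (c + rowForm Sig u) * haffDiv m p φ (eigval u) +
      2 * η' (c + rowForm Sig u) * haffWeight Sig φ u ≤ k u) : 0 ≤ ∫ u, k u := by
  classical
  -- The extension by zero is differentiable everywhere: by `hvan` it vanishes in a neighbourhood of
  -- every singular matrix.
  let X : (Fin m → Fin p → ℝ) → Fin m → Fin p → ℝ := (regular m p).indicator (spectralField φ)
  have hQd : ∀ u, HasFDerivAt (fun x : Fin m → Fin p → ℝ => rowForm Sig x)
      (fderiv ℝ (fun x : Fin m → Fin p → ℝ => rowForm Sig x) u) u := fun u =>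
    (hasFDerivAt_rowForm hSig u).1.hasFDerivAt
  have hηQ : ∀ u, HasFDerivAt (fun x : Fin m → Fin p → ℝ => η (c + rowForm Sig x))
      (η' (c + rowForm Sig u) • fderiv ℝ (fun x : Fin m → Fin p → ℝ => rowForm Sig x) u) u :=
    fun u => (hη _).comp_hasFDerivAt u ((hQd u).const_add c)
  have hXreg : ∀ u ∈ regular m p, HasFDerivAt X (fderiv ℝ (spectralField φ) u) u := by
    intro u hu
    have h1 := (differentiableAt_spectralField hu
      ((hφ _ hu).differentiableAt ((isOpen_chamber _).mem_nhds hu))).hasFDerivAt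
    refine h1.congr_of_eventuallyEq ?_
    filter_upwards [isOpen_regular.mem_nhds hu] with w hw
    exact Set.indicator_of_mem hw _
  have hXsing : ∀ u ∉ regular m p, X =ᶠ[𝓝 u] fun _ => 0 := by
    intro u hu
    filter_upwards [hvan u hu] with w hw
    by_cases hr : w ∈ regular m p
    · have hXw : X w = spectralField φ w := Set.indicator_of_mem hr _
      rw [hXw]
      funext k a
      simp [spectralField, hw hr]
    · exact Set.indicator_of_notMem hr _
  have hXd : ∀ u, DifferentiableAt ℝ X u := by
    intro u
    by_cases hu : u ∈ regular m p
    · exact (hXreg u hu).differentiableAt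
    · exact (differentiableAt_const _).congr_of_eventuallyEq (hXsing u hu)
  -- The weight gives compact support, since `η` vanishes beyond `T` and the quadratic form is
  -- coercive.
  let Y : (Fin m → Fin p → ℝ) → Fin m → Fin p → ℝ := fun u => η (c + rowForm Sig u) • X u
  have hYd : ∀ u, HasFDerivAt Y (η (c + rowForm Sig u) • fderiv ℝ X u +
      (η' (c + rowForm Sig u) • fderiv ℝ (fun x : Fin m → Fin p → ℝ => rowForm Sig x) u).smulRight
        (X u)) u := fun u => (hηQ u).smul (hXd u).hasFDerivAt
  obtain ⟨R, hR0, hR⟩ := exists_norm_le_of_rowForm_le (n := m) hSig (T - c)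
  have hYc : HasCompactSupport Y := by
    refine HasCompactSupport.of_support_subset_isCompact (isCompact_closedBall 0 R) fun u hu => ?_
    rw [mem_closedBall_zero_iff]
    refine hR u ?_
    by_contra h
    refine hu ?_
    simp only [Y]
    rw [hT _ (by linarith), zero_smul]
  have hsumX : ∀ u, ∑ i, ∑ a, fderiv ℝ (fun x : Fin m → Fin p → ℝ => rowForm Sig x) u
      (Pi.single i (Pi.single a 1)) * X u i a =
      fderiv ℝ (fun x : Fin m → Fin p → ℝ => rowForm Sig x) u (X u) := by
    intro u
    have e : X u = ∑ i, ∑ a, X u i a • (Pi.single i (Pi.single a (1 : ℝ)) : Fin m → Fin p → ℝ) := by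
      funext k b
      simp [Finset.sum_apply, Pi.single_apply, ite_apply]
    conv_rhs => rw [e, map_sum]
    refine Finset.sum_congr rfl fun i _ => ?_
    rw [map_sum]
    refine Finset.sum_congr rfl fun a _ => ?_
    rw [map_smul, smul_eq_mul, mul_comm]
  have hdivY : ∀ u, ∑ i, ∑ a, fderiv ℝ Y u (Pi.single i (Pi.single a 1)) i a =
      η (c + rowForm Sig u) * ∑ i, ∑ a, fderiv ℝ X u (Pi.single i (Pi.single a 1)) i a +
      η' (c + rowForm Sig u) *
        fderiv ℝ (fun x : Fin m → Fin p → ℝ => rowForm Sig x) u (X u) := by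
    intro u
    rw [(hYd u).fderiv, ← hsumX, Finset.mul_sum, Finset.mul_sum, ← Finset.sum_add_distrib]
    refine Finset.sum_congr rfl fun i _ => ?_
    rw [Finset.mul_sum, Finset.mul_sum, ← Finset.sum_add_distrib]
    refine Finset.sum_congr rfl fun a _ => ?_
    simp [mul_assoc]
  have hki : Integrable ((regular m p).indicator k) := hk.indicator isOpen_regular.measurableSet
  have hae : (regular m p).indicator k =ᵐ[volume] k := by
    filter_upwards [ae_mem_regular m p] with u hu
    exact Set.indicator_of_mem hu _
  rw [← integral_congr_ae hae]
  refine integral_nonneg_of_divergence_le (fun u => (hYd u).differentiableAt) hYc hki fun u => ?_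
  rw [hdivY]
  by_cases hu : u ∈ regular m p
  · rw [Set.indicator_of_mem hu, (hXreg u hu).fderiv, sum_fderiv_spectralField hu
      ((hφ _ hu).differentiableAt ((isOpen_chamber _).mem_nhds hu))]
    refine le_trans (le_of_eq ?_) (hle u hu)
    have : X u = spectralField φ u := Set.indicator_of_mem hu _
    rw [this, fderiv_rowForm_spectralField hSig]
    ring
  · rw [Set.indicator_of_notMem hu, (hXsing u hu).fderiv_eq]
    have : X u = 0 := Set.indicator_of_notMem hu _
    rw [this]
    simp

theorem eigval_le_of_norm_le {R : ℝ} {u : Fin m → Fin p → ℝ} (hu : ‖u‖ ≤ R) (i : Fin (min p m)) :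
    eigval u i ≤ p * (m * R ^ 2) := by
  have h1 : eigval u i ≤ ∑ j, eigval u j :=
    Finset.single_le_sum (f := fun j => eigval u j) (fun j _ => eigval_nonneg u j)
      (Finset.mem_univ i)
  have h2 : ∑ j, eigval u j = (gramMat u).trace := by
    rw [gramMat_eq_sum, Matrix.trace_sum]
    exact Finset.sum_congr rfl fun j _ => by rw [Matrix.trace_smul, eigProj_trace]; simp
  have h3 : (gramMat u).trace ≤ ∑ _a : Fin p, ∑ _k : Fin m, R ^ 2 := by
    rw [Matrix.trace]
    refine Finset.sum_le_sum fun a _ => ?_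
    rw [Matrix.diag_apply, gramMat, Matrix.mul_apply]
    refine Finset.sum_le_sum fun k _ => ?_
    have := (norm_le_pi_norm (u k) a).trans ((norm_le_pi_norm u k).trans hu)
    rw [Matrix.transpose_apply, ← sq, Matrix.of_apply, ← sq_abs]
    exact pow_le_pow_left₀ (abs_nonneg _) this 2
  refine h1.trans (h2.le.trans (h3.trans (le_of_eq ?_)))
  simp

theorem exists_abs_trace_mul_eigProj_le (m : ℕ) (A : Matrix (Fin p) (Fin p) ℝ) :
    ∃ C : ℝ, 0 ≤ C ∧ ∀ (u : Fin m → Fin p → ℝ) i, |(A * eigProj u i).trace| ≤ C := by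
  refine ⟨∑ a, ∑ b, |A a b|, Finset.sum_nonneg fun _ _ => Finset.sum_nonneg fun _ _ => abs_nonneg _,
    fun u i => ?_⟩
  rw [Matrix.trace]
  refine (Finset.abs_sum_le_sum_abs _ _).trans (Finset.sum_le_sum fun a _ => ?_)
  rw [Matrix.diag_apply, Matrix.mul_apply]
  refine (Finset.abs_sum_le_sum_abs _ _).trans (Finset.sum_le_sum fun b _ => ?_)
  rw [abs_mul]
  exact mul_le_of_le_one_right (abs_nonneg _) (abs_apply_le_one_of_proj (eigProj_transpose u i)
    (eigProj_mul_self u i) b a)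

theorem continuousOn_comp_eigval {β : Type*} [TopologicalSpace β] {F : (Fin (min p m) → ℝ) → β}
    (hF : ContinuousOn F (chamber (min p m))) :
    ContinuousOn (fun u : Fin m → Fin p → ℝ => F (eigval u)) (regular m p) :=
  hF.comp continuous_eigval.continuousOn fun _ hu => hu

theorem continuousOn_trace_mul_eigProj (A : Matrix (Fin p) (Fin p) ℝ) (i : Fin (min p m)) :
    ContinuousOn (fun u : Fin m → Fin p → ℝ => (A * eigProj u i).trace) (regular m p) := by
  simp only [Matrix.trace, Matrix.diag_apply, Matrix.mul_apply]
  exact continuousOn_finsetSum _ fun a _ => continuousOn_finsetSum _ fun b _ =>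
    continuousOn_const.mul (continuousOn_eigProj_apply i b a)

theorem continuousOn_haffWeight {φ : (Fin (min p m) → ℝ) → Fin (min p m) → ℝ}
    (hφ : ContinuousOn φ (chamber (min p m))) :
    ContinuousOn (fun u : Fin m → Fin p → ℝ => haffWeight Sig φ u) (regular m p) := by
  unfold haffWeight
  refine continuousOn_finsetSum _ fun i _ => ContinuousOn.mul ?_ (ContinuousOn.mul ?_ ?_)
  · exact continuousOn_comp_eigval (continuousOn_pi.mp hφ i)
  · exact (continuous_eigval_apply i).continuousOn
  · exact continuousOn_trace_mul_eigProj _ i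

/-- A singular matrix has a zero eigenvalue or two equal positive ones; by continuity, nearby
regular matrices have a small eigenvalue or a large inverse gap. In either case the doubly cut field
vanishes. -/
theorem eventually_gapSum_gt {u : Fin m → Fin p → ℝ} {ε K : ℝ} (hε : 0 < ε)
    (hu : u ∉ regular m p) :
    ∀ᶠ w in 𝓝 u, w ∈ regular m p → (∃ i, eigval w i < ε) ∨ K ≤ gapSum (eigval w) := by
  by_cases hpos : ∀ i, 0 < eigval u i
  · have hns : ¬ StrictAnti (eigval u) := fun h => hu ⟨h, hpos⟩
    simp only [StrictAnti, not_forall, not_lt] at hns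
    obtain ⟨i, j, hij, hle⟩ := hns
    have hc : Continuous fun w : Fin m → Fin p → ℝ => eigval w i - eigval w j :=
      (continuous_eigval_apply i).sub (continuous_eigval_apply j)
    have hK : 0 < (max K 1)⁻¹ := inv_pos.mpr (lt_of_lt_of_le one_pos (le_max_right _ _))
    have hev : ∀ᶠ w in 𝓝 u, eigval w i - eigval w j < (max K 1)⁻¹ :=
      hc.continuousAt.eventually_lt continuousAt_const (by linarith)
    filter_upwards [hev] with w hw hr
    right
    have hpos' : 0 < eigval w i - eigval w j := sub_pos.mpr (hr.1 hij)
    calc K ≤ max K 1 := le_max_left _ _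
      _ ≤ (eigval w i - eigval w j)⁻¹ := by
        rw [← inv_inv (max K 1)]
        exact inv_anti₀ hpos' hw.le
      _ ≤ _ := inv_gap_le_gapSum hr hij
  · push Not at hpos
    obtain ⟨i, hi⟩ := hpos
    have hev : ∀ᶠ w in 𝓝 u, eigval w i < ε :=
      (continuous_eigval_apply i).continuousAt.eventually_lt continuousAt_const (by linarith)
    filter_upwards [hev] with w hw _
    exact Or.inl ⟨i, hw⟩

theorem tendsto_cut_div (x : ℝ) :
    ∀ᶠ n : ℕ in atTop, cut (1 / ((n : ℝ) + 1) * x) = 1 := by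
  obtain ⟨N, hN⟩ := exists_nat_ge x
  filter_upwards [eventually_ge_atTop N] with n hn
  apply cut_eq_one
  have : (N : ℝ) ≤ n := by exact_mod_cast hn
  rw [one_div, inv_mul_le_iff₀ (by positivity)]
  linarith

/-- Stein's inequality for a field supported in `{l_i ≥ ε}`, with a smooth weight. -/
theorem integral_nonneg_of_haffDiv_le_of_vanish (hSig : Sig.PosDef)
    {φ : (Fin (min p m) → ℝ) → Fin (min p m) → ℝ}
    (hφ : DifferentiableOn ℝ φ (chamber (min p m))) {ε : ℝ} (hε : 0 < ε)
    (hvan : ∀ l ∈ chamber (min p m), (∃ i, l i < ε) → φ l = 0)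
    (hbdd : ∀ R : ℝ, ∃ C : ℝ, ∀ l ∈ chamber (min p m), (∀ i, l i ≤ R) → ∀ i, |φ l i| ≤ C)
    {η η' : ℝ → ℝ} (hη : ∀ t, HasDerivAt η (η' t) t) (hη0 : ∀ t, 0 ≤ η t) (hη' : Continuous η')
    {T : ℝ} (hT : ∀ t, T ≤ t → η t = 0) (hT' : ∀ t, T ≤ t → η' t = 0) (c : ℝ)
    {k : (Fin (min p m) → ℝ) → ℝ} (hk : ∀ l ∈ chamber (min p m), haffDiv m p φ l ≤ k l)
    (hki : IntegrableOn (fun u : Fin m → Fin p → ℝ => k (eigval u)) {u | c + rowForm Sig u < T}) :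
    0 ≤ ∫ u : Fin m → Fin p → ℝ, (η (c + rowForm Sig u) * k (eigval u) +
      2 * η' (c + rowForm Sig u) * haffWeight Sig φ u) := by
  classical
  set D : Set (Fin m → Fin p → ℝ) := {u | c + rowForm Sig u < T} with hD
  have hDo : IsOpen D :=
    isOpen_lt (continuous_const.add continuous_rowForm) continuous_const
  obtain ⟨R, hR0, hR⟩ := exists_norm_le_of_rowForm_le (n := m) hSig (T - c)
  have hDR : ∀ u ∈ D, ‖u‖ ≤ R := fun u hu => hR u (by
    have : c + rowForm Sig u < T := hu
    linarith)
  have hDfin : volume D ≠ ∞ := by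
    refine ne_top_of_le_ne_top (isCompact_closedBall (0 : Fin m → Fin p → ℝ) R).measure_lt_top.ne
      (measure_mono fun u hu => mem_closedBall_zero_iff.mpr (hDR u hu))
  set R' : ℝ := p * (m * R ^ 2) with hR'
  have hR'0 : 0 ≤ R' := by positivity
  have hlR : ∀ u ∈ D, ∀ i, eigval u i ≤ R' := fun u hu i => eigval_le_of_norm_le (hDR u hu) i
  obtain ⟨Cφ', hCφ'⟩ := hbdd R'
  set Cφ := max Cφ' 0 with hCφdef
  have hCφ0 : 0 ≤ Cφ := le_max_right _ _
  have hCφ : ∀ u ∈ D, u ∈ regular m p → ∀ i, |φ (eigval u) i| ≤ Cφ := fun u hu hr i =>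
    (hCφ' _ hr (hlR u hu) i).trans (le_max_left _ _)
  obtain ⟨Cs, hCs0, hCs⟩ := exists_abs_trace_mul_eigProj_le m Sig⁻¹
  have hηc : Continuous η := continuous_iff_continuousAt.mpr fun t => (hη t).continuousAt
  obtain ⟨M, hM0, hM⟩ : ∃ M : ℝ, 0 ≤ M ∧ ∀ u : Fin m → Fin p → ℝ,
      |η (c + rowForm Sig u)| ≤ M ∧ |η' (c + rowForm Sig u)| ≤ M := by
    obtain ⟨M1, hM1⟩ := (isCompact_Icc (a := c) (b := T)).exists_bound_of_continuousOn
      hηc.continuousOn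
    obtain ⟨M2, hM2⟩ := (isCompact_Icc (a := c) (b := T)).exists_bound_of_continuousOn
      hη'.continuousOn
    refine ⟨max (max M1 M2) 0, le_max_right _ _, fun u => ?_⟩
    have h0 := rowForm_nonneg hSig u
    by_cases h : T ≤ c + rowForm Sig u
    · rw [hT _ h, hT' _ h, abs_zero]
      exact ⟨le_max_right _ _, le_max_right _ _⟩
    · have hmem : c + rowForm Sig u ∈ Set.Icc c T := ⟨by linarith, (not_le.mp h).le⟩
      exact ⟨(hM1 _ hmem).trans ((le_max_left _ _).trans (le_max_left _ _)),
        (hM2 _ hmem).trans ((le_max_right _ _).trans (le_max_left _ _))⟩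
  have hoff : ∀ u ∉ D, η (c + rowForm Sig u) = 0 ∧ η' (c + rowForm Sig u) = 0 := fun u hu =>
    ⟨hT _ (not_lt.mp hu), hT' _ (not_lt.mp hu)⟩
  obtain ⟨C, hC0, hC⟩ := exists_abs_fderiv_cut_le
  let δ : ℕ → ℝ := fun n => 1 / ((n : ℝ) + 1)
  have hδ0 : ∀ n, 0 < δ n := fun n => by positivity
  let χ : ℕ → (Fin (min p m) → ℝ) → ℝ := fun n l => cut (δ n * gapSum l)
  let rem : ℕ → (Fin m → Fin p → ℝ) → ℝ := fun n u =>
    if 1 ≤ δ n * gapSum (eigval u) ∧ δ n * gapSum (eigval u) ≤ 2 then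
      2 * C * gapSum (eigval u) * ∑ i, 2 * eigval u i * |φ (eigval u) i| else 0
  let kn : ℕ → (Fin m → Fin p → ℝ) → ℝ := fun n u =>
    η (c + rowForm Sig u) * (χ n (eigval u) * k (eigval u) + rem n u) +
      2 * η' (c + rowForm Sig u) * (χ n (eigval u) * haffWeight Sig φ u)
  have hχd : ∀ n, ∀ l ∈ chamber (min p m), DifferentiableAt ℝ (χ n) l := fun n l hl =>
    (differentiable_cut _).comp l ((hasFDerivAt_gapSum hl).1.const_mul (δ n))
  have hφd : ∀ l ∈ chamber (min p m), DifferentiableAt ℝ φ l := fun l hl =>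
    (hφ l hl).differentiableAt ((isOpen_chamber _).mem_nhds hl)
  have hχ0 : ∀ n l, 0 ≤ χ n l := fun n l => cut_nonneg _
  have hχ1 : ∀ n l, χ n l ≤ 1 := fun n l => cut_le_one _
  -- pointwise bound of the divergence of the truncated field
  have hdiv : ∀ n, ∀ u ∈ regular m p, haffDiv m p (fun l => χ n l • φ l) (eigval u) ≤
      χ n (eigval u) * k (eigval u) + rem n u := by
    intro n u hu
    rw [haffDiv_smul (hχd n _ hu) (hφd _ hu)]
    refine add_le_add (mul_le_mul_of_nonneg_left (hk _ hu) (hχ0 n _)) ?_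
    have hγ0 := gapSum_nonneg hu
    -- On the transition band one factor of `δ · gapSum` is bounded by two, which leaves a bound
    -- linear in `gapSum`.
    have hder : ∀ i, |fderiv ℝ (χ n) (eigval u) (Pi.single i 1)| ≤
        if 1 ≤ δ n * gapSum (eigval u) ∧ δ n * gapSum (eigval u) ≤ 2 then
          2 * C * gapSum (eigval u) else 0 := by
      intro i
      refine (hC _ gapSum (δ n) (eigval u) (Pi.single i 1) (hδ0 n) (hasFDerivAt_gapSum hu).1).trans ?_
      split_ifs with h
      · have h1 := (hasFDerivAt_gapSum hu).2 i
        calc C * δ n * |fderiv ℝ gapSum (eigval u) (Pi.single i 1)|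
            ≤ C * δ n * gapSum (eigval u) ^ 2 := by
              have := (hδ0 n).le
              gcongr
          _ = C * (δ n * gapSum (eigval u)) * gapSum (eigval u) := by ring
          _ ≤ C * 2 * gapSum (eigval u) := by gcongr; exact h.2
          _ = _ := by ring
      · exact le_rfl
    have hterm : ∀ i ∈ (univ : Finset (Fin (min p m))),
        2 * eigval u i * φ (eigval u) i * fderiv ℝ (χ n) (eigval u) (Pi.single i 1) ≤
        2 * eigval u i * |φ (eigval u) i| *
          if 1 ≤ δ n * gapSum (eigval u) ∧ δ n * gapSum (eigval u) ≤ 2 then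
          2 * C * gapSum (eigval u) else 0 := by
      intro i _
      refine (le_abs_self _).trans ?_
      rw [abs_mul, abs_mul, abs_mul, abs_two, abs_of_nonneg (eigval_nonneg u i)]
      have := eigval_nonneg u i
      exact mul_le_mul_of_nonneg_left (hder i) (by positivity)
    refine (Finset.sum_le_sum hterm).trans (le_of_eq ?_)
    rw [← Finset.sum_mul]
    simp only [rem]
    split_ifs
    · ring
    · simp
  have hwn : ∀ n u, haffWeight Sig (fun l => χ n l • φ l) u =
      χ n (eigval u) * haffWeight Sig φ u := by
    intro n u
    simp only [haffWeight, Finset.mul_sum, Pi.smul_apply, smul_eq_mul, mul_assoc]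
  -- the dominating function
  set A : Set (Fin m → Fin p → ℝ) := {u | u ∈ regular m p ∧ ‖u‖ ≤ R ∧ ∀ i, ε ≤ eigval u i}
  have hAm : MeasurableSet A := by
    have : A = regular m p ∩ ({u | ‖u‖ ≤ R} ∩ ⋂ i, {u | ε ≤ eigval u i}) := by
      ext u
      simp only [A, Set.mem_inter_iff, Set.mem_iInter]
      rfl
    rw [this]
    exact isOpen_regular.measurableSet.inter
      ((isClosed_le continuous_norm continuous_const).measurableSet.inter
      (MeasurableSet.iInter fun i => measurableSet_le measurable_const (measurable_eigval_apply i)))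
  set C1 : ℝ := ∑ _i : Fin (min p m), 2 * R' * Cφ with hC1
  set C2 : ℝ := ∑ _i : Fin (min p m), Cφ * (R' * Cs) with hC2
  have hC10 : 0 ≤ C1 := by positivity
  have hC20 : 0 ≤ C2 := by positivity
  let bd : (Fin m → Fin p → ℝ) → ℝ := fun u =>
    M * D.indicator (fun u => |k (eigval u)|) u +
      M * (2 * C * C1) * A.indicator (fun u => gapSum (eigval u)) u +
      D.indicator (fun _ => 2 * M * C2) u
  have hbdi : Integrable bd := by
    refine ((((integrable_indicator_iff hDo.measurableSet).mpr hki.abs).const_mul M).add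
      (((integrable_indicator_iff hAm).mpr (integrableOn_gapSum R hε)).const_mul _)).add
      ((integrable_indicator_iff hDo.measurableSet).mpr (integrableOn_const hDfin))
  have hsumφ : ∀ u ∈ D, u ∈ regular m p → ∑ i, 2 * eigval u i * |φ (eigval u) i| ≤ C1 := by
    intro u hu hr
    refine Finset.sum_le_sum fun i _ => ?_
    have h1 := hlR u hu i
    have h2 := hCφ u hu hr i
    have h3 := eigval_nonneg u i
    gcongr
  have hw : ∀ u ∈ D, u ∈ regular m p → |haffWeight Sig φ u| ≤ C2 := by
    intro u hu hr
    refine (Finset.abs_sum_le_sum_abs _ _).trans (Finset.sum_le_sum fun i _ => ?_)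
    rw [abs_mul, abs_mul, abs_of_nonneg (eigval_nonneg u i)]
    have h1 := hlR u hu i
    have h2 := hCφ u hu hr i
    have h3 := eigval_nonneg u i
    have h4 := hCs u i
    gcongr
  have hbound : ∀ n, ∀ u ∈ regular m p, |kn n u| ≤ bd u := by
    intro n u hr
    by_cases hu : u ∈ D
    · have hγ0 := gapSum_nonneg hr
      have hrem : |rem n u| ≤ 2 * C * C1 * A.indicator (fun u => gapSum (eigval u)) u := by
        by_cases hφ0 : φ (eigval u) = 0
        · have : rem n u = 0 := by simp [rem, hφ0]
          rw [this, abs_zero]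
          exact mul_nonneg (by positivity) (Set.indicator_nonneg (fun v hv => gapSum_nonneg hv.1) _)
        · have hA : u ∈ A := ⟨hr, hDR u hu, fun i => not_lt.mp fun h => hφ0 (hvan _ hr ⟨i, h⟩)⟩
          rw [Set.indicator_of_mem hA]
          simp only [rem]
          split_ifs
          · have h1 : 0 ≤ ∑ i, 2 * eigval u i * |φ (eigval u) i| :=
              Finset.sum_nonneg fun i _ => by have := eigval_nonneg u i; positivity
            rw [abs_of_nonneg (by positivity)]
            calc _ ≤ 2 * C * gapSum (eigval u) * C1 := by
                  have := hsumφ u hu hr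
                  gcongr
              _ = _ := by ring
          · rw [abs_zero]; positivity
      simp only [kn, bd]
      rw [Set.indicator_of_mem hu, Set.indicator_of_mem hu]
      have h1 : |χ n (eigval u) * k (eigval u)| ≤ |k (eigval u)| := by
        rw [abs_mul, abs_of_nonneg (hχ0 n _)]
        exact mul_le_of_le_one_left (abs_nonneg _) (hχ1 n _)
      have h2 : |χ n (eigval u) * haffWeight Sig φ u| ≤ C2 := by
        rw [abs_mul, abs_of_nonneg (hχ0 n _)]
        exact (mul_le_of_le_one_left (abs_nonneg _) (hχ1 n _)).trans (hw u hu hr)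
      obtain ⟨hM1, hM2⟩ := hM u
      refine (abs_add_le _ _).trans (add_le_add ?_ ?_)
      · rw [abs_mul]
        calc _ ≤ M * (|k (eigval u)| + 2 * C * C1 * A.indicator (fun u => gapSum (eigval u)) u) :=
              mul_le_mul hM1 ((abs_add_le _ _).trans (add_le_add h1 hrem)) (abs_nonneg _) hM0
          _ = _ := by ring
      · rw [abs_mul, abs_mul, abs_two]
        gcongr
    · obtain ⟨h1, h2⟩ := hoff u hu
      have : kn n u = 0 := by simp [kn, h1, h2]
      rw [this, abs_zero]
      simp only [bd]
      rw [Set.indicator_of_notMem hu, Set.indicator_of_notMem hu, mul_zero, zero_add, add_zero]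
      exact mul_nonneg (by positivity) (Set.indicator_nonneg (fun v hv => gapSum_nonneg hv.1) _)
  have hkm : ∀ n, AEStronglyMeasurable (kn n) volume := by
    intro n
    have hηm : Measurable fun u : Fin m → Fin p → ℝ => η (c + rowForm Sig u) :=
      (hηc.comp (continuous_const.add continuous_rowForm)).measurable
    have hη'm : Measurable fun u : Fin m → Fin p → ℝ => η' (c + rowForm Sig u) :=
      (hη'.comp (continuous_const.add continuous_rowForm)).measurable
    have hχm : Measurable fun u : Fin m → Fin p → ℝ => χ n (eigval u) :=
      continuous_cut.measurable.comp (measurable_gapSum.const_mul _)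
    have hkD : AEMeasurable (D.indicator fun u => k (eigval u)) volume :=
      ((integrable_indicator_iff hDo.measurableSet).mpr hki).aemeasurable
    have hwm : AEMeasurable (fun u : Fin m → Fin p → ℝ => haffWeight Sig φ u) volume :=
      (aestronglyMeasurable_of_continuousOn_regular
        (continuousOn_haffWeight hφ.continuousOn)).aemeasurable
    have hφm : ∀ i, AEMeasurable (fun u : Fin m → Fin p → ℝ => φ (eigval u) i) volume := fun i =>
      (aestronglyMeasurable_of_continuousOn_regular (continuousOn_comp_eigval
        (continuousOn_pi.mp hφ.continuousOn i))).aemeasurable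
    have hrm : AEMeasurable (rem n) volume := by
      have hset : MeasurableSet {u : Fin m → Fin p → ℝ | 1 ≤ δ n * gapSum (eigval u) ∧
          δ n * gapSum (eigval u) ≤ 2} :=
        (measurableSet_le measurable_const (measurable_gapSum.const_mul _)).inter
          (measurableSet_le (measurable_gapSum.const_mul _) measurable_const)
      have := AEMeasurable.indicator (μ := volume) (((measurable_gapSum (m := m) (p := p)).const_mul
        (2 * C)).aemeasurable.mul (Finset.aemeasurable_fun_sum univ fun i _ =>
          ((measurable_eigval_apply i).const_mul 2).aemeasurable.mul (hφm i).abs)) hset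
      refine this.congr (Eventually.of_forall fun u => ?_)
      simp only [rem, Set.indicator, Set.mem_ofPred_eq]
      split_ifs <;> rfl
    -- Measurability of `k ∘ eigval` is known only on `D`; the weight vanishes elsewhere, so `k` may
    -- be replaced by its indicator version.
    have e : kn n = fun u => η (c + rowForm Sig u) * (χ n (eigval u) *
        D.indicator (fun u => k (eigval u)) u + rem n u) +
        2 * η' (c + rowForm Sig u) * (χ n (eigval u) * haffWeight Sig φ u) := by
      funext u
      simp only [kn]
      by_cases hu : u ∈ D
      · rw [Set.indicator_of_mem hu]
      · rw [(hoff u hu).1, (hoff u hu).2]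
        simp
    rw [e]
    exact ((hηm.aemeasurable.mul ((hχm.aemeasurable.mul hkD).add hrm)).add
      ((hη'm.const_mul 2).aemeasurable.mul (hχm.aemeasurable.mul hwm))).aestronglyMeasurable
  have hkni : ∀ n, Integrable (kn n) := fun n => hbdi.mono' (hkm n) (by
    filter_upwards [ae_mem_regular m p] with u hu
    exact hbound n u hu)
  have hnn : ∀ n, 0 ≤ ∫ u, kn n u := by
    intro n
    refine integral_nonneg_of_haffDiv_le (φ := fun l => χ n l • φ l) hSig
      (fun l hl => ((hχd n l hl).smul (hφd l hl)).differentiableWithinAt) ?_ hη hT c (hkni n) ?_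
    · intro u hu
      -- The level `2 (n + 1)` is where `cut (δ n * ·)` becomes zero.
      filter_upwards [eventually_gapSum_gt (K := 2 * ((n : ℝ) + 1)) hε hu] with w hw hr
      rcases hw hr with h | h
      · rw [hvan _ hr h, smul_zero]
      · have : χ n (eigval w) = 0 := by
          apply cut_eq_zero
          simp only [δ]
          rw [one_div, le_inv_mul_iff₀ (by positivity)]
          linarith
        rw [this, zero_smul]
    · intro u hu
      simp only [kn]
      rw [hwn]
      exact add_le_add_left (mul_le_mul_of_nonneg_left (hdiv n u hu) (hη0 _)) _
  have hlim : Tendsto (fun n => ∫ u, kn n u) atTop (𝓝 (∫ u : Fin m → Fin p → ℝ,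
      (η (c + rowForm Sig u) * k (eigval u) +
      2 * η' (c + rowForm Sig u) * haffWeight Sig φ u))) := by
    refine tendsto_integral_of_dominated_convergence bd hkm hbdi (fun n => ?_) ?_
    · filter_upwards [ae_mem_regular m p] with u hu
      exact hbound n u hu
    · filter_upwards with u
      refine tendsto_const_nhds.congr' ?_
      obtain ⟨N, hN⟩ := exists_nat_ge (gapSum (eigval u))
      filter_upwards [tendsto_cut_div (gapSum (eigval u)), eventually_ge_atTop N] with n hn hnN
      have h1 : χ n (eigval u) = 1 := hn
      -- The transition band `1 ≤ δ n * gapSum` is left as soon as `n + 1` exceeds `gapSum`, so the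
      -- error tends to zero pointwise.
      have h2 : rem n u = 0 := by
        simp only [rem]
        rw [if_neg]
        rw [not_and_or]
        left
        have : (N : ℝ) ≤ n := by exact_mod_cast hnN
        simp only [δ]
        rw [not_le, one_div, inv_mul_lt_iff₀ (by positivity)]
        linarith
      simp only [kn, h1, h2]
      ring
  exact ge_of_tendsto' hlim hnn

end

/-! ### Integration over `(z, u)`: continuous, then bounded measurable, generating functions. -/

section

variable {q m p : ℕ} {Sig : Matrix (Fin p) (Fin p) ℝ}

theorem quadForm_eq (θ : Matrix (Fin q) (Fin p) ℝ) (Sig : Matrix (Fin p) (Fin p) ℝ)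
    (ω : Sample q m p) :
    quadForm θ Sig ω = rowForm Sig (fun i a => ω.1 i a - θ i a) + rowForm Sig ω.2 := rfl

theorem continuous_quadForm (θ : Matrix (Fin q) (Fin p) ℝ) (Sig : Matrix (Fin p) (Fin p) ℝ) :
    Continuous fun ω : Sample q m p => quadForm θ Sig ω := by
  simp only [quadForm_eq]
  refine (continuous_rowForm.comp ?_).add (continuous_rowForm.comp continuous_snd)
  fun_prop

theorem quadForm_nonneg (hSig : Sig.PosDef) (θ : Matrix (Fin q) (Fin p) ℝ) (ω : Sample q m p) :
    0 ≤ quadForm θ Sig ω :=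
  add_nonneg (rowForm_nonneg hSig _) (rowForm_nonneg hSig _)

theorem exists_norm_le_of_quadForm_le (hSig : Sig.PosDef) (θ : Matrix (Fin q) (Fin p) ℝ) (T : ℝ) :
    ∃ R : ℝ, 0 ≤ R ∧ ∀ ω : Sample q m p, quadForm θ Sig ω ≤ T → ‖ω‖ ≤ R := by
  obtain ⟨R1, hR1, h1⟩ := exists_norm_le_of_rowForm_le (n := q) hSig T
  obtain ⟨R2, hR2, h2⟩ := exists_norm_le_of_rowForm_le (n := m) hSig T
  let θ' : Fin q → Fin p → ℝ := θ
  refine ⟨R1 + ‖θ'‖ + R2, by positivity, fun ω hω => ?_⟩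
  rw [quadForm_eq] at hω
  have e1 := h1 (fun i a => ω.1 i a - θ i a) (by linarith [rowForm_nonneg hSig ω.2])
  have e2 := h2 ω.2 (by linarith [rowForm_nonneg hSig (fun i a => ω.1 i a - θ i a)])
  have e3 : ‖ω.1‖ ≤ R1 + ‖θ'‖ := by
    calc ‖ω.1‖ = ‖(fun i a => ω.1 i a - θ i a) + θ'‖ := by
          congr 1
          funext i a
          exact (sub_add_cancel (ω.1 i a) (θ i a)).symm
      _ ≤ _ := (norm_add_le _ _).trans (by gcongr)
  rw [Prod.norm_def]
  exact max_le (by linarith) (by linarith [norm_nonneg θ'])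

theorem volume_quadForm_lt_ne_top (hSig : Sig.PosDef) (θ : Matrix (Fin q) (Fin p) ℝ) (T : ℝ) :
    volume {ω : Sample q m p | quadForm θ Sig ω < T} ≠ ∞ := by
  obtain ⟨R, -, hR⟩ := exists_norm_le_of_quadForm_le (q := q) (m := m) hSig θ T
  refine ne_top_of_le_ne_top (isCompact_closedBall (0 : Sample q m p) R).measure_lt_top.ne
    (measure_mono fun ω hω => ?_)
  have : quadForm θ Sig ω < T := hω
  exact mem_closedBall_zero_iff.mpr (hR ω this.le)

theorem ae_snd_mem_regular (q m p : ℕ) : ∀ᵐ ω : Sample q m p, ω.2 ∈ regular m p :=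
  Measure.quasiMeasurePreserving_snd.ae (ae_mem_regular m p)

theorem exists_abs_haffWeight_le {φ : (Fin (min p m) → ℝ) → Fin (min p m) → ℝ}
    (hbdd : ∀ R : ℝ, ∃ C : ℝ, ∀ l ∈ chamber (min p m), (∀ i, l i ≤ R) → ∀ i, |φ l i| ≤ C) (R : ℝ) :
    ∃ C : ℝ, 0 ≤ C ∧ ∀ u ∈ regular m p, ‖u‖ ≤ R → |haffWeight Sig φ u| ≤ C := by
  obtain ⟨C1, hC1⟩ := hbdd (p * (m * R ^ 2))
  obtain ⟨C2, hC20, hC2⟩ := exists_abs_trace_mul_eigProj_le m Sig⁻¹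
  refine ⟨∑ _i : Fin (min p m), max C1 0 * (p * (m * R ^ 2) * C2), ?_, fun u hu hR => ?_⟩
  · have : 0 ≤ max C1 0 := le_max_right _ _
    positivity
  refine (Finset.abs_sum_le_sum_abs _ _).trans (Finset.sum_le_sum fun i _ => ?_)
  rw [abs_mul, abs_mul, abs_of_nonneg (eigval_nonneg u i)]
  have h1 := eigval_le_of_norm_le hR i
  have h2 := (hC1 _ hu (fun i => eigval_le_of_norm_le hR i) i).trans (le_max_left C1 0)
  have h3 := eigval_nonneg u i
  have h4 := hC2 u i
  have h5 : 0 ≤ max C1 0 := le_max_right _ _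
  gcongr

theorem aestronglyMeasurable_haffWeight_snd {φ : (Fin (min p m) → ℝ) → Fin (min p m) → ℝ}
    (hφ : ContinuousOn φ (chamber (min p m))) :
    AEStronglyMeasurable (fun ω : Sample q m p => haffWeight Sig φ ω.2) volume :=
  (aestronglyMeasurable_of_continuousOn_regular (continuousOn_haffWeight hφ)).comp_snd

theorem integral_Ioi_eq_intervalIntegral {g : ℝ → ℝ} {T : ℝ} (hgT : ∀ t, T ≤ t → g t = 0)
    (t : ℝ) : ∫ s in Set.Ioi t, g s = ∫ s in t..T, g s := by
  rcases le_total t T with h | h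
  · rw [intervalIntegral.integral_of_le h]
    refine setIntegral_eq_of_subset_of_forall_sdiff_eq_zero measurableSet_Ioi
      Set.Ioc_subset_Ioi_self fun s hs => hgT s ?_
    by_contra hsT
    exact hs.2 ⟨hs.1, (not_le.mp hsT).le⟩
  · rw [intervalIntegral.integral_symm, intervalIntegral.integral_of_le h,
      setIntegral_eq_zero_of_forall_eq_zero fun s hs => hgT s (h.trans (Set.mem_Ioi.mp hs).le),
      setIntegral_eq_zero_of_forall_eq_zero fun s hs => hgT s hs.1.le, neg_zero]

theorem hasDerivAt_integral_Ioi {g : ℝ → ℝ} (hg : Continuous g) {T : ℝ}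
    (hgT : ∀ t, T ≤ t → g t = 0) (t : ℝ) :
    HasDerivAt (fun t => ∫ s in Set.Ioi t, g s) (-g t) t := by
  simp only [integral_Ioi_eq_intervalIntegral hgT]
  exact intervalIntegral.integral_hasDerivAt_left (hg.intervalIntegrable _ _)
    hg.stronglyMeasurable.stronglyMeasurableAtFilter hg.continuousAt

theorem measurable_integral_Ioi {g : ℝ → ℝ} (hg : Measurable g) :
    Measurable fun t : ℝ => ∫ s in Set.Ioi t, g s := by
  have e : (fun t : ℝ => ∫ s in Set.Ioi t, g s) = fun t => ∫ s, (if t < s then g s else 0) := by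
    funext t
    rw [← integral_indicator measurableSet_Ioi]
    rfl
  rw [e]
  refine (StronglyMeasurable.integral_prod_right (f := fun (t s : ℝ) =>
    if t < s then g s else 0) ?_).measurable
  exact (Measurable.ite (measurableSet_lt measurable_fst measurable_snd)
    (hg.comp measurable_snd) measurable_const).stronglyMeasurable

/-- The integrated inequality for a continuous generating function. -/
theorem integral_mul_haffWeight_le_of_continuous (hSig : Sig.PosDef)
    {φ : (Fin (min p m) → ℝ) → Fin (min p m) → ℝ}
    (hφ : DifferentiableOn ℝ φ (chamber (min p m))) {ε : ℝ} (hε : 0 < ε)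
    (hvan : ∀ l ∈ chamber (min p m), (∃ i, l i < ε) → φ l = 0)
    (hbdd : ∀ R : ℝ, ∃ C : ℝ, ∀ l ∈ chamber (min p m), (∀ i, l i ≤ R) → ∀ i, |φ l i| ≤ C)
    {k : (Fin (min p m) → ℝ) → ℝ} (hk : ∀ l ∈ chamber (min p m), haffDiv m p φ l ≤ k l)
    (θ : Matrix (Fin q) (Fin p) ℝ) {T : ℝ}
    (hki : IntegrableOn (fun ω : Sample q m p => k (eigval ω.2)) {ω | quadForm θ Sig ω < T})
    {g : ℝ → ℝ} (hg : Continuous g) (hg0 : ∀ t, 0 ≤ g t) (hgT : ∀ t, T ≤ t → g t = 0) :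
    ∫ ω : Sample q m p, g (quadForm θ Sig ω) * haffWeight Sig φ ω.2 ≤
      ∫ ω : Sample q m p, 2⁻¹ * (∫ s in Set.Ioi (quadForm θ Sig ω), g s) * k (eigval ω.2) := by
  set D : Set (Sample q m p) := {ω | quadForm θ Sig ω < T} with hD
  have hDm : MeasurableSet D :=
    (isOpen_lt (continuous_quadForm θ Sig) continuous_const).measurableSet
  -- Half the tail integral, the analogue of `F*`: its derivative is `-g/2`, so the weight term `2
  -- η' haffWeight` becomes `-g haffWeight`.
  set η : ℝ → ℝ := fun t => 2⁻¹ * ∫ s in Set.Ioi t, g s with hηdef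
  have hη : ∀ t, HasDerivAt η (2⁻¹ * -g t) t := fun t =>
    (hasDerivAt_integral_Ioi hg hgT t).const_mul _
  have hηc : Continuous η := continuous_iff_continuousAt.mpr fun t => (hη t).continuousAt
  have hη0 : ∀ t, 0 ≤ η t := fun t =>
    mul_nonneg (by norm_num) (integral_nonneg fun s => hg0 s)
  have hηT : ∀ t, T ≤ t → η t = 0 := fun t ht => by
    simp only [hηdef]
    rw [setIntegral_eq_zero_of_forall_eq_zero fun s hs => hgT s (ht.trans (Set.mem_Ioi.mp hs).le),
      mul_zero]
  obtain ⟨M, hM⟩ : ∃ M : ℝ, ∀ ω : Sample q m p,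
      ‖η (quadForm θ Sig ω)‖ ≤ M ∧ ‖g (quadForm θ Sig ω)‖ ≤ M := by
    obtain ⟨M1, hM1⟩ := (isCompact_Icc (a := 0) (b := T)).exists_bound_of_continuousOn
      hηc.continuousOn
    obtain ⟨M2, hM2⟩ := (isCompact_Icc (a := 0) (b := T)).exists_bound_of_continuousOn
      hg.continuousOn
    refine ⟨max (max M1 M2) 0, fun ω => ?_⟩
    by_cases h : T ≤ quadForm θ Sig ω
    · rw [hηT _ h, hgT _ h, norm_zero]
      exact ⟨le_max_right _ _, le_max_right _ _⟩
    · have hmem : quadForm θ Sig ω ∈ Set.Icc 0 T := ⟨quadForm_nonneg hSig θ ω, (not_le.mp h).le⟩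
      exact ⟨(hM1 _ hmem).trans ((le_max_left _ _).trans (le_max_left _ _)),
        (hM2 _ hmem).trans ((le_max_right _ _).trans (le_max_left _ _))⟩
  have hQm : Measurable fun ω : Sample q m p => quadForm θ Sig ω :=
    (continuous_quadForm θ Sig).measurable
  have hkD := (integrable_indicator_iff hDm).mpr hki
  have hint1 : Integrable fun ω : Sample q m p => η (quadForm θ Sig ω) * k (eigval ω.2) := by
    have := hkD.bdd_mul (c := M) (hηc.measurable.comp hQm).aestronglyMeasurable
      (Eventually.of_forall fun ω => (hM ω).1)
    refine this.congr (Eventually.of_forall fun ω => ?_)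
    by_cases hω : ω ∈ D
    · simp only [Function.comp, Set.indicator_of_mem hω]
    · simp only [Function.comp, Set.indicator_of_notMem hω]
      rw [hηT _ (not_lt.mp hω), zero_mul, zero_mul]
  have hint2 : Integrable fun ω : Sample q m p =>
      g (quadForm θ Sig ω) * haffWeight Sig φ ω.2 := by
    obtain ⟨R, hR0, hR⟩ := exists_norm_le_of_quadForm_le (q := q) (m := m) hSig θ T
    obtain ⟨C, hC0, hC⟩ := exists_abs_haffWeight_le (Sig := Sig) (m := m) hbdd R
    have hb : Integrable (D.indicator fun _ => M * C) :=
      (integrable_indicator_iff hDm).mpr (integrableOn_const (volume_quadForm_lt_ne_top hSig θ T))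
    refine hb.mono' (((hg.measurable.comp hQm).aestronglyMeasurable).mul
      (aestronglyMeasurable_haffWeight_snd hφ.continuousOn)) ?_
    filter_upwards [ae_snd_mem_regular q m p] with ω hr
    by_cases hω : ω ∈ D
    · rw [Set.indicator_of_mem hω, norm_mul]
      exact mul_le_mul (hM ω).2 (hC _ hr ((norm_snd_le ω).trans (hR ω (le_of_lt hω))))
        (norm_nonneg _) ((norm_nonneg _).trans (hM ω).2)
    · rw [Set.indicator_of_notMem hω, hgT _ (not_lt.mp hω), zero_mul, norm_zero]
  rw [← sub_nonneg, ← integral_sub hint1 hint2]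
  -- Fubini: for fixed `z`, the inequality in `u` applies with the shift `c = tr (z - θ) Σ⁻¹ (z -
  -- θ)ᵀ`.
  have hfib : ∀ᵐ z : Fin q → Fin p → ℝ, 0 ≤ ∫ u : Fin m → Fin p → ℝ,
      (η (quadForm θ Sig (z, u)) * k (eigval u) -
        g (quadForm θ Sig (z, u)) * haffWeight Sig φ u) := by
    rw [Measure.volume_eq_prod] at hkD
    filter_upwards [hkD.prod_right_ae] with z hz
    have hDz : MeasurableSet {u : Fin m → Fin p → ℝ |
        rowForm Sig (fun i a => z i a - θ i a) + rowForm Sig u < T} :=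
      (isOpen_lt (continuous_const.add continuous_rowForm) continuous_const).measurableSet
    have hz' : IntegrableOn (fun u : Fin m → Fin p → ℝ => k (eigval u))
        {u | rowForm Sig (fun i a => z i a - θ i a) + rowForm Sig u < T} := by
      rw [← integrable_indicator_iff hDz]
      exact hz
    have := integral_nonneg_of_haffDiv_le_of_vanish hSig hφ hε hvan hbdd hη hη0
      (continuous_const.mul hg.neg) hηT (fun t ht => by rw [hgT t ht]; simp)
      (rowForm Sig (fun i a => z i a - θ i a)) hk hz'
    refine this.trans (le_of_eq (integral_congr_ae (Eventually.of_forall fun u => ?_)))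
    simp only [quadForm_eq]
    ring
  rw [Measure.volume_eq_prod, integral_prod]
  · exact integral_nonneg_of_ae hfib
  · rw [← Measure.volume_eq_prod]
    exact hint1.sub hint2

/-- The integrated inequality for a bounded measurable generating function of bounded support. -/
theorem integral_mul_haffWeight_le_of_bounded (hSig : Sig.PosDef)
    {φ : (Fin (min p m) → ℝ) → Fin (min p m) → ℝ}
    (hφ : DifferentiableOn ℝ φ (chamber (min p m))) {ε : ℝ} (hε : 0 < ε)
    (hvan : ∀ l ∈ chamber (min p m), (∃ i, l i < ε) → φ l = 0)
    (hbdd : ∀ R : ℝ, ∃ C : ℝ, ∀ l ∈ chamber (min p m), (∀ i, l i ≤ R) → ∀ i, |φ l i| ≤ C)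
    {k : (Fin (min p m) → ℝ) → ℝ} (hk : ∀ l ∈ chamber (min p m), haffDiv m p φ l ≤ k l)
    (θ : Matrix (Fin q) (Fin p) ℝ) {T T' : ℝ} (hTT' : T < T')
    (hki : IntegrableOn (fun ω : Sample q m p => k (eigval ω.2)) {ω | quadForm θ Sig ω < T'})
    {g : ℝ → ℝ} (hg : Measurable g) (hg0 : ∀ t, 0 ≤ g t) {M : ℝ} (hgM : ∀ t, g t ≤ M)
    (hgT : ∀ t, T < t → g t = 0) :
    ∫ ω : Sample q m p, g (quadForm θ Sig ω) * haffWeight Sig φ ω.2 ≤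
      ∫ ω : Sample q m p, 2⁻¹ * (∫ s in Set.Ioi (quadForm θ Sig ω), g s) * k (eigval ω.2) := by
  set D : Set (Sample q m p) := {ω | quadForm θ Sig ω < T'} with hD
  have hDm : MeasurableSet D :=
    (isOpen_lt (continuous_quadForm θ Sig) continuous_const).measurableSet
  have hDfin := volume_quadForm_lt_ne_top (q := q) (m := m) hSig θ T'
  have hQm : Measurable fun ω : Sample q m p => quadForm θ Sig ω :=
    (continuous_quadForm θ Sig).measurable
  obtain ⟨R, hR0, hR⟩ := exists_norm_le_of_quadForm_le (q := q) (m := m) hSig θ T'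
  obtain ⟨C, hC0, hC⟩ := exists_abs_haffWeight_le (Sig := Sig) (m := m) hbdd R
  have hwm : AEStronglyMeasurable (fun ω : Sample q m p => haffWeight Sig φ ω.2) volume :=
    aestronglyMeasurable_haffWeight_snd hφ.continuousOn
  have hwD : ∀ᵐ ω : Sample q m p, ω ∈ D → |haffWeight Sig φ ω.2| ≤ C := by
    filter_upwards [ae_snd_mem_regular q m p] with ω hr hω
    exact hC _ hr ((norm_snd_le ω).trans (hR ω (le_of_lt hω)))
  have : IsFiniteMeasure (volume.restrict D) := ⟨by simpa using hDfin.lt_top⟩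
  -- Lebesgue measure on `[0, T')` controls the tail integral, and the image of Lebesgue measure on
  -- `D` under the quadratic form controls `g` of that form. One approximation in `L¹(ν)` therefore
  -- handles both sides.
  set ν : Measure ℝ := volume.restrict (Set.Ico 0 T') +
    Measure.map (fun ω : Sample q m p => quadForm θ Sig ω) (volume.restrict D) with hν
  have hgν : Integrable g ν := Integrable.of_bound hg.aestronglyMeasurable M
    (Eventually.of_forall fun t => by rw [Real.norm_of_nonneg (hg0 t)]; exact hgM t)
  set K : ℝ := ∫ ω in D, |k (eigval ω.2)| with hK
  have hK0 : 0 ≤ K := integral_nonneg fun _ => abs_nonneg _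
  -- comparison of the two sides for two generating functions
  have hcomp : ∀ g1 : ℝ → ℝ, Measurable g1 → (∀ t, T' ≤ t → g1 t = 0) → Integrable g1 ν →
      Integrable (fun ω : Sample q m p => g1 (quadForm θ Sig ω) * haffWeight Sig φ ω.2) ∧
      |∫ ω : Sample q m p, g1 (quadForm θ Sig ω) * haffWeight Sig φ ω.2| ≤ C * ∫ t, |g1 t| ∂ν ∧
      Integrable (fun ω : Sample q m p =>
        2⁻¹ * (∫ s in Set.Ioi (quadForm θ Sig ω), g1 s) * k (eigval ω.2)) ∧
      |∫ ω : Sample q m p, 2⁻¹ * (∫ s in Set.Ioi (quadForm θ Sig ω), g1 s) * k (eigval ω.2)| ≤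
        K * ∫ t, |g1 t| ∂ν := by
    intro g1 hg1m hg1T hg1i
    have hi1 : Integrable g1 (volume.restrict (Set.Ico 0 T')) := hg1i.left_of_add_measure
    have hi2 := hg1i.right_of_add_measure
    have hi2' : Integrable (fun ω : Sample q m p => g1 (quadForm θ Sig ω)) (volume.restrict D) :=
      (integrable_map_measure hg1m.aestronglyMeasurable hQm.aemeasurable).mp hi2
    have hsplit : ∫ t, |g1 t| ∂ν = (∫ t in Set.Ico 0 T', |g1 t|) +
        ∫ ω in D, |g1 (quadForm θ Sig ω)| := by
      rw [hν, integral_add_measure hi1.abs hi2.abs,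
        integral_map hQm.aemeasurable hg1m.abs.aestronglyMeasurable]
    have hn1 : 0 ≤ ∫ t in Set.Ico 0 T', |g1 t| := integral_nonneg fun _ => abs_nonneg _
    have hn2 : 0 ≤ ∫ ω in D, |g1 (quadForm θ Sig ω)| := integral_nonneg fun _ => abs_nonneg _
    have hi3 : Integrable fun ω : Sample q m p => C * D.indicator
        (fun ω => |g1 (quadForm θ Sig ω)|) ω :=
      ((integrable_indicator_iff hDm).mpr hi2'.abs).const_mul C
    have hb1 : ∀ᵐ ω : Sample q m p, ‖g1 (quadForm θ Sig ω) * haffWeight Sig φ ω.2‖ ≤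
        C * D.indicator (fun ω => |g1 (quadForm θ Sig ω)|) ω := by
      filter_upwards [hwD] with ω hω
      by_cases h : ω ∈ D
      · rw [Set.indicator_of_mem h, norm_mul, mul_comm]
        exact mul_le_mul_of_nonneg_right (hω h) (abs_nonneg _)
      · rw [hg1T _ (not_lt.mp h), zero_mul, norm_zero, Set.indicator_of_notMem h, mul_zero]
    have hηb : ∀ ω : Sample q m p, ω ∈ D →
        |∫ s in Set.Ioi (quadForm θ Sig ω), g1 s| ≤ ∫ t in Set.Ico 0 T', |g1 t| := by
      intro ω hω
      have h0 := quadForm_nonneg hSig θ ω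
      calc |∫ s in Set.Ioi (quadForm θ Sig ω), g1 s|
          = |∫ s in Set.Ioo (quadForm θ Sig ω) T', g1 s| := by
            congr 1
            refine setIntegral_eq_of_subset_of_forall_sdiff_eq_zero measurableSet_Ioi
              Set.Ioo_subset_Ioi_self fun s hs => hg1T s ?_
            by_contra hsT
            exact hs.2 ⟨hs.1, not_le.mp hsT⟩
        _ ≤ ∫ s in Set.Ioo (quadForm θ Sig ω) T', |g1 s| := abs_integral_le_integral_abs
        _ ≤ _ := setIntegral_mono_set hi1.abs (Eventually.of_forall fun _ => abs_nonneg _)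
            (Eventually.of_forall fun s hs => ⟨h0.trans hs.1.le, hs.2⟩)
    have hη0 : ∀ ω : Sample q m p, ω ∉ D → ∫ s in Set.Ioi (quadForm θ Sig ω), g1 s = 0 :=
      fun ω hω => setIntegral_eq_zero_of_forall_eq_zero fun s hs =>
        hg1T s ((not_lt.mp hω).trans (Set.mem_Ioi.mp hs).le)
    have hkD := (integrable_indicator_iff hDm).mpr hki
    have hi4 : Integrable fun ω : Sample q m p => (∫ t in Set.Ico 0 T', |g1 t|) *
        D.indicator (fun ω => |k (eigval ω.2)|) ω :=
      ((integrable_indicator_iff hDm).mpr hki.abs).const_mul _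
    have hb2 : ∀ ω : Sample q m p,
        ‖2⁻¹ * (∫ s in Set.Ioi (quadForm θ Sig ω), g1 s) * k (eigval ω.2)‖ ≤
        (∫ t in Set.Ico 0 T', |g1 t|) * D.indicator (fun ω => |k (eigval ω.2)|) ω := by
      intro ω
      by_cases h : ω ∈ D
      · rw [Set.indicator_of_mem h, norm_mul, norm_mul]
        refine mul_le_mul_of_nonneg_right ?_ (abs_nonneg _)
        have h1 := hηb ω h
        rw [Real.norm_of_nonneg (by norm_num : (0 : ℝ) ≤ 2⁻¹), Real.norm_eq_abs]
        linarith [abs_nonneg (∫ s in Set.Ioi (quadForm θ Sig ω), g1 s)]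
      · rw [hη0 ω h, mul_zero, zero_mul, norm_zero, Set.indicator_of_notMem h, mul_zero]
    have hηm := measurable_integral_Ioi hg1m
    refine ⟨hi3.mono' ((hg1m.comp hQm).aestronglyMeasurable.mul hwm) hb1, ?_, ?_, ?_⟩
    · refine (norm_integral_le_of_norm_le hi3 hb1).trans ?_
      rw [integral_const_mul, integral_indicator hDm, hsplit]
      exact mul_le_mul_of_nonneg_left (by linarith) hC0
    · refine hi4.mono' ?_ (Eventually.of_forall hb2)
      have : (fun ω : Sample q m p => 2⁻¹ * (∫ s in Set.Ioi (quadForm θ Sig ω), g1 s) *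
          k (eigval ω.2)) = fun ω => 2⁻¹ * (∫ s in Set.Ioi (quadForm θ Sig ω), g1 s) *
          D.indicator (fun ω => k (eigval ω.2)) ω := by
        funext ω
        by_cases h : ω ∈ D
        · rw [Set.indicator_of_mem h]
        · rw [hη0 ω h, mul_zero, zero_mul, zero_mul]
      rw [this]
      exact (((hηm.comp hQm).const_mul _).aestronglyMeasurable).mul hkD.1
    · refine (norm_integral_le_of_norm_le hi4 (Eventually.of_forall hb2)).trans ?_
      rw [integral_const_mul, integral_indicator hDm, hsplit, mul_comm]
      exact mul_le_mul_of_nonneg_left (by linarith) hK0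
  refine le_of_forall_pos_le_add fun e he => ?_
  set e' := e / (C + K + 1) with he'
  have he'0 : 0 < e' := by positivity
  obtain ⟨g', -, hg'1, hg'c, hg'i⟩ := hgν.exists_hasCompactSupport_integral_sub_le he'0
  -- a continuous cutoff at `T'`
  let cc : ℝ → ℝ := fun t => max 0 (min 1 ((T' - t) / (T' - T)))
  have hccc : Continuous cc := by fun_prop
  have hcc0 : ∀ t, 0 ≤ cc t := fun t => le_max_left _ _
  have hcc1 : ∀ t, cc t ≤ 1 := fun t => max_le zero_le_one (min_le_left _ _)
  have hTT0 : 0 < T' - T := by linarith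
  have hccT : ∀ t, t ≤ T → cc t = 1 := fun t ht => by
    have : 1 ≤ (T' - t) / (T' - T) := by rw [le_div_iff₀ hTT0]; linarith
    simp only [cc]
    rw [min_eq_left this, max_eq_right zero_le_one]
  have hccT' : ∀ t, T' ≤ t → cc t = 0 := fun t ht => by
    have : (T' - t) / (T' - T) ≤ 0 := div_nonpos_of_nonpos_of_nonneg (by linarith) hTT0.le
    simp only [cc]
    rw [max_eq_left ((min_le_right _ _).trans this)]
  -- The approximant must be continuous, nonnegative and zero beyond `T'`. The positive part and the
  -- cutoff, which equals one up to `T` where `g` lives, do not increase the distance to `g`.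
  let h : ℝ → ℝ := fun t => max (g' t) 0 * cc t
  have hhc : Continuous h := (hg'c.max continuous_const).mul hccc
  have hh0 : ∀ t, 0 ≤ h t := fun t => mul_nonneg (le_max_right _ _) (hcc0 t)
  have hhT : ∀ t, T' ≤ t → h t = 0 := fun t ht => by simp only [h, hccT' t ht, mul_zero]
  have hgh : ∀ t, |g t - h t| ≤ ‖g t - g' t‖ := by
    intro t
    rcases le_or_gt t T with ht | ht
    · simp only [h, hccT t ht, mul_one]
      have := abs_max_sub_max_le_abs (g t) (g' t) 0
      rwa [max_eq_left (hg0 t)] at this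
    · rw [hgT t ht, zero_sub, zero_sub, abs_neg, norm_neg, abs_of_nonneg (hh0 t)]
      calc h t ≤ max (g' t) 0 * 1 := by
            have : 0 ≤ max (g' t) 0 := le_max_right _ _
            simp only [h]
            gcongr
            exact hcc1 t
        _ ≤ ‖g' t‖ := by rw [mul_one]; exact max_le (le_abs_self _) (abs_nonneg _)
  have hdi : Integrable (fun t => g t - h t) ν :=
    (hgν.sub hg'i).mono (hg.sub hhc.measurable).aestronglyMeasurable
      (Eventually.of_forall hgh)
  have hde : ∫ t, |g t - h t| ∂ν ≤ e' :=
    (integral_mono hdi.abs (hgν.sub hg'i).norm hgh).trans hg'1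
  have hhi : Integrable h ν := by
    refine (hgν.sub hdi).congr (Eventually.of_forall fun t => ?_)
    simp only [Pi.sub_apply, sub_sub_cancel]
  have hTle : ∀ t, T' ≤ t → g t = 0 := fun t ht => hgT t (hTT'.trans_le ht)
  obtain ⟨a1, -, a3, -⟩ := hcomp g hg hTle hgν
  obtain ⟨b1, -, b3, -⟩ := hcomp h hhc.measurable hhT hhi
  obtain ⟨-, d2, -, d4⟩ := hcomp (fun t => g t - h t) (hg.sub hhc.measurable)
    (fun t ht => by rw [hTle t ht, hhT t ht, sub_zero]) hdi
  have hmain := integral_mul_haffWeight_le_of_continuous hSig hφ hε hvan hbdd hk θ hki hhc hh0 hhT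
  have e1 : ∫ ω : Sample q m p, (g (quadForm θ Sig ω) - h (quadForm θ Sig ω)) *
      haffWeight Sig φ ω.2 = (∫ ω : Sample q m p, g (quadForm θ Sig ω) * haffWeight Sig φ ω.2) -
      ∫ ω : Sample q m p, h (quadForm θ Sig ω) * haffWeight Sig φ ω.2 := by
    rw [← integral_sub a1 b1]
    simp only [sub_mul]
  have e2 : ∫ ω : Sample q m p, 2⁻¹ * (∫ s in Set.Ioi (quadForm θ Sig ω), (g s - h s)) *
      k (eigval ω.2) = (∫ ω : Sample q m p, 2⁻¹ * (∫ s in Set.Ioi (quadForm θ Sig ω), g s) *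
        k (eigval ω.2)) -
      ∫ ω : Sample q m p, 2⁻¹ * (∫ s in Set.Ioi (quadForm θ Sig ω), h s) * k (eigval ω.2) := by
    rw [← integral_sub a3 b3]
    refine integral_congr_ae (Eventually.of_forall fun ω => ?_)
    have hI : ∀ g1 : ℝ → ℝ, Integrable g1 ν → (∀ t, T' ≤ t → g1 t = 0) →
        IntegrableOn g1 (Set.Ioi (quadForm θ Sig ω)) := by
      intro g1 hi hz
      have h1 : IntegrableOn g1 (Set.Ico 0 T') := hi.left_of_add_measure
      have h2 : IntegrableOn g1 (Set.Ici T') :=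
        integrableOn_zero.congr_fun (fun t ht => (hz t ht).symm) measurableSet_Ici
      refine (h1.union h2).mono_set fun s hs => ?_
      have := (quadForm_nonneg hSig θ ω).trans (Set.mem_Ioi.mp hs).le
      rcases lt_or_ge s T' with h | h
      · exact Or.inl ⟨this, h⟩
      · exact Or.inr h
    change _ * (∫ s in _, (g s - h s)) * _ = _ * (∫ s in _, g s) * _ - _ * (∫ s in _, h s) * _
    rw [integral_sub (hI g hgν hTle) (hI h hhi hhT)]
    ring
  rw [e1] at d2
  rw [e2] at d4
  have f1 := (abs_le.mp d2).2
  have f2 := (abs_le.mp d4).1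
  have f3 : (C + K + 1) * e' = e := by
    rw [he']
    field_simp
  nlinarith [mul_le_mul_of_nonneg_left hde hC0, mul_le_mul_of_nonneg_left hde hK0]

end

/-! ### Tails are dominated after integrating out `z`. -/

section

variable {q m p : ℕ} {Sig : Matrix (Fin p) (Fin p) ℝ}

open scoped Pointwise in
/-- The sublevel sets of a quadratic form in `n p` variables have volume proportional to
`s ^ (n p / 2)`. -/
theorem volume_rowForm_le (n : ℕ) (hSig : Sig.PosDef) {s : ℝ} (hs : 0 ≤ s) :
    volume {x : Fin n → Fin p → ℝ | rowForm Sig x ≤ s} =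
      ENNReal.ofReal (s ^ (((n * p : ℕ) : ℝ) / 2)) *
        volume {x : Fin n → Fin p → ℝ | rowForm Sig x ≤ 1} := by
  have hset : {x : Fin n → Fin p → ℝ | rowForm Sig x ≤ s} =
      Real.sqrt s • {x : Fin n → Fin p → ℝ | rowForm Sig x ≤ 1} := by
    ext x
    rw [Set.mem_smul_set]
    constructor
    · intro hx
      change rowForm Sig x ≤ s at hx
      rcases hs.eq_or_lt with rfl | hs'
      · have hx0 : x = 0 := by
          by_contra h
          exact absurd hx (not_le.mpr (rowForm_pos hSig h))
        refine ⟨0, ?_, by rw [smul_zero, hx0]⟩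
        change rowForm Sig (0 : Fin n → Fin p → ℝ) ≤ 1
        simp [rowForm_eq_sum]
      · have hq : Real.sqrt s ≠ 0 := (Real.sqrt_pos.mpr hs').ne'
        refine ⟨(Real.sqrt s)⁻¹ • x, ?_, by rw [smul_smul, mul_inv_cancel₀ hq, one_smul]⟩
        change rowForm Sig _ ≤ 1
        rw [rowForm_smul, inv_pow, Real.sq_sqrt hs, inv_mul_le_iff₀ hs', mul_one]
        exact hx
    · rintro ⟨y, hy, rfl⟩
      change rowForm Sig y ≤ 1 at hy
      change rowForm Sig _ ≤ s
      rw [rowForm_smul, Real.sq_sqrt hs]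
      exact mul_le_of_le_one_right hs hy
  rw [hset, Measure.addHaar_smul, abs_of_nonneg (by positivity)]
  congr 2
  have hd : Module.finrank ℝ (Fin n → Fin p → ℝ) = n * p := by simp [Module.finrank_pi_fintype]
  rw [hd, Real.sqrt_eq_rpow, ← Real.rpow_natCast, ← Real.rpow_mul hs]
  congr 1
  ring

/-- The density with respect to Lebesgue measure of the image of `volume` under a positive definite
quadratic form, up to the constant `κ`. -/
noncomputable def radialDensity (κ a s : ℝ) : ℝ≥0∞ := ENNReal.ofReal (κ * (a * s ^ (a - 1)))

theorem measurable_radialDensity (κ a : ℝ) : Measurable (radialDensity κ a) := by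
  unfold radialDensity
  fun_prop

theorem lintegral_radialDensity {κ a : ℝ} (hκ : 0 ≤ κ) (ha : 0 < a) {x y : ℝ} (hx : 0 ≤ x)
    (hxy : x ≤ y) :
    ∫⁻ s in Set.Ioc x y, radialDensity κ a s = ENNReal.ofReal (κ * y ^ a - κ * x ^ a) := by
  have hint : IntervalIntegrable (fun s : ℝ => s ^ (a - 1)) volume x y :=
    intervalIntegral.intervalIntegrable_rpow' (by linarith)
  have hint' : Integrable (fun s : ℝ => κ * (a * s ^ (a - 1))) (volume.restrict (Set.Ioc x y)) :=
    (((intervalIntegrable_iff_integrableOn_Ioc_of_le hxy).mp hint).const_mul a).const_mul κ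
  unfold radialDensity
  rw [← ofReal_integral_eq_lintegral_ofReal hint']
  · congr 1
    rw [integral_const_mul, integral_const_mul, ← intervalIntegral.integral_of_le hxy,
      integral_rpow (Or.inl (by linarith)), sub_add_cancel]
    field_simp
  · filter_upwards [ae_restrict_mem measurableSet_Ioc] with s hs
    have : 0 < s := hx.trans_lt hs.1
    have h1 := Real.rpow_nonneg this.le (a - 1)
    change 0 ≤ κ * (a * s ^ (a - 1))
    positivity

/-- The image of `volume` under a positive definite quadratic form. -/
theorem exists_map_rowForm (n : ℕ) (hn : 0 < n * p) (hSig : Sig.PosDef) :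
    ∃ κ : ℝ, 0 ≤ κ ∧ Measure.map (fun x : Fin n → Fin p → ℝ => rowForm Sig x) volume =
      (volume.restrict (Set.Ioi 0)).withDensity (radialDensity κ (((n * p : ℕ) : ℝ) / 2)) := by
  set a : ℝ := ((n * p : ℕ) : ℝ) / 2 with ha
  have ha0 : 0 < a := by
    have : (0 : ℝ) < ((n * p : ℕ) : ℝ) := by exact_mod_cast hn
    positivity
  have hfin : volume {x : Fin n → Fin p → ℝ | rowForm Sig x ≤ 1} ≠ ∞ := by
    obtain ⟨R, -, hR⟩ := exists_norm_le_of_rowForm_le (n := n) hSig 1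
    exact ne_top_of_le_ne_top (isCompact_closedBall (0 : Fin n → Fin p → ℝ) R).measure_lt_top.ne
      (measure_mono fun x hx => mem_closedBall_zero_iff.mpr (hR x hx))
  set κ : ℝ := (volume {x : Fin n → Fin p → ℝ | rowForm Sig x ≤ 1}).toReal with hκ
  have hκ0 : 0 ≤ κ := ENNReal.toReal_nonneg
  have hm : Measurable fun x : Fin n → Fin p → ℝ => rowForm Sig x := continuous_rowForm.measurable
  have hIic : ∀ s : ℝ, Measure.map (fun x : Fin n → Fin p → ℝ => rowForm Sig x) volume (Set.Iic s) =
      ENNReal.ofReal (κ * max s 0 ^ a) := by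
    intro s
    rw [Measure.map_apply hm measurableSet_Iic]
    have hbase : ∀ s : ℝ, 0 ≤ s → volume {x : Fin n → Fin p → ℝ | rowForm Sig x ≤ s} =
        ENNReal.ofReal (κ * s ^ a) := by
      intro s hs
      rw [volume_rowForm_le n hSig hs, mul_comm κ, ENNReal.ofReal_mul (Real.rpow_nonneg hs _), hκ,
        ENNReal.ofReal_toReal hfin]
    rcases le_total 0 s with h | h
    · rw [max_eq_left h]
      exact hbase s h
    · rw [max_eq_right h, Real.zero_rpow ha0.ne', mul_zero, ENNReal.ofReal_zero]
      refine measure_mono_null (fun x hx => ?_) ((hbase 0 le_rfl).trans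
        (by rw [Real.zero_rpow ha0.ne', mul_zero, ENNReal.ofReal_zero]))
      exact le_trans hx h
  refine ⟨κ, hκ0, Measure.ext_of_Ioc' _ _ (fun x y _ => ?_) fun x y hxy => ?_⟩
  · exact ne_top_of_le_ne_top (by rw [hIic]; exact ENNReal.ofReal_ne_top)
      (measure_mono (Set.Ioc_subset_Iic_self (a := x)))
  · have hmono : max x 0 ≤ max y 0 := max_le_max_right 0 hxy.le
    rw [withDensity_apply _ measurableSet_Ioc, Measure.restrict_restrict measurableSet_Ioc]
    have hset : Set.Ioc x y ∩ Set.Ioi 0 = Set.Ioc (max x 0) (max y 0) := by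
      ext s
      simp only [Set.mem_inter_iff, Set.mem_Ioc, Set.mem_Ioi, max_lt_iff, le_max_iff]
      constructor
      · rintro ⟨⟨h1, h2⟩, h3⟩
        exact ⟨⟨h1, h3⟩, Or.inl h2⟩
      · rintro ⟨⟨h1, h2⟩, h3⟩
        exact ⟨⟨h1, h3.resolve_right (not_le.mpr h2)⟩, h2⟩
    rw [hset, lintegral_radialDensity hκ0 ha0 (le_max_right _ _) hmono, ← Set.Iic_sdiff_Iic,
      measure_sdiff (Set.Iic_subset_Iic.mpr hxy.le) measurableSet_Iic.nullMeasurableSet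
        (by rw [hIic]; exact ENNReal.ofReal_ne_top), hIic, hIic,
      ENNReal.ofReal_sub _ (mul_nonneg hκ0 (Real.rpow_nonneg (le_max_right _ _) _))]

/-- Tail integrals are dominated, on average against a power density. -/
theorem lintegral_tail_le_of_radialDensity {κ a : ℝ} (hκ : 0 ≤ κ) (ha : 0 < a) {F : ℝ → ℝ≥0∞}
    (hF : Measurable F) {T : ℝ} (hT : ∀ v, T < v → F v = 0) {t : ℝ} (ht : 0 ≤ t) :
    ∫⁻ s, (∫⁻ v in Set.Ioi (s + t), F v)
        ∂((volume.restrict (Set.Ioi 0)).withDensity (radialDensity κ a)) ≤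
      ENNReal.ofReal (T / a) *
        ∫⁻ s, F (s + t) ∂((volume.restrict (Set.Ioi 0)).withDensity (radialDensity κ a)) := by
  set d := radialDensity κ a with hd
  have hdm : Measurable d := measurable_radialDensity κ a
  have hG : Measurable fun x : ℝ × ℝ => if x.1 + t < x.2 then F x.2 else 0 :=
    Measurable.ite (measurableSet_lt (by fun_prop) measurable_snd) (hF.comp measurable_snd)
      measurable_const
  have e1 : ∀ s, ∫⁻ v in Set.Ioi (s + t), F v = ∫⁻ v, if s + t < v then F v else 0 := by
    intro s
    rw [← lintegral_indicator measurableSet_Ioi]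
    rfl
  have hGs : Measurable fun s : ℝ => ∫⁻ v, if s + t < v then F v else 0 :=
    Measurable.lintegral_prod_right (f := fun s v : ℝ => if s + t < v then F v else 0) hG
  simp only [e1]
  have hFt : Measurable fun s => F (s + t) := hF.comp (measurable_id.add_const t)
  rw [lintegral_withDensity_eq_lintegral_mul _ hdm hGs,
    lintegral_withDensity_eq_lintegral_mul _ hdm hFt, ← lintegral_indicator measurableSet_Ioi,
    ← lintegral_indicator measurableSet_Ioi]
  set D : ℝ → ℝ≥0∞ := (Set.Ioi (0 : ℝ)).indicator d with hD
  have hDm : Measurable D := hdm.indicator measurableSet_Ioi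
  have e2 : ∫⁻ s, (Set.Ioi (0 : ℝ)).indicator (d * fun s => F (s + t)) s =
      ∫⁻ v, D (v - t) * F v := by
    rw [← lintegral_sub_right_eq_self _ t]
    refine lintegral_congr fun v => ?_
    simp only [Set.indicator, hD, Pi.mul_apply, sub_add_cancel]
    split_ifs <;> simp
  -- By Tonelli, the averaged tail charges `F v` with the mass that the power density gives to `(0,
  -- v - t)`.
  have e3 : ∫⁻ s, (Set.Ioi (0 : ℝ)).indicator
      (d * fun s => ∫⁻ v, if s + t < v then F v else 0) s =
      ∫⁻ v, (∫⁻ s in Set.Iio (v - t), D s) * F v := by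
    have : ∀ s, (Set.Ioi (0 : ℝ)).indicator (d * fun s => ∫⁻ v, if s + t < v then F v else 0) s =
        ∫⁻ v, D s * (if s + t < v then F v else 0) := by
      intro s
      have hGsv : Measurable fun v : ℝ => if s + t < v then F v else 0 :=
        hG.comp (measurable_prodMk_left (x := s))
      rw [lintegral_const_mul _ hGsv]
      simp only [Set.indicator, hD, Pi.mul_apply]
      split_ifs <;> simp
    simp only [this]
    rw [lintegral_lintegral_swap ((hDm.comp measurable_fst).mul hG).aemeasurable]
    refine lintegral_congr fun v => ?_
    rw [← lintegral_indicator measurableSet_Iio, ← lintegral_mul_const _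
      (hDm.indicator measurableSet_Iio)]
    refine lintegral_congr fun s => ?_
    by_cases h : s + t < v
    · rw [if_pos h, Set.indicator_of_mem (show s ∈ Set.Iio (v - t) from lt_sub_iff_add_lt.mpr h)]
    · have hs : s ∉ Set.Iio (v - t) := fun hs => h (lt_sub_iff_add_lt.mp hs)
      rw [if_neg h, Set.indicator_of_notMem hs, zero_mul, mul_zero]
  have hDF : Measurable fun v => D (v - t) * F v := (hDm.comp (measurable_id.sub_const t)).mul hF
  rw [e2, e3, ← lintegral_const_mul _ hDF]
  refine lintegral_mono fun v => ?_
  rcases lt_or_ge T v with hv | hv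
  · rw [hT v hv, mul_zero, mul_zero, mul_zero]
  rw [← mul_assoc]
  refine mul_le_mul_left ?_ _
  have e4 : ∫⁻ s in Set.Iio (v - t), D s = ∫⁻ s in Set.Iio (v - t) ∩ Set.Ioi 0, d s := by
    rw [hD, lintegral_indicator measurableSet_Ioi, Measure.restrict_restrict measurableSet_Ioi,
      Set.inter_comm]
  rw [e4]
  rcases le_or_gt (v - t) 0 with h | h
  · have : Set.Iio (v - t) ∩ Set.Ioi 0 = ∅ := by
      ext s
      simp only [Set.mem_inter_iff, Set.mem_Iio, Set.mem_Ioi, Set.mem_empty_iff_false, iff_false,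
        not_and, not_lt]
      intro hs
      linarith
    rw [this]
    simp
  · have hx : 0 ≤ v - t := h.le
    -- With `x = v - t ≤ T`, the mass of `(0, x]` is `κ x ^ a`, which is `x / a` times the density
    -- at `x`; this is the origin of the constant `T / a`.
    calc ∫⁻ s in Set.Iio (v - t) ∩ Set.Ioi 0, d s ≤ ∫⁻ s in Set.Ioc 0 (v - t), d s :=
          lintegral_mono_set fun s hs => ⟨hs.2, le_of_lt hs.1⟩
      _ = ENNReal.ofReal (κ * (v - t) ^ a) := by
          rw [hd, lintegral_radialDensity hκ ha le_rfl hx, Real.zero_rpow ha.ne', mul_zero, sub_zero]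
      _ ≤ ENNReal.ofReal (T / a) * D (v - t) := by
          rw [hD, Set.indicator_of_mem (show v - t ∈ Set.Ioi (0 : ℝ) from h), hd, radialDensity,
            ← ENNReal.ofReal_mul (by have : 0 ≤ T := by linarith
                                     positivity)]
          refine ENNReal.ofReal_le_ofReal ?_
          have h1 : (v - t) ^ a = (v - t) ^ (a - 1) * (v - t) := by
            rw [Real.rpow_sub_one h.ne']
            field_simp
          have h2 := Real.rpow_nonneg hx (a - 1)
          calc κ * (v - t) ^ a = κ * ((v - t) ^ (a - 1)) * (v - t) := by rw [h1]; ring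
            _ ≤ κ * ((v - t) ^ (a - 1)) * T := by
                refine mul_le_mul_of_nonneg_left (by linarith) (by positivity)
            _ = _ := by field_simp

/-- Translation by `θ` removes the location, leaving a positive definite form in `q p ≥ 1` variables
shifted by a constant depending on `u`. This is where a nonempty block `Z` matters: the law of the
form is absolutely continuous on every fibre. -/
theorem exists_map_quadForm_fiber (hqp : 0 < q * p) (hSig : Sig.PosDef)
    (θ : Matrix (Fin q) (Fin p) ℝ) :
    ∃ κ : ℝ, 0 ≤ κ ∧ ∀ (F : ℝ → ℝ≥0∞), Measurable F → ∀ u : Fin m → Fin p → ℝ,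
      ∫⁻ z : Fin q → Fin p → ℝ, F (quadForm θ Sig (z, u)) = ∫⁻ s, F (s + rowForm Sig u)
        ∂((volume.restrict (Set.Ioi 0)).withDensity
          (radialDensity κ (((q * p : ℕ) : ℝ) / 2))) := by
  obtain ⟨κ, hκ0, hκ⟩ := exists_map_rowForm q hqp hSig
  refine ⟨κ, hκ0, fun F hF u => ?_⟩
  have hFu : Measurable fun s : ℝ => F (s + rowForm Sig u) := hF.comp (measurable_id.add_const _)
  rw [← hκ, lintegral_map hFu continuous_rowForm.measurable]
  let θ' : Fin q → Fin p → ℝ := θ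
  exact lintegral_sub_right_eq_self
    (fun x : Fin q → Fin p → ℝ => F (rowForm Sig x + rowForm Sig u)) θ'

/-- Tail integrals of a generating function of bounded support are dominated on average. -/
theorem exists_lintegral_tail_quadForm_le (hqp : 0 < q * p) (hSig : Sig.PosDef)
    (θ : Matrix (Fin q) (Fin p) ℝ) {F : ℝ → ℝ≥0∞} (hF : Measurable F) {T : ℝ}
    (hT : ∀ v, T < v → F v = 0) :
    ∃ C : ℝ≥0∞, C ≠ ∞ ∧ ∀ G : (Fin m → Fin p → ℝ) → ℝ≥0∞, AEMeasurable G →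
      ∫⁻ ω : Sample q m p, (∫⁻ v in Set.Ioi (quadForm θ Sig ω), F v) * G ω.2 ≤
        C * ∫⁻ ω : Sample q m p, F (quadForm θ Sig ω) * G ω.2 := by
  obtain ⟨κ, hκ0, hκ⟩ := exists_map_quadForm_fiber (m := m) hqp hSig θ
  set a : ℝ := ((q * p : ℕ) : ℝ) / 2 with ha
  have ha0 : 0 < a := by
    have : (0 : ℝ) < ((q * p : ℕ) : ℝ) := by exact_mod_cast hqp
    positivity
  refine ⟨ENNReal.ofReal (T / a), ENNReal.ofReal_ne_top, fun G hG => ?_⟩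
  have hQm : Measurable fun ω : Sample q m p => quadForm θ Sig ω :=
    (continuous_quadForm θ Sig).measurable
  have htail : Measurable fun t : ℝ => ∫⁻ v in Set.Ioi t, F v :=
    Antitone.measurable fun s t hst => lintegral_mono_set (Set.Ioi_subset_Ioi hst)
  have hGm : AEMeasurable (fun ω : Sample q m p => G ω.2) volume :=
    hG.comp_quasiMeasurePreserving Measure.quasiMeasurePreserving_snd
  have hGm' : AEMeasurable (fun ω : Sample q m p => G ω.2)
      ((volume : Measure (Fin q → Fin p → ℝ)).prod (volume : Measure (Fin m → Fin p → ℝ))) := hGm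
  have hm1 : AEMeasurable (fun ω : Sample q m p =>
      (∫⁻ v in Set.Ioi (quadForm θ Sig ω), F v) * G ω.2)
      ((volume : Measure (Fin q → Fin p → ℝ)).prod (volume : Measure (Fin m → Fin p → ℝ))) :=
    (htail.comp hQm).aemeasurable.mul hGm'
  have hm2 : AEMeasurable (fun ω : Sample q m p => F (quadForm θ Sig ω) * G ω.2)
      ((volume : Measure (Fin q → Fin p → ℝ)).prod (volume : Measure (Fin m → Fin p → ℝ))) :=
    (hF.comp hQm).aemeasurable.mul hGm'
  rw [Measure.volume_eq_prod, lintegral_prod_symm _ hm1, lintegral_prod_symm _ hm2,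
    ← lintegral_const_mul' _ _ ENNReal.ofReal_ne_top]
  refine lintegral_mono fun u => ?_
  have hs1 : Measurable fun z : Fin q → Fin p → ℝ => quadForm θ Sig (z, u) :=
    hQm.comp measurable_prodMk_right
  change ∫⁻ z, (∫⁻ v in Set.Ioi (quadForm θ Sig (z, u)), F v) * G u ≤
    _ * ∫⁻ z, F (quadForm θ Sig (z, u)) * G u
  have hs2 : Measurable fun z : Fin q → Fin p → ℝ => ∫⁻ v in Set.Ioi (quadForm θ Sig (z, u)), F v :=
    htail.comp hs1
  have hs3 : Measurable fun z : Fin q → Fin p → ℝ => F (quadForm θ Sig (z, u)) := hF.comp hs1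
  rw [lintegral_mul_const _ hs2, lintegral_mul_const _ hs3, ← mul_assoc,
    hκ _ htail u, hκ _ hF u]
  exact mul_le_mul_left
    (lintegral_tail_le_of_radialDensity hκ0 ha0 hF hT (rowForm_nonneg hSig u)) _

/-- Lebesgue-almost sure properties hold at `Q`, for almost every observation. -/
theorem quasiMeasurePreserving_quadForm (hqp : 0 < q * p) (hSig : Sig.PosDef)
    (θ : Matrix (Fin q) (Fin p) ℝ) :
    Measure.QuasiMeasurePreserving (fun ω : Sample q m p => quadForm θ Sig ω) volume volume := by
  have hQm : Measurable fun ω : Sample q m p => quadForm θ Sig ω :=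
    (continuous_quadForm θ Sig).measurable
  obtain ⟨κ, hκ0, hκ⟩ := exists_map_quadForm_fiber (m := m) hqp hSig θ
  refine ⟨hQm, Measure.AbsolutelyContinuous.mk fun s hs hs0 => ?_⟩
  have hF : Measurable (s.indicator fun _ => (1 : ℝ≥0∞)) := measurable_const.indicator hs
  rw [Measure.map_apply hQm hs, ← lintegral_indicator_one (hQm hs)]
  have e : ((fun ω : Sample q m p => quadForm θ Sig ω) ⁻¹' s).indicator
      (1 : Sample q m p → ℝ≥0∞) =
      fun ω => s.indicator (fun _ => (1 : ℝ≥0∞)) (quadForm θ Sig ω) := by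
    funext ω
    by_cases h : quadForm θ Sig ω ∈ s
    · rw [Set.indicator_of_mem h, Set.indicator_of_mem (show ω ∈ _ ⁻¹' s from h)]
      rfl
    · rw [Set.indicator_of_notMem h, Set.indicator_of_notMem (show ω ∉ _ ⁻¹' s from h)]
  have hFQ : Measurable fun ω : Sample q m p =>
      s.indicator (fun _ => (1 : ℝ≥0∞)) (quadForm θ Sig ω) := hF.comp hQm
  rw [e, Measure.volume_eq_prod]
  beta_reduce
  rw [lintegral_prod_symm _ hFQ.aemeasurable]
  refine lintegral_eq_zero_of_ae_eq_zero (Eventually.of_forall fun u => ?_)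
  change ∫⁻ z : Fin q → Fin p → ℝ, s.indicator (fun _ => (1 : ℝ≥0∞)) (quadForm θ Sig (z, u)) = 0
  rw [hκ _ hF u]
  set A : Set ℝ := {x | x + rowForm Sig u ∈ s} with hA
  have hAm : MeasurableSet A := (measurable_id.add_const (rowForm Sig u)) hs
  have e2 : (fun x : ℝ => s.indicator (fun _ => (1 : ℝ≥0∞)) (x + rowForm Sig u)) =
      A.indicator 1 := rfl
  rw [e2, lintegral_indicator_one hAm]
  refine withDensity_absolutelyContinuous _ _ (Measure.absolutelyContinuous_of_le
    Measure.restrict_le_self ?_)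
  exact (measure_preimage_add_right volume _ _).trans hs0

end

/-! ### Removing the restriction to eigenvalues bounded away from zero. -/

section

variable {q m p : ℕ} {Sig : Matrix (Fin p) (Fin p) ℝ}

theorem measurable_invSum : Measurable fun u : Fin m → Fin p → ℝ => invSum (eigval u) := by
  unfold invSum
  have := measurable_eigval_apply (m := m) (p := p)
  fun_prop

/-- Cutting `φ` off near the boundary `l_i = 0` costs a term controlled by `φ` itself. -/
theorem exists_haffDiv_cut_le : ∃ C : ℝ, 0 ≤ C ∧ ∀ (m p : ℕ)
    (φ : (Fin (min p m) → ℝ) → Fin (min p m) → ℝ) (ε : ℝ) (l : Fin (min p m) → ℝ), 0 < ε →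
    l ∈ chamber (min p m) → DifferentiableAt ℝ φ l →
    haffDiv m p (fun l => cut (ε * invSum l) • φ l) l ≤ cut (ε * invSum l) * haffDiv m p φ l +
      if 1 ≤ ε * invSum l ∧ ε * invSum l ≤ 2 then C * ∑ i, |φ l i| else 0 := by
  obtain ⟨C, hC0, hC⟩ := exists_abs_fderiv_cut_le
  refine ⟨4 * C, by positivity, fun m p φ ε l hε hl hφ => ?_⟩
  have hd := hasFDerivAt_invSum hl.2
  have hχ : DifferentiableAt ℝ (fun l => cut (ε * invSum l)) l :=
    (differentiable_cut _).comp l (hd.1.const_mul ε)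
  rw [haffDiv_smul hχ hφ]
  refine add_le_add le_rfl ?_
  have hterm : ∀ i ∈ (univ : Finset (Fin (min p m))),
      2 * l i * φ l i * fderiv ℝ (fun l => cut (ε * invSum l)) l (Pi.single i 1) ≤
      if 1 ≤ ε * invSum l ∧ ε * invSum l ≤ 2 then 4 * C * |φ l i| else 0 := by
    intro i _
    have hli := hl.2 i
    have h1 := hC _ invSum ε l (Pi.single i 1) hε hd.1
    refine (le_abs_self _).trans ?_
    rw [abs_mul, abs_mul, abs_mul, abs_two, abs_of_pos hli]
    refine (mul_le_mul_of_nonneg_left h1 (by positivity)).trans ?_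
    split_ifs with h
    · rw [hd.2 i]
      -- One factor `l_i⁻¹` is absorbed by the weight `l_i` of the divergence, the other by `ε` on
      -- the transition band.
      have h2 : ε * (l i)⁻¹ ≤ 2 :=
        (mul_le_mul_of_nonneg_left (inv_le_invSum hl.2 i) hε.le).trans h.2
      calc 2 * l i * |φ l i| * (C * ε * (l i)⁻¹ ^ 2)
          = 2 * C * |φ l i| * (ε * (l i)⁻¹) * (l i * (l i)⁻¹) := by ring
        _ = 2 * C * |φ l i| * (ε * (l i)⁻¹) := by rw [mul_inv_cancel₀ hli.ne', mul_one]
        _ ≤ 2 * C * |φ l i| * 2 := by gcongr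
        _ = 4 * C * |φ l i| := by ring
    · rw [mul_zero]
  refine (Finset.sum_le_sum hterm).trans (le_of_eq ?_)
  split_ifs
  · rw [Finset.mul_sum]
  · rw [Finset.sum_const_zero]

/-- The integrated inequality for fields that need not vanish near the boundary `l_i = 0`. -/
theorem integral_mul_haffWeight_le_of_bounded_support (hqp : 0 < q * p) (hSig : Sig.PosDef)
    {φ : (Fin (min p m) → ℝ) → Fin (min p m) → ℝ}
    (hφ : DifferentiableOn ℝ φ (chamber (min p m)))
    (hbox : ∀ ε R : ℝ, 0 < ε → ∃ C : ℝ, ∀ l ∈ chamber (min p m),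
      (∀ i, ε ≤ l i ∧ l i ≤ R) → ∀ i, |φ l i| ≤ C)
    {h : (Fin (min p m) → ℝ) → ℝ} (hh : ∀ l ∈ chamber (min p m), haffDiv m p φ l ≤ h l)
    (θ : Matrix (Fin q) (Fin p) ℝ) {T T' : ℝ} (hTT' : T < T')
    (hki : IntegrableOn (fun ω : Sample q m p => h (eigval ω.2)) {ω | quadForm θ Sig ω < T'})
    {g : ℝ → ℝ} (hg : Measurable g) (hg0 : ∀ t, 0 ≤ g t) {M : ℝ} (hgM : ∀ t, g t ≤ M)
    (hgT : ∀ t, T < t → g t = 0)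
    (hi1 : Integrable fun ω : Sample q m p => g (quadForm θ Sig ω) * haffWeight Sig φ ω.2)
    (hi2 : ∀ i, Integrable fun ω : Sample q m p => g (quadForm θ Sig ω) * φ (eigval ω.2) i)
    (hi3 : Integrable fun ω : Sample q m p =>
      2⁻¹ * (∫ s in Set.Ioi (quadForm θ Sig ω), g s) * h (eigval ω.2)) :
    ∫ ω : Sample q m p, g (quadForm θ Sig ω) * haffWeight Sig φ ω.2 ≤
      ∫ ω : Sample q m p, 2⁻¹ * (∫ s in Set.Ioi (quadForm θ Sig ω), g s) * h (eigval ω.2) := by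
  classical
  have hQm : Measurable fun ω : Sample q m p => quadForm θ Sig ω :=
    (continuous_quadForm θ Sig).measurable
  have hηm : Measurable fun ω : Sample q m p => 2⁻¹ * ∫ s in Set.Ioi (quadForm θ Sig ω), g s :=
    ((measurable_integral_Ioi hg).comp hQm).const_mul _
  have hφm' : ∀ i, AEStronglyMeasurable (fun u : Fin m → Fin p → ℝ => φ (eigval u) i) volume :=
    fun i => aestronglyMeasurable_of_continuousOn_regular (continuousOn_comp_eigval
      (continuousOn_pi.mp hφ.continuousOn i))
  have hφm : ∀ i, AEStronglyMeasurable (fun ω : Sample q m p => φ (eigval ω.2) i) volume :=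
    fun i => (hφm' i).comp_snd
  have hφd : ∀ l ∈ chamber (min p m), DifferentiableAt ℝ φ l := fun l hl =>
    (hφ l hl).differentiableAt ((isOpen_chamber _).mem_nhds hl)
  -- The tail weight times `φ_i` is integrable because, on average over `z`, tails are bounded by a
  -- multiple of `g` itself. This dominates the cost of the cutoff.
  have hηφ : ∀ i, Integrable fun ω : Sample q m p =>
      2⁻¹ * (∫ s in Set.Ioi (quadForm θ Sig ω), g s) * φ (eigval ω.2) i := by
    intro i
    refine ⟨hηm.aestronglyMeasurable.mul (hφm i), ?_⟩
    obtain ⟨C, hC, hCG⟩ := exists_lintegral_tail_quadForm_le (m := m) hqp hSig θ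
      (F := fun v => ‖g v‖ₑ) (T := T) hg.enorm (fun v hv => by simp [hgT v hv])
    refine lt_of_le_of_lt (lintegral_mono fun ω => ?_)
      (lt_of_le_of_lt (hCG (fun u => ‖φ (eigval u) i‖ₑ) (hφm' i).enorm) ?_)
    · rw [enorm_mul, enorm_mul]
      refine mul_le_mul_left ?_ _
      calc ‖(2⁻¹ : ℝ)‖ₑ * ‖∫ s in Set.Ioi (quadForm θ Sig ω), g s‖ₑ
          ≤ 1 * ‖∫ s in Set.Ioi (quadForm θ Sig ω), g s‖ₑ := by
            refine mul_le_mul_left ?_ _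
            rw [Real.enorm_of_nonneg (by norm_num), ← ENNReal.ofReal_one]
            exact ENNReal.ofReal_le_ofReal (by norm_num)
        _ ≤ _ := by
            rw [one_mul]
            exact enorm_integral_le_lintegral_enorm _
    · have := (hi2 i).2
      rw [HasFiniteIntegral] at this
      simp only [enorm_mul] at this
      exact ENNReal.mul_lt_top hC.lt_top this
  obtain ⟨C, hC0, hC⟩ := exists_haffDiv_cut_le
  let ε : ℕ → ℝ := fun n => 1 / ((n : ℝ) + 1)
  have hε0 : ∀ n, 0 < ε n := fun n => by positivity
  let χ : ℕ → (Fin (min p m) → ℝ) → ℝ := fun n l => cut (ε n * invSum l)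
  let rem : ℕ → (Fin (min p m) → ℝ) → ℝ := fun n l =>
    if 1 ≤ ε n * invSum l ∧ ε n * invSum l ≤ 2 then C * ∑ i, |φ l i| else 0
  let k : ℕ → (Fin (min p m) → ℝ) → ℝ := fun n l => χ n l * h l + rem n l
  have hχ0 : ∀ n l, 0 ≤ χ n l := fun n l => cut_nonneg _
  have hχ1 : ∀ n l, χ n l ≤ 1 := fun n l => cut_le_one _
  have hrem0 : ∀ n l, 0 ≤ rem n l := fun n l => by
    simp only [rem]
    split_ifs
    · exact mul_nonneg hC0 (Finset.sum_nonneg fun _ _ => abs_nonneg _)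
    · exact le_rfl
  have hremle : ∀ n l, rem n l ≤ C * ∑ i, |φ l i| := fun n l => by
    simp only [rem]
    split_ifs
    · exact le_rfl
    · exact mul_nonneg hC0 (Finset.sum_nonneg fun _ _ => abs_nonneg _)
  have hinvm : Measurable fun ω : Sample q m p => invSum (eigval ω.2) :=
    measurable_invSum.comp measurable_snd
  have hχm : ∀ n, Measurable fun ω : Sample q m p => χ n (eigval ω.2) := fun n =>
    continuous_cut.measurable.comp (hinvm.const_mul (ε n))
  have hremm : ∀ n, AEStronglyMeasurable (fun ω : Sample q m p => rem n (eigval ω.2)) volume := by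
    intro n
    have hset : MeasurableSet {ω : Sample q m p | 1 ≤ ε n * invSum (eigval ω.2) ∧
        ε n * invSum (eigval ω.2) ≤ 2} :=
      (measurableSet_le measurable_const (hinvm.const_mul _)).inter
        (measurableSet_le (hinvm.const_mul _) measurable_const)
    have := AEMeasurable.indicator (μ := volume) ((Finset.aemeasurable_fun_sum univ fun i _ =>
      (hφm i).aemeasurable.abs).const_mul C) hset
    refine (this.congr (Eventually.of_forall fun ω => ?_)).aestronglyMeasurable
    simp only [rem, Set.indicator, Set.mem_ofPred_eq]
  have hχd : ∀ n, ∀ l ∈ chamber (min p m), DifferentiableAt ℝ (χ n) l := fun n l hl =>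
    (differentiable_cut _).comp l ((hasFDerivAt_invSum hl.2).1.const_mul (ε n))
  -- An eigenvalue below `ε n / 2` already puts the argument of `cut` above two, so the cut field is
  -- supported where all `l_i ≥ ε n / 2`.
  have hsmall : ∀ n, ∀ l ∈ chamber (min p m), (∃ i, l i < ε n / 2) → 2 < ε n * invSum l := by
    rintro n l hl ⟨i, hi⟩
    have h1 := hl.2 i
    have h2 := inv_le_invSum hl.2 i
    have h3 : 2 < ε n * (l i)⁻¹ := by
      rw [← div_eq_mul_inv, lt_div_iff₀ h1]
      linarith
    exact h3.trans_le (mul_le_mul_of_nonneg_left h2 (hε0 n).le)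
  have hw : ∀ n u, haffWeight Sig (fun l => χ n l • φ l) u =
      χ n (eigval u) * haffWeight Sig φ u := by
    intro n u
    simp only [haffWeight, Finset.mul_sum, Pi.smul_apply, smul_eq_mul, mul_assoc]
  have hstep : ∀ n, ∫ ω : Sample q m p,
      g (quadForm θ Sig ω) * (χ n (eigval ω.2) * haffWeight Sig φ ω.2) ≤
      ∫ ω : Sample q m p, 2⁻¹ * (∫ s in Set.Ioi (quadForm θ Sig ω), g s) * k n (eigval ω.2) := by
    intro n
    simp only [← hw]
    have hkin : IntegrableOn (fun ω : Sample q m p => k n (eigval ω.2))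
        {ω | quadForm θ Sig ω < T'} := by
      refine Integrable.add (Integrable.bdd_mul (c := 1) hki
        (hχm n).aestronglyMeasurable (Eventually.of_forall fun ω => ?_)) ?_
      · rw [Real.norm_of_nonneg (hχ0 _ _)]
        exact hχ1 _ _
      · obtain ⟨R, hR0, hR⟩ := exists_norm_le_of_quadForm_le (q := q) (m := m) hSig θ T'
        -- The remainder lives on the transition band, where the eigenvalues are at least `ε n / 2`;
        -- they are also bounded above on the sublevel set, so boundedness of `φ` on such boxes
        -- suffices.
        obtain ⟨Cb, hCb⟩ := hbox (ε n / 2) (p * (m * R ^ 2)) (half_pos (hε0 n))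
        have hDm : MeasurableSet {ω : Sample q m p | quadForm θ Sig ω < T'} :=
          measurableSet_lt hQm measurable_const
        refine Measure.integrableOn_of_bounded (M := C * ∑ _i : Fin (min p m), max Cb 0)
          (volume_quadForm_lt_ne_top hSig θ T') (hremm n) ?_
        filter_upwards [ae_restrict_mem hDm, ae_restrict_of_ae (ae_snd_mem_regular q m p)]
          with ω hω hr
        have hω' : quadForm θ Sig ω < T' := hω
        have hr' : eigval ω.2 ∈ chamber (min p m) := hr
        rw [Real.norm_of_nonneg (hrem0 _ _)]
        simp only [rem]
        split_ifs with hcond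
        · refine mul_le_mul_of_nonneg_left (Finset.sum_le_sum fun i _ => ?_) hC0
          refine (hCb _ hr' (fun i => ⟨?_, ?_⟩) i).trans (le_max_left _ _)
          · by_contra hlt
            exact absurd hcond.2 (not_le.mpr (hsmall n _ hr' ⟨i, not_le.mp hlt⟩))
          · exact eigval_le_of_norm_le ((norm_snd_le ω).trans (hR ω hω'.le)) i
        · exact mul_nonneg hC0 (Finset.sum_nonneg fun _ _ => le_max_right _ _)
    refine integral_mul_haffWeight_le_of_bounded (φ := fun l => χ n l • φ l) hSig
      (fun l hl => ((hχd n l hl).smul (hφd l hl)).differentiableWithinAt) (half_pos (hε0 n))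
      (fun l hl hs => ?_) (fun R => ?_) (fun l hl => ?_) θ hTT' hkin hg hg0 hgM hgT
    · have : χ n l = 0 := cut_eq_zero (hsmall n l hl hs).le
      rw [this, zero_smul]
    · obtain ⟨Cb, hCb⟩ := hbox (ε n / 2) R (half_pos (hε0 n))
      refine ⟨max Cb 0, fun l hl hlR i => ?_⟩
      by_cases hs : ∃ i, l i < ε n / 2
      · have : χ n l = 0 := cut_eq_zero (hsmall n l hl hs).le
        rw [this, zero_smul]
        simp
      · push Not at hs
        rw [Pi.smul_apply, smul_eq_mul, abs_mul, abs_of_nonneg (hχ0 n l)]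
        exact (mul_le_of_le_one_left (abs_nonneg _) (hχ1 n l)).trans
          ((hCb l hl (fun i => ⟨hs i, hlR i⟩) i).trans (le_max_left _ _))
    · exact (hC m p φ (ε n) l (hε0 n) hl (hφd l hl)).trans
        (add_le_add (mul_le_mul_of_nonneg_left (hh l hl) (hχ0 n l)) le_rfl)
  have hone : ∀ l : Fin (min p m) → ℝ, ∀ᶠ n in atTop, χ n l = 1 ∧ rem n l = 0 := by
    intro l
    obtain ⟨N, hN⟩ := exists_nat_ge (invSum l)
    filter_upwards [tendsto_cut_div (invSum l), eventually_ge_atTop N] with n hn hnN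
    refine ⟨hn, ?_⟩
    simp only [rem]
    rw [if_neg]
    rw [not_and_or]
    left
    have : (N : ℝ) ≤ n := by exact_mod_cast hnN
    simp only [ε]
    rw [not_le, one_div, inv_mul_lt_iff₀ (by positivity)]
    linarith
  have hlim1 : Tendsto (fun n => ∫ ω : Sample q m p,
      g (quadForm θ Sig ω) * (χ n (eigval ω.2) * haffWeight Sig φ ω.2)) atTop
      (𝓝 (∫ ω : Sample q m p, g (quadForm θ Sig ω) * haffWeight Sig φ ω.2)) := by
    refine tendsto_integral_of_dominated_convergence _ (fun n => ?_) hi1.norm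
      (fun n => Eventually.of_forall fun ω => ?_) (Eventually.of_forall fun ω => ?_)
    · exact (hg.comp hQm).aestronglyMeasurable.mul ((hχm n).aestronglyMeasurable.mul
        (aestronglyMeasurable_haffWeight_snd hφ.continuousOn))
    · rw [norm_mul, norm_mul, norm_mul, Real.norm_of_nonneg (hχ0 _ _)]
      exact mul_le_mul_of_nonneg_left (mul_le_of_le_one_left (norm_nonneg _) (hχ1 _ _))
        (norm_nonneg _)
    · refine tendsto_const_nhds.congr' ?_
      filter_upwards [hone (eigval ω.2)] with n hn
      rw [hn.1, one_mul]
  have hlim2 : Tendsto (fun n => ∫ ω : Sample q m p,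
      2⁻¹ * (∫ s in Set.Ioi (quadForm θ Sig ω), g s) * k n (eigval ω.2)) atTop
      (𝓝 (∫ ω : Sample q m p,
        2⁻¹ * (∫ s in Set.Ioi (quadForm θ Sig ω), g s) * h (eigval ω.2))) := by
    have hbd : Integrable fun ω : Sample q m p =>
        ‖2⁻¹ * (∫ s in Set.Ioi (quadForm θ Sig ω), g s) * h (eigval ω.2)‖ +
        C * ∑ i, ‖2⁻¹ * (∫ s in Set.Ioi (quadForm θ Sig ω), g s) * φ (eigval ω.2) i‖ :=
      hi3.norm.add ((integrable_finsetSum _ fun i _ => (hηφ i).norm).const_mul C)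
    refine tendsto_integral_of_dominated_convergence _ (fun n => ?_) hbd
      (fun n => Eventually.of_forall fun ω => ?_) (Eventually.of_forall fun ω => ?_)
    · have e : (fun ω : Sample q m p =>
          2⁻¹ * (∫ s in Set.Ioi (quadForm θ Sig ω), g s) * k n (eigval ω.2)) = fun ω =>
          χ n (eigval ω.2) * (2⁻¹ * (∫ s in Set.Ioi (quadForm θ Sig ω), g s) * h (eigval ω.2)) +
          (2⁻¹ * (∫ s in Set.Ioi (quadForm θ Sig ω), g s)) * rem n (eigval ω.2) := by
        funext ω
        simp only [k]
        ring
      rw [e]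
      exact ((hχm n).aestronglyMeasurable.mul hi3.1).add
        (hηm.aestronglyMeasurable.mul (hremm n))
    · simp only [k]
      rw [mul_add]
      refine (norm_add_le _ _).trans (add_le_add ?_ ?_)
      · rw [norm_mul, norm_mul (χ _ _), norm_mul _ (h _), Real.norm_of_nonneg (hχ0 _ _)]
        exact mul_le_mul_of_nonneg_left (mul_le_of_le_one_left (norm_nonneg _) (hχ1 _ _))
          (norm_nonneg _)
      · rw [norm_mul, Real.norm_of_nonneg (hrem0 _ _)]
        refine (mul_le_mul_of_nonneg_left (hremle n _) (norm_nonneg _)).trans (le_of_eq ?_)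
        simp only [norm_mul _ (φ _ _), ← Finset.mul_sum, Real.norm_eq_abs (φ _ _)]
        ring
    · refine tendsto_const_nhds.congr' ?_
      filter_upwards [hone (eigval ω.2)] with n hn
      simp only [k]
      rw [hn.1, hn.2, one_mul, add_zero]
  exact le_of_tendsto_of_tendsto' hlim1 hlim2 hstep

end

/-! ### General generating functions: truncation of `f`. -/

section

variable {q m p : ℕ} {Sig : Matrix (Fin p) (Fin p) ℝ} {f : ℝ → ℝ}

theorem antitone_Fstar (f : ℝ → ℝ) : Antitone (Fstar f) := fun _ _ hst =>
  mul_le_mul_right (lintegral_mono_set (Set.Ioi_subset_Ioi hst)) _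

theorem measurable_Fstar (f : ℝ → ℝ) : Measurable (Fstar f) := (antitone_Fstar f).measurable

theorem lintegral_ofReal_Ioi_ne_top {t : ℝ} (h : Fstar f t ≠ ∞) :
    ∫⁻ ν in Set.Ioi t, ENNReal.ofReal (f ν) ≠ ∞ := by
  intro h'
  rw [Fstar, h'] at h
  exact h (ENNReal.mul_top (by simp))

theorem integrableOn_Ioi_of_Fstar (hf : Measurable f) (hf0 : ∀ t, 0 ≤ t → 0 ≤ f t) {t : ℝ}
    (ht : 0 ≤ t) (h : Fstar f t ≠ ∞) : IntegrableOn f (Set.Ioi t) := by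
  refine ⟨hf.aestronglyMeasurable, ?_⟩
  rw [hasFiniteIntegral_iff_ofReal]
  · exact (lintegral_ofReal_Ioi_ne_top h).lt_top
  · filter_upwards [ae_restrict_mem measurableSet_Ioi] with s hs
    exact hf0 s (ht.trans (le_of_lt hs))

theorem toReal_Fstar (hf : Measurable f) (hf0 : ∀ t, 0 ≤ t → 0 ≤ f t) {t : ℝ} (ht : 0 ≤ t) :
    (Fstar f t).toReal = 2⁻¹ * ∫ s in Set.Ioi t, f s := by
  rw [integral_eq_lintegral_of_nonneg_ae _ hf.aestronglyMeasurable, Fstar, ENNReal.toReal_mul]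
  · simp
  · filter_upwards [ae_restrict_mem measurableSet_Ioi] with s hs
    exact hf0 s (ht.trans (le_of_lt hs))

theorem ae_eq_zero_of_Fstar_eq_zero (hf : Measurable f) (hf0 : ∀ t, 0 ≤ t → 0 ≤ f t) {t : ℝ}
    (h : Fstar f t = 0) : ∀ᵐ s, 0 < s → t < s → f s = 0 := by
  rw [Fstar, mul_eq_zero, or_iff_right (by simp), lintegral_eq_zero_iff (by fun_prop)] at h
  filter_upwards [(ae_restrict_iff' measurableSet_Ioi).mp h] with s hs h0 hts
  exact le_antisymm (ENNReal.ofReal_eq_zero.mp (hs hts)) (hf0 s h0.le)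

/-- The support of `f` is exhausted by intervals to the right of which `f` has positive mass. -/
theorem exists_seq_Fstar_ne_zero (hf : Measurable f) (hf0 : ∀ t, 0 ≤ t → 0 ≤ f t)
    (h0 : Fstar f 0 ≠ 0) :
    ∃ T : ℕ → ℝ, StrictMono T ∧ (∀ n, Fstar f (T n) ≠ 0) ∧
      ∀ᵐ t, 0 < t → f t ≠ 0 → ∀ᶠ n in atTop, t ≤ T n := by
  by_cases hall : ∀ t, Fstar f t ≠ 0
  · refine ⟨fun n => n, Nat.strictMono_cast, fun n => hall n, Eventually.of_forall fun t _ _ => ?_⟩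
    obtain ⟨N, hN⟩ := exists_nat_ge t
    filter_upwards [eventually_ge_atTop N] with n hn
    exact hN.trans (by exact_mod_cast hn)
  · push Not at hall
    obtain ⟨t0, ht0⟩ := hall
    -- Once `F*` vanishes somewhere, the useful levels are those strictly below the right end `sSup
    -- A` of the essential support of `f`, approached by a strictly increasing sequence.
    set A : Set ℝ := {t | Fstar f t ≠ 0} with hA
    have hAb : BddAbove A := ⟨t0, fun t ht => by
      by_contra hlt
      exact ht (le_antisymm (ht0 ▸ antitone_Fstar f (not_le.mp hlt).le) (zero_le))⟩
    have hAne : A.Nonempty := ⟨0, h0⟩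
    obtain ⟨u, hu, hult, hut⟩ := exists_seq_strictMono_tendsto (sSup A)
    refine ⟨u, hu, fun n hn => ?_, ?_⟩
    · obtain ⟨a, ha, hua⟩ := exists_lt_of_lt_csSup hAne (hult n)
      exact ha (le_antisymm (hn ▸ antitone_Fstar f hua.le) (zero_le))
    · have hz : ∀ k : ℕ, ∀ᵐ s, 0 < s → sSup A + 1 / ((k : ℝ) + 1) < s → f s = 0 := by
        intro k
        refine ae_eq_zero_of_Fstar_eq_zero hf hf0 ?_
        by_contra hne
        have h1 : sSup A + 1 / ((k : ℝ) + 1) ≤ sSup A := le_csSup hAb hne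
        have h2 : 0 < 1 / ((k : ℝ) + 1) := by positivity
        linarith
      filter_upwards [ae_all_iff.mpr hz, Measure.ae_ne volume (sSup A)] with t ht htne ht0 hft
      have hlt : t < sSup A := by
        by_contra hge
        have hlt : 0 < t - sSup A :=
          sub_pos.mpr (lt_of_le_of_ne (not_lt.mp hge) (Ne.symm htne))
        obtain ⟨k, hk⟩ := exists_nat_one_div_lt hlt
        exact hft (ht k ht0 (by linarith))
      filter_upwards [hut.eventually (lt_mem_nhds hlt)] with n hn
      exact hn.le

/-- The integrated Stein–Haff inequality. -/
theorem integral_mul_haffWeight_le (hqp : 0 < q * p) (hSig : Sig.PosDef)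
    {φ : (Fin (min p m) → ℝ) → Fin (min p m) → ℝ}
    (hφ : DifferentiableOn ℝ φ (chamber (min p m)))
    (hbox : ∀ ε R : ℝ, 0 < ε → ∃ C : ℝ, ∀ l ∈ chamber (min p m),
      (∀ i, ε ≤ l i ∧ l i ≤ R) → ∀ i, |φ l i| ≤ C)
    {h : (Fin (min p m) → ℝ) → ℝ} (hh : ∀ l ∈ chamber (min p m), haffDiv m p φ l ≤ h l)
    (θ : Matrix (Fin q) (Fin p) ℝ) (hf : Measurable f) (hf0 : ∀ t, 0 ≤ t → 0 ≤ f t)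
    (hF : ∀ t, 0 < t → Fstar f t ≠ ∞)
    (hi1 : Integrable fun ω : Sample q m p => f (quadForm θ Sig ω) * haffWeight Sig φ ω.2)
    (hi2 : ∀ i, Integrable fun ω : Sample q m p => f (quadForm θ Sig ω) * φ (eigval ω.2) i)
    (hi3 : Integrable fun ω : Sample q m p =>
      (Fstar f (quadForm θ Sig ω)).toReal * h (eigval ω.2)) :
    ∫ ω : Sample q m p, f (quadForm θ Sig ω) * haffWeight Sig φ ω.2 ≤
      ∫ ω : Sample q m p, (Fstar f (quadForm θ Sig ω)).toReal * h (eigval ω.2) := by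
  have hQm : Measurable fun ω : Sample q m p => quadForm θ Sig ω :=
    (continuous_quadForm θ Sig).measurable
  have hQae := quasiMeasurePreserving_quadForm (m := m) hqp hSig θ
  have hQpos : ∀ᵐ ω : Sample q m p, 0 < quadForm θ Sig ω := by
    filter_upwards [hQae.ae (Measure.ae_ne volume (0 : ℝ))] with ω hω
    exact lt_of_le_of_ne (quadForm_nonneg hSig θ ω) (Ne.symm hω)
  -- If `f` has no mass on the half-line, both sides are zero.
  by_cases h0 : Fstar f 0 = 0
  · have e1 : ∫ ω : Sample q m p, f (quadForm θ Sig ω) * haffWeight Sig φ ω.2 = 0 := by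
      refine integral_eq_zero_of_ae ?_
      filter_upwards [hQpos, hQae.ae (ae_eq_zero_of_Fstar_eq_zero hf hf0 h0)] with ω hω hz
      rw [hz hω hω, zero_mul]
      rfl
    have e2 : ∫ ω : Sample q m p, (Fstar f (quadForm θ Sig ω)).toReal * h (eigval ω.2) = 0 := by
      refine integral_eq_zero_of_ae (Eventually.of_forall fun ω => ?_)
      have : Fstar f (quadForm θ Sig ω) = 0 :=
        le_antisymm (h0 ▸ antitone_Fstar f (quadForm_nonneg hSig θ ω)) (zero_le)
      simp [this]
    rw [e1, e2]
  obtain ⟨T, hTmono, hTF, hTae⟩ := exists_seq_Fstar_ne_zero hf hf0 h0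
  -- Truncation in height by `n` and in range by `T n`; the strictly larger `T (n + 1)` leaves room
  -- for the continuous approximation used in the bounded case.
  let g : ℕ → ℝ → ℝ := fun n t => if 0 ≤ t ∧ t ≤ T n then min (f t) n else 0
  have hgm : ∀ n, Measurable (g n) := fun n =>
    Measurable.ite ((measurableSet_le measurable_const measurable_id).inter
      (measurableSet_le measurable_id measurable_const)) (hf.min measurable_const) measurable_const
  have hg0 : ∀ n t, 0 ≤ g n t := fun n t => by
    simp only [g]
    split_ifs with hc
    · exact le_min (hf0 t hc.1) n.cast_nonneg
    · exact le_rfl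
  have hgM : ∀ n t, g n t ≤ n := fun n t => by
    simp only [g]
    split_ifs
    · exact min_le_right _ _
    · exact n.cast_nonneg
  have hgT : ∀ n t, T n < t → g n t = 0 := fun n t ht => if_neg fun hc => not_lt.mpr hc.2 ht
  have hgf : ∀ n t, 0 ≤ t → g n t ≤ f t := fun n t ht => by
    simp only [g]
    split_ifs
    · exact min_le_left _ _
    · exact hf0 t ht
  have hglim : ∀ᵐ t, 0 < t → ∀ᶠ n in atTop, g n t = f t := by
    filter_upwards [hTae] with t ht ht0
    by_cases hft : f t = 0
    · refine Eventually.of_forall fun n => ?_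
      simp only [g, hft]
      split_ifs
      · exact min_eq_left n.cast_nonneg
      · rfl
    · obtain ⟨N, hN⟩ := exists_nat_ge (f t)
      filter_upwards [ht ht0 hft, eventually_ge_atTop N] with n hn hNn
      simp only [g]
      rw [if_pos ⟨ht0.le, hn⟩, min_eq_left (hN.trans (by exact_mod_cast hNn))]
  have hint : ∀ t, 0 < t → IntegrableOn f (Set.Ioi t) := fun t ht =>
    integrableOn_Ioi_of_Fstar hf hf0 ht.le (hF t ht)
  have hgint : ∀ n t, 0 < t → IntegrableOn (g n) (Set.Ioi t) := fun n t ht =>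
    Integrable.mono (hint t ht) (hgm n).aestronglyMeasurable (by
      filter_upwards [ae_restrict_mem measurableSet_Ioi] with s hs
      have hs0 : 0 ≤ s := ht.le.trans (le_of_lt hs)
      rw [Real.norm_of_nonneg (hg0 n s), Real.norm_of_nonneg (hf0 s hs0)]
      exact hgf n s hs0)
  have hηF : ∀ n t, 0 < t → 2⁻¹ * ∫ s in Set.Ioi t, g n s ≤ (Fstar f t).toReal := by
    intro n t ht
    rw [toReal_Fstar hf hf0 ht.le]
    refine mul_le_mul_of_nonneg_left ?_ (by norm_num)
    exact setIntegral_mono_on (hgint n t ht) (hint t ht) measurableSet_Ioi fun s hs =>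
      hgf n s (ht.le.trans (le_of_lt hs))
  have hη0 : ∀ n t, 0 ≤ 2⁻¹ * ∫ s in Set.Ioi t, g n s := fun n t =>
    mul_nonneg (by norm_num) (integral_nonneg fun s => hg0 n s)
  have hηm : ∀ n, Measurable fun ω : Sample q m p =>
      2⁻¹ * ∫ s in Set.Ioi (quadForm θ Sig ω), g n s := fun n =>
    ((measurable_integral_Ioi (hgm n)).comp hQm).const_mul _
  have hFm : Measurable fun ω : Sample q m p => (Fstar f (quadForm θ Sig ω)).toReal :=
    ((measurable_Fstar f).comp hQm).ennreal_toReal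
  have hφm : ∀ i, AEStronglyMeasurable (fun ω : Sample q m p => φ (eigval ω.2) i) volume :=
    fun i => (aestronglyMeasurable_of_continuousOn_regular (continuousOn_comp_eigval
      (continuousOn_pi.mp hφ.continuousOn i))).comp_snd
  have hwm : AEStronglyMeasurable (fun ω : Sample q m p => haffWeight Sig φ ω.2) volume :=
    aestronglyMeasurable_haffWeight_snd hφ.continuousOn
  have hgle : ∀ n (ω : Sample q m p) (x : ℝ),
      ‖g n (quadForm θ Sig ω) * x‖ ≤ ‖f (quadForm θ Sig ω) * x‖ := by
    intro n ω x
    have hQ := quadForm_nonneg hSig θ ω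
    rw [norm_mul, norm_mul, Real.norm_of_nonneg (hg0 n _), Real.norm_of_nonneg (hf0 _ hQ)]
    exact mul_le_mul_of_nonneg_right (hgf n _ hQ) (norm_nonneg _)
  have hi1n : ∀ n, Integrable fun ω : Sample q m p =>
      g n (quadForm θ Sig ω) * haffWeight Sig φ ω.2 := fun n =>
    hi1.mono (((hgm n).comp hQm).aestronglyMeasurable.mul hwm)
      (Eventually.of_forall fun ω => hgle n ω _)
  have hi2n : ∀ n i, Integrable fun ω : Sample q m p =>
      g n (quadForm θ Sig ω) * φ (eigval ω.2) i := fun n i =>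
    (hi2 i).mono (((hgm n).comp hQm).aestronglyMeasurable.mul (hφm i))
      (Eventually.of_forall fun ω => hgle n ω _)
  have hηle : ∀ n, ∀ᵐ ω : Sample q m p,
      ‖2⁻¹ * (∫ s in Set.Ioi (quadForm θ Sig ω), g n s) * h (eigval ω.2)‖ ≤
        ‖(Fstar f (quadForm θ Sig ω)).toReal * h (eigval ω.2)‖ := by
    intro n
    filter_upwards [hQpos] with ω hω
    rw [norm_mul _ (h _), norm_mul _ (h _), Real.norm_of_nonneg (hη0 n _), Real.norm_of_nonneg ENNReal.toReal_nonneg]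
    exact mul_le_mul_of_nonneg_right (hηF n _ hω) (norm_nonneg _)
  -- Measurability is known only for `F* · h`, so the truncated product is obtained by multiplying
  -- it by the ratio of tails; where `F*` vanishes, so does the truncated tail.
  have hi3m : ∀ n, AEStronglyMeasurable (fun ω : Sample q m p =>
      2⁻¹ * (∫ s in Set.Ioi (quadForm θ Sig ω), g n s) * h (eigval ω.2)) volume := by
    intro n
    refine ((((hηm n).div hFm).aestronglyMeasurable).mul hi3.1).congr ?_
    filter_upwards [hQpos] with ω hω
    simp only [Pi.mul_apply, Pi.div_apply]
    by_cases hz : (Fstar f (quadForm θ Sig ω)).toReal = 0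
    · have := le_antisymm ((hηF n _ hω).trans hz.le) (hη0 n _)
      rw [this]
      simp
    · field_simp
  have hi3n : ∀ n, Integrable fun ω : Sample q m p =>
      2⁻¹ * (∫ s in Set.Ioi (quadForm θ Sig ω), g n s) * h (eigval ω.2) := fun n =>
    hi3.mono (hi3m n) (hηle n)
  -- Below the level `T (n + 1)`, `F*` is at least the positive number `F*(T (n + 1))`, so
  -- integrability of `F* · h` gives that of `h`. This is why the truncation levels must keep `F*`
  -- nonzero.
  have hki : ∀ n, IntegrableOn (fun ω : Sample q m p => h (eigval ω.2))
      {ω | quadForm θ Sig ω < T (n + 1)} := by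
    intro n
    by_cases hT0 : T (n + 1) ≤ 0
    · have : {ω : Sample q m p | quadForm θ Sig ω < T (n + 1)} = ∅ := by
        ext ω
        simp only [Set.mem_ofPred_eq, Set.mem_empty_iff_false, iff_false, not_lt]
        exact hT0.trans (quadForm_nonneg hSig θ ω)
      rw [this]
      exact integrableOn_empty
    · have hc : 0 < (Fstar f (T (n + 1))).toReal :=
        ENNReal.toReal_pos (hTF _) (hF _ (not_le.mp hT0))
      have hDm : MeasurableSet {ω : Sample q m p | quadForm θ Sig ω < T (n + 1)} :=
        measurableSet_lt hQm measurable_const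
      have hle : ∀ᵐ ω ∂((volume : Measure (Sample q m p)).restrict
          {ω | quadForm θ Sig ω < T (n + 1)}),
          (Fstar f (T (n + 1))).toReal ≤ (Fstar f (quadForm θ Sig ω)).toReal := by
        filter_upwards [ae_restrict_mem hDm, ae_restrict_of_ae hQpos] with ω hω hpos
        exact ENNReal.toReal_mono (hF _ hpos) (antitone_Fstar f (le_of_lt hω))
      have := hi3.integrableOn (s := {ω : Sample q m p | quadForm θ Sig ω < T (n + 1)})
      refine (Integrable.bdd_mul (c := ((Fstar f (T (n + 1))).toReal)⁻¹) this
        hFm.inv.aestronglyMeasurable ?_).congr ?_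
      · filter_upwards [hle] with ω hω
        simp only [Pi.inv_apply]
        rw [norm_inv, Real.norm_of_nonneg ENNReal.toReal_nonneg]
        exact inv_anti₀ hc hω
      · filter_upwards [hle] with ω hω
        have : (Fstar f (quadForm θ Sig ω)).toReal ≠ 0 := (hc.trans_le hω).ne'
        simp only [Pi.inv_apply]
        field_simp
  have hstep : ∀ n, ∫ ω : Sample q m p, g n (quadForm θ Sig ω) * haffWeight Sig φ ω.2 ≤
      ∫ ω : Sample q m p,
        2⁻¹ * (∫ s in Set.Ioi (quadForm θ Sig ω), g n s) * h (eigval ω.2) := fun n =>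
    integral_mul_haffWeight_le_of_bounded_support hqp hSig hφ hbox hh θ
      (hTmono (Nat.lt_succ_self n)) (hki n) (hgm n) (hg0 n) (hgM n) (hgT n) (hi1n n) (hi2n n)
      (hi3n n)
  have hlim1 : Tendsto (fun n => ∫ ω : Sample q m p,
      g n (quadForm θ Sig ω) * haffWeight Sig φ ω.2) atTop
      (𝓝 (∫ ω : Sample q m p, f (quadForm θ Sig ω) * haffWeight Sig φ ω.2)) := by
    refine tendsto_integral_of_dominated_convergence _ (fun n => (hi1n n).1) hi1.norm
      (fun n => Eventually.of_forall fun ω => hgle n ω _) ?_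
    filter_upwards [hQpos, hQae.ae hglim] with ω hω hl
    refine tendsto_const_nhds.congr' ?_
    filter_upwards [hl hω] with n hn
    rw [hn]
  have hlim2 : Tendsto (fun n => ∫ ω : Sample q m p,
      2⁻¹ * (∫ s in Set.Ioi (quadForm θ Sig ω), g n s) * h (eigval ω.2)) atTop
      (𝓝 (∫ ω : Sample q m p, (Fstar f (quadForm θ Sig ω)).toReal * h (eigval ω.2))) := by
    refine tendsto_integral_of_dominated_convergence _ (fun n => (hi3n n).1) hi3.norm hηle ?_
    filter_upwards [hQpos] with ω hω
    rw [toReal_Fstar hf hf0 hω.le]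
    refine (Tendsto.const_mul _ ?_).mul_const _
    refine tendsto_integral_of_dominated_convergence _
      (fun n => (hgm n).aestronglyMeasurable) (hint _ hω) (fun n => ?_) ?_
    · filter_upwards [ae_restrict_mem measurableSet_Ioi] with s hs
      rw [Real.norm_of_nonneg (hg0 n s)]
      exact hgf n s (hω.le.trans (le_of_lt hs))
    · filter_upwards [ae_restrict_mem measurableSet_Ioi, ae_restrict_of_ae hglim] with s hs hl
      refine tendsto_const_nhds.congr' ?_
      filter_upwards [hl (hω.trans hs)] with n hn
      rw [hn]
  exact le_of_tendsto_of_tendsto' hlim1 hlim2 hstep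

end

/-! ### Change of variables, normalization, and the two laws. -/

section

variable {q m p : ℕ} {Sig : Matrix (Fin p) (Fin p) ℝ} {f : ℝ → ℝ}

theorem exists_eq_mul_transpose {A : Matrix (Fin p) (Fin p) ℝ} (hA : A.PosDef) :
    ∃ C : Matrix (Fin p) (Fin p) ℝ, A = C * Cᵀ := by
  have hs := hA.isHermitian.spectral_theorem
  rw [Unitary.conjStarAlgAut_apply, Matrix.star_eq_conjTranspose,
    Matrix.conjTranspose_eq_transpose_of_trivial] at hs
  refine ⟨(hA.isHermitian.eigenvectorUnitary : Matrix (Fin p) (Fin p) ℝ) *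
    Matrix.diagonal fun i => Real.sqrt (hA.isHermitian.eigenvalues i), ?_⟩
  rw [Matrix.transpose_mul, Matrix.diagonal_transpose, Matrix.mul_assoc, ← Matrix.mul_assoc
    (Matrix.diagonal _) (Matrix.diagonal _), Matrix.diagonal_mul_diagonal]
  simp only [Real.mul_self_sqrt (hA.posSemidef.eigenvalues_nonneg _)]
  rw [← Matrix.mul_assoc]
  simpa using hs

/-- Linear change of variables in the integral of a function of `tr x Σ⁻¹ xᵀ`. -/
theorem lintegral_rowForm (n : ℕ) {C : Matrix (Fin p) (Fin p) ℝ} (hC : C.det ≠ 0)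
    (hSC : Sig⁻¹ = C * Cᵀ) {F : ℝ → ℝ≥0∞} (hF : Measurable F) :
    ∫⁻ x : Fin n → Fin p → ℝ, F (rowForm Sig x) =
      ENNReal.ofReal (|C.det|⁻¹ ^ n) * ∫⁻ x : Fin n → Fin p → ℝ, F (rowForm 1 x) := by
  -- Right multiplication by `C` acts separately on the `n` rows, so its determinant is `det C ^ n`.
  let L : (Fin n → Fin p → ℝ) →ₗ[ℝ] (Fin n → Fin p → ℝ) :=
    LinearMap.pi fun k => (Matrix.toLin' Cᵀ).comp (LinearMap.proj k)
  have hdet : LinearMap.det L = C.det ^ n := by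
    rw [LinearMap.det_pi]
    simp [LinearMap.det_toLin', Matrix.det_transpose]
  have hL : ∀ x, rowForm Sig x = rowForm 1 (L x) := by
    intro x
    have h1 : Matrix.of (L x) = Matrix.of x * C := by
      ext k a
      simp [L, Matrix.mul_apply, Matrix.mulVec, dotProduct, mul_comm]
    rw [rowForm, rowForm, hSC, h1, inv_one, Matrix.mul_one, Matrix.transpose_mul]
    simp only [Matrix.mul_assoc]
  have hmap := Measure.map_linearMap_addHaar_eq_smul_addHaar
    (volume : Measure (Fin n → Fin p → ℝ)) (f := L) (by rw [hdet]; exact pow_ne_zero n hC)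
  have hFm : Measurable fun x : Fin n → Fin p → ℝ => F (rowForm 1 x) :=
    hF.comp continuous_rowForm.measurable
  have hLm : Measurable L := L.continuous_of_finiteDimensional.measurable
  simp only [hL]
  rw [← lintegral_map (f := fun x : Fin n → Fin p → ℝ => F (rowForm 1 x)) hFm hLm, hmap,
    lintegral_smul_measure, hdet, smul_eq_mul, abs_inv, abs_pow, inv_pow]

/-- The total mass of an elliptical kernel does not depend on the location and scale. -/
theorem lintegral_quadForm (hSig : Sig.PosDef) (θ : Matrix (Fin q) (Fin p) ℝ) {F : ℝ → ℝ≥0∞}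
    (hF : Measurable F) :
    ENNReal.ofReal (Sig.det ^ (-((q : ℝ) + (m : ℝ)) / 2)) *
      ∫⁻ ω : Sample q m p, F (quadForm θ Sig ω) = ∫⁻ ω : Sample q m p, F (quadForm 0 1 ω) := by
  obtain ⟨C, hSC⟩ := exists_eq_mul_transpose hSig.inv
  have hdetpos := hSig.det_pos
  have hdet : C.det ^ 2 = Sig.det⁻¹ := by
    have h1 := congrArg Matrix.det hSC
    rw [Matrix.det_mul, Matrix.det_transpose, Matrix.det_nonsing_inv, Ring.inverse_eq_inv'] at h1
    rw [sq, ← h1]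
  have hC : C.det ≠ 0 := by
    intro h
    rw [h, sq, zero_mul] at hdet
    exact (inv_pos.mpr hdetpos).ne hdet
  have hCpos : 0 < |C.det| := abs_pos.mpr hC
  have hQ : ∀ (θ : Matrix (Fin q) (Fin p) ℝ) (S : Matrix (Fin p) (Fin p) ℝ),
      ∫⁻ ω : Sample q m p, F (quadForm θ S ω) = ∫⁻ z : Fin q → Fin p → ℝ,
        ∫⁻ u : Fin m → Fin p → ℝ, F (rowForm S z + rowForm S u) := by
    intro θ S
    have hm : Measurable fun ω : Sample q m p => F (quadForm θ S ω) :=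
      hF.comp (continuous_quadForm θ S).measurable
    rw [Measure.volume_eq_prod, lintegral_prod _ hm.aemeasurable]
    let θ' : Fin q → Fin p → ℝ := θ
    exact lintegral_sub_right_eq_self (fun z : Fin q → Fin p → ℝ =>
      ∫⁻ u : Fin m → Fin p → ℝ, F (rowForm S z + rowForm S u)) θ'
  have hFc : ∀ c : ℝ, Measurable fun t => F (c + t) := fun c => hF.comp (measurable_id.const_add c)
  have hG : Measurable fun c : ℝ => ∫⁻ u : Fin m → Fin p → ℝ, F (c + rowForm 1 u) :=
    Measurable.lintegral_prod_right (f := fun (c : ℝ) (u : Fin m → Fin p → ℝ) =>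
      F (c + rowForm 1 u)) (hF.comp (measurable_fst.add
        (continuous_rowForm.measurable.comp measurable_snd)))
  rw [hQ, hQ]
  have h1 : ∀ z : Fin q → Fin p → ℝ, ∫⁻ u : Fin m → Fin p → ℝ, F (rowForm Sig z + rowForm Sig u) =
      ENNReal.ofReal (|C.det|⁻¹ ^ m) *
        ∫⁻ u : Fin m → Fin p → ℝ, F (rowForm Sig z + rowForm 1 u) := fun z =>
    lintegral_rowForm m hC hSC (hFc _)
  simp only [h1]
  rw [lintegral_const_mul' _ _ ENNReal.ofReal_ne_top, lintegral_rowForm q hC hSC hG, ← mul_assoc,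
    ← mul_assoc, ← ENNReal.ofReal_mul (Real.rpow_nonneg hdetpos.le _),
    ← ENNReal.ofReal_mul (by positivity)]
  -- The Jacobians of the `z` and `u` blocks combine to `|det C|^{-(q+m)}`, and `det Σ = |det C|⁻²`
  -- cancels them.
  have hone : Sig.det ^ (-((q : ℝ) + (m : ℝ)) / 2) * |C.det|⁻¹ ^ m * |C.det|⁻¹ ^ q = 1 := by
    have h2 : Sig.det = |C.det| ^ (-2 : ℝ) := by
      rw [Real.rpow_neg hCpos.le, show (2 : ℝ) = ((2 : ℕ) : ℝ) by norm_num, Real.rpow_natCast,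
        sq_abs, hdet, inv_inv]
    rw [h2, ← Real.rpow_mul hCpos.le, mul_assoc, ← pow_add, inv_pow, ← Real.rpow_natCast,
      ← Real.rpow_neg hCpos.le, ← Real.rpow_add hCpos]
    convert Real.rpow_zero |C.det| using 2
    push_cast
    ring
  rw [hone, ENNReal.ofReal_one, one_mul]

/-- `F*` is decreasing, so an infinite value at `t > 0` would be infinite on an open neighbourhood
of the centre, which has positive volume, contradicting finiteness of `K*`. Nothing is claimed at `t
= 0`. -/
theorem Fstar_ne_top (hK : KstarENN q m p f ≠ ∞) {t : ℝ} (ht : 0 < t) : Fstar f t ≠ ∞ := by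
  intro h
  apply hK
  set D : Set (Sample q m p) := {ω | quadForm 0 1 ω < t} with hD
  have hDo : IsOpen D := isOpen_lt (continuous_quadForm 0 1) continuous_const
  have hD0 : (0 : Sample q m p) ∈ D := by
    change quadForm 0 1 (0 : Sample q m p) < t
    have : quadForm 0 1 (0 : Sample q m p) = 0 := by simp [quadForm_eq, rowForm_eq_sum]
    rwa [this]
  have h1 : (volume : Measure (Fin q → Fin p → ℝ)).IsOpenPosMeasure := inferInstance
  have h2 : (volume : Measure (Fin m → Fin p → ℝ)).IsOpenPosMeasure := inferInstance
  have h3 : (volume : Measure (Sample q m p)).IsOpenPosMeasure :=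
    Measure.prod.instIsOpenPosMeasure
  have hpos : volume D ≠ 0 := (hDo.measure_pos volume ⟨0, hD0⟩).ne'
  rw [KstarENN, eq_top_iff]
  calc ∞ = ∫⁻ _ in D, ∞ := by rw [setLIntegral_const, ENNReal.top_mul hpos]
    _ ≤ ∫⁻ ω in D, Fstar f (quadForm 0 1 ω) := by
        refine setLIntegral_mono' hDo.measurableSet fun ω hω => ?_
        rw [← h]
        exact antitone_Fstar f (le_of_lt hω)
    _ ≤ _ := setLIntegral_le_lintegral _ _

theorem ae_Fstar_quadForm_lt_top (hqp : 0 < q * p) (hSig : Sig.PosDef)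
    (θ : Matrix (Fin q) (Fin p) ℝ) (hK : KstarENN q m p f ≠ ∞) :
    ∀ᵐ ω : Sample q m p, Fstar f (quadForm θ Sig ω) < ∞ := by
  filter_upwards [(quasiMeasurePreserving_quadForm (m := m) hqp hSig θ).ae
    (Measure.ae_ne volume (0 : ℝ))] with ω hω
  exact (Fstar_ne_top hK (lt_of_le_of_ne (quadForm_nonneg hSig θ ω) (Ne.symm hω))).lt_top

theorem toReal_law_density (hSig : Sig.PosDef) (θ : Matrix (Fin q) (Fin p) ℝ)
    (hf0 : ∀ t, 0 ≤ t → 0 ≤ f t) (ω : Sample q m p) :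
    (ENNReal.ofReal (Sig.det ^ (-((q : ℝ) + (m : ℝ)) / 2)) *
      ENNReal.ofReal (f (quadForm θ Sig ω))).toReal =
      Sig.det ^ (-((q : ℝ) + (m : ℝ)) / 2) * f (quadForm θ Sig ω) := by
  rw [ENNReal.toReal_mul, ENNReal.toReal_ofReal (Real.rpow_nonneg hSig.det_pos.le _),
    ENNReal.toReal_ofReal (hf0 _ (quadForm_nonneg hSig θ ω))]

theorem integrable_law_iff (hSig : Sig.PosDef) (θ : Matrix (Fin q) (Fin p) ℝ)
    (hf : Measurable f) (hf0 : ∀ t, 0 ≤ t → 0 ≤ f t) {X : Sample q m p → ℝ} :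
    Integrable X (law f θ Sig) ↔ Integrable fun ω => f (quadForm θ Sig ω) * X ω := by
  have hc := (Real.rpow_pos_of_pos hSig.det_pos (-((q : ℝ) + (m : ℝ)) / 2)).ne'
  have hQm : Measurable fun ω : Sample q m p => quadForm θ Sig ω :=
    (continuous_quadForm θ Sig).measurable
  rw [law, integrable_withDensity_iff (by fun_prop) (Eventually.of_forall fun ω =>
    ENNReal.mul_lt_top ENNReal.ofReal_lt_top ENNReal.ofReal_lt_top)]
  simp only [toReal_law_density hSig θ hf0]
  rw [← integrable_const_mul_iff (isUnit_iff_ne_zero.mpr hc)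
    (fun ω : Sample q m p => f (quadForm θ Sig ω) * X ω)]
  refine integrable_congr (Eventually.of_forall fun ω => ?_)
  ring

theorem integral_law (hSig : Sig.PosDef) (θ : Matrix (Fin q) (Fin p) ℝ)
    (hf : Measurable f) (hf0 : ∀ t, 0 ≤ t → 0 ≤ f t) (X : Sample q m p → ℝ) :
    ∫ ω, X ω ∂(law f θ Sig) =
      Sig.det ^ (-((q : ℝ) + (m : ℝ)) / 2) * ∫ ω, f (quadForm θ Sig ω) * X ω := by
  have hQm : Measurable fun ω : Sample q m p => quadForm θ Sig ω :=
    (continuous_quadForm θ Sig).measurable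
  rw [law, integral_withDensity_eq_integral_toReal_smul (by fun_prop) (Eventually.of_forall fun ω =>
    ENNReal.mul_lt_top ENNReal.ofReal_lt_top ENNReal.ofReal_lt_top), ← integral_const_mul]
  refine integral_congr_ae (Eventually.of_forall fun ω => ?_)
  simp only [toReal_law_density hSig θ hf0, smul_eq_mul]
  ring

theorem measurable_lawStar_density (f : ℝ → ℝ) (Sig : Matrix (Fin p) (Fin p) ℝ)
    (θ : Matrix (Fin q) (Fin p) ℝ) : Measurable fun ω : Sample q m p => (KstarENN q m p f)⁻¹ *
      (ENNReal.ofReal (Sig.det ^ (-((q : ℝ) + (m : ℝ)) / 2)) * Fstar f (quadForm θ Sig ω)) :=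
  (((measurable_Fstar f).comp (continuous_quadForm θ Sig).measurable).const_mul _).const_mul _

theorem ae_lawStar_density_lt_top (hSig : Sig.PosDef) (θ : Matrix (Fin q) (Fin p) ℝ)
    (hqp : 0 < q * p) (hK : KstarENN q m p f ≠ ∞) (hK0 : KstarENN q m p f ≠ 0) :
    ∀ᵐ ω : Sample q m p, (KstarENN q m p f)⁻¹ *
      (ENNReal.ofReal (Sig.det ^ (-((q : ℝ) + (m : ℝ)) / 2)) * Fstar f (quadForm θ Sig ω)) < ∞ := by
  filter_upwards [ae_Fstar_quadForm_lt_top hqp hSig θ hK] with ω hω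
  exact ENNReal.mul_lt_top (ENNReal.inv_lt_top.mpr (pos_iff_ne_zero.mpr hK0))
    (ENNReal.mul_lt_top ENNReal.ofReal_lt_top hω)

theorem toReal_lawStar_density (hSig : Sig.PosDef) (θ : Matrix (Fin q) (Fin p) ℝ)
    (ω : Sample q m p) :
    ((KstarENN q m p f)⁻¹ * (ENNReal.ofReal (Sig.det ^ (-((q : ℝ) + (m : ℝ)) / 2)) *
      Fstar f (quadForm θ Sig ω))).toReal = (Kstar q m p f)⁻¹ *
      (Sig.det ^ (-((q : ℝ) + (m : ℝ)) / 2) * (Fstar f (quadForm θ Sig ω)).toReal) := by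
  rw [ENNReal.toReal_mul, ENNReal.toReal_mul, ENNReal.toReal_inv,
    ENNReal.toReal_ofReal (Real.rpow_nonneg hSig.det_pos.le _), Kstar]

theorem integrable_lawStar_iff (hSig : Sig.PosDef) (θ : Matrix (Fin q) (Fin p) ℝ)
    (hqp : 0 < q * p) (hK : KstarENN q m p f ≠ ∞) (hK0 : KstarENN q m p f ≠ 0)
    {X : Sample q m p → ℝ} :
    Integrable X (lawStar f θ Sig) ↔
      Integrable fun ω => (Fstar f (quadForm θ Sig ω)).toReal * X ω := by
  have hc := (Real.rpow_pos_of_pos hSig.det_pos (-((q : ℝ) + (m : ℝ)) / 2)).ne'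
  have hk : (Kstar q m p f)⁻¹ ≠ 0 := inv_ne_zero (ENNReal.toReal_pos hK0 hK).ne'
  rw [lawStar, integrable_withDensity_iff (measurable_lawStar_density f Sig θ)
    (ae_lawStar_density_lt_top hSig θ hqp hK hK0)]
  simp only [toReal_lawStar_density hSig θ]
  rw [← integrable_const_mul_iff (isUnit_iff_ne_zero.mpr (mul_ne_zero hk hc))
    (fun ω : Sample q m p => (Fstar f (quadForm θ Sig ω)).toReal * X ω)]
  refine integrable_congr (Eventually.of_forall fun ω => ?_)
  ring

theorem integral_lawStar (hSig : Sig.PosDef) (θ : Matrix (Fin q) (Fin p) ℝ)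
    (hqp : 0 < q * p) (hK : KstarENN q m p f ≠ ∞) (hK0 : KstarENN q m p f ≠ 0)
    (X : Sample q m p → ℝ) :
    Kstar q m p f * ∫ ω, X ω ∂(lawStar f θ Sig) = Sig.det ^ (-((q : ℝ) + (m : ℝ)) / 2) *
      ∫ ω, (Fstar f (quadForm θ Sig ω)).toReal * X ω := by
  have hk : Kstar q m p f ≠ 0 := (ENNReal.toReal_pos hK0 hK).ne'
  rw [lawStar, integral_withDensity_eq_integral_toReal_smul (measurable_lawStar_density f Sig θ)
    (ae_lawStar_density_lt_top hSig θ hqp hK hK0), ← integral_const_mul, ← integral_const_mul]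
  refine integral_congr_ae (Eventually.of_forall fun ω => ?_)
  simp only [toReal_lawStar_density hSig θ, smul_eq_mul]
  field_simp

theorem isProbabilityMeasure_lawStar (hSig : Sig.PosDef) (θ : Matrix (Fin q) (Fin p) ℝ)
    (hK : KstarENN q m p f ≠ ∞) (hK0 : KstarENN q m p f ≠ 0) :
    IsProbabilityMeasure (lawStar f θ Sig : Measure (Sample q m p)) := by
  constructor
  have hFm : Measurable fun ω : Sample q m p => Fstar f (quadForm θ Sig ω) :=
    (measurable_Fstar f).comp (continuous_quadForm θ Sig).measurable
  rw [lawStar, withDensity_apply _ MeasurableSet.univ, Measure.restrict_univ,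
    lintegral_const_mul _ (hFm.const_mul _), lintegral_const_mul _ hFm,
    lintegral_quadForm hSig θ (measurable_Fstar f)]
  exact ENNReal.inv_mul_cancel hK0 hK

/-- The Stein–Haff inequality in terms of the two laws. -/
theorem integral_haffWeight_law_le (hqp : 0 < q * p) (hSig : Sig.PosDef)
    {φ : (Fin (min p m) → ℝ) → Fin (min p m) → ℝ}
    (hφ : DifferentiableOn ℝ φ (chamber (min p m)))
    (hbox : ∀ ε R : ℝ, 0 < ε → ∃ C : ℝ, ∀ l ∈ chamber (min p m),
      (∀ i, ε ≤ l i ∧ l i ≤ R) → ∀ i, |φ l i| ≤ C)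
    {h : (Fin (min p m) → ℝ) → ℝ} (hh : ∀ l ∈ chamber (min p m), haffDiv m p φ l ≤ h l)
    (θ : Matrix (Fin q) (Fin p) ℝ) (hf : Measurable f) (hf0 : ∀ t, 0 ≤ t → 0 ≤ f t)
    (hK : KstarENN q m p f ≠ ∞) (hK0 : KstarENN q m p f ≠ 0)
    (hi1 : Integrable (fun ω : Sample q m p => haffWeight Sig φ ω.2) (law f θ Sig))
    (hi2 : ∀ i, Integrable (fun ω : Sample q m p => φ (eigval ω.2) i) (law f θ Sig))
    (hi3 : Integrable (fun ω : Sample q m p => h (eigval ω.2)) (lawStar f θ Sig)) :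
    ∫ ω : Sample q m p, haffWeight Sig φ ω.2 ∂(law f θ Sig) ≤
      Kstar q m p f * ∫ ω : Sample q m p, h (eigval ω.2) ∂(lawStar f θ Sig) := by
  rw [integral_law hSig θ hf hf0, integral_lawStar hSig θ hqp hK hK0]
  refine mul_le_mul_of_nonneg_left ?_ (Real.rpow_nonneg hSig.det_pos.le _)
  exact integral_mul_haffWeight_le hqp hSig hφ hbox hh θ hf hf0 (fun t ht => Fstar_ne_top hK ht)
    ((integrable_law_iff hSig θ hf hf0).mp hi1) (fun i => (integrable_law_iff hSig θ hf hf0).mp (hi2 i))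
    ((integrable_lawStar_iff hSig θ hqp hK hK0).mp hi3)

end

/-! ### The loss in terms of the eigenvalues. -/

section

variable {q m p : ℕ} {Sig : Matrix (Fin p) (Fin p) ℝ}

theorem sum_smul_eigProj_mul (u : Fin m → Fin p → ℝ) (c d : Fin (min p m) → ℝ) :
    (∑ i, c i • eigProj u i) * (∑ i, d i • eigProj u i) = ∑ i, (c i * d i) • eigProj u i := by
  rw [Finset.sum_mul_sum]
  refine Finset.sum_congr rfl fun i _ => ?_
  rw [Finset.sum_eq_single i]
  · rw [Matrix.smul_mul, Matrix.mul_smul, eigProj_mul_self, smul_smul]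
  · intro j _ hj
    rw [Matrix.smul_mul, Matrix.mul_smul, eigProj_mul_of_ne u hj.symm, smul_zero, smul_zero]
  · simp

theorem trace_mul_sum_smul_eigProj (u : Fin m → Fin p → ℝ) (A : Matrix (Fin p) (Fin p) ℝ)
    (c : Fin (min p m) → ℝ) :
    (A * ∑ i, c i • eigProj u i).trace = ∑ i, c i * (A * eigProj u i).trace := by
  rw [Matrix.mul_sum, Matrix.trace_sum]
  exact Finset.sum_congr rfl fun i _ => by rw [Matrix.mul_smul, Matrix.trace_smul, smul_eq_mul]

theorem trace_sum_smul_eigProj (u : Fin m → Fin p → ℝ) (c : Fin (min p m) → ℝ) :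
    (∑ i, c i • eigProj u i).trace = ∑ i, c i := by
  rw [Matrix.trace_sum]
  exact Finset.sum_congr rfl fun i _ => by
    rw [Matrix.trace_smul, eigProj_trace, smul_eq_mul, mul_one]

theorem gramPinv_mul_eigProj (u : Fin m → Fin p → ℝ) (i : Fin (min p m)) :
    gramPinv u * eigProj u i = (eigval u i)⁻¹ • eigProj u i := by
  have h1 : gramPinv u = spec u fun b => (allEig u b)⁻¹ := rfl
  unfold eigProj
  rw [h1, spec_mul, ← spec_smul]
  congr 1
  ext b
  by_cases hb : b = topIdx p m i
  · subst hb
    simp [eigval_eq_allEig]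
  · simp [hb]

theorem gramPinv_mul_sum_smul_eigProj {u : Fin m → Fin p → ℝ} (hu : u ∈ regular m p)
    (c : Fin (min p m) → ℝ) :
    gramPinv u * ∑ i, (eigval u i * c i) • eigProj u i = ∑ i, c i • eigProj u i := by
  rw [Matrix.mul_sum]
  refine Finset.sum_congr rfl fun i _ => ?_
  rw [Matrix.mul_smul, gramPinv_mul_eigProj, smul_smul]
  congr 1
  have : eigval u i ≠ 0 := (hu.2 i).ne'
  field_simp

theorem corr_eq_sum (ψ : (Fin (min p m) → ℝ) → Fin (min p m) → ℝ) (u : Fin m → Fin p → ℝ) :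
    corr ψ u = ∑ i, (eigval u i * ψ (eigval u) i) • eigProj u i := by
  rw [corr, Matrix.mul_assoc (eigvec u), Matrix.diagonal_mul_diagonal, eigvec_diagonal_mul]

theorem shape_eq_sum (ψ : (Fin (min p m) → ℝ) → Fin (min p m) → ℝ) (u : Fin m → Fin p → ℝ) :
    shape ψ u = ∑ i, ψ (eigval u) i • eigProj u i := by
  rw [shape, eigvec_diagonal_mul]

/-- The loss of an orthogonally invariant estimator. -/
theorem loss_orthogonally_invariant (hSig : Sig.PosDef) {u : Fin m → Fin p → ℝ}
    (hu : u ∈ regular m p) (y : Fin (min p m) → ℝ) :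
    (gramPinv u * Sig * (Sig⁻¹ * (∑ i, (eigval u i * y i) • eigProj u i) - 1) ^ 2).trace =
      ∑ i, y i ^ 2 * (eigval u i * (Sig⁻¹ * eigProj u i).trace) - 2 * ∑ i, y i +
        (Sig * gramPinv u).trace := by
  have hdet : IsUnit Sig.det := isUnit_iff_ne_zero.mpr hSig.det_pos.ne'
  set E := ∑ i, (eigval u i * y i) • eigProj u i with hE
  set N := ∑ i, y i • eigProj u i with hN
  have h1 : gramPinv u * E = N := gramPinv_mul_sum_smul_eigProj hu y
  -- Both `S⁺ E = N` and `Σ (Σ⁻¹ E - 1) = E - Σ` make the square expand without inverting `S`, so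
  -- the singular case needs no separate treatment.
  have h2 : gramPinv u * Sig * (Sig⁻¹ * E - 1) ^ 2 =
      N * (Sig⁻¹ * E) - N - N + gramPinv u * Sig := by
    have h3 : Sig * (Sig⁻¹ * E - 1) = E - Sig := by
      rw [Matrix.mul_sub, Matrix.mul_one, Matrix.mul_nonsing_inv_cancel_left _ _ hdet]
    rw [sq, Matrix.mul_assoc, ← Matrix.mul_assoc Sig, h3, Matrix.sub_mul, h3, Matrix.mul_sub E,
      Matrix.mul_one, Matrix.mul_sub, Matrix.mul_sub, Matrix.mul_sub,
      ← Matrix.mul_assoc (gramPinv u) E, h1]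
    abel
  have h5 : (N * (Sig⁻¹ * E)).trace =
      ∑ i, y i ^ 2 * (eigval u i * (Sig⁻¹ * eigProj u i).trace) := by
    rw [Matrix.trace_mul_comm, Matrix.mul_assoc, hE, hN, sum_smul_eigProj_mul,
      trace_mul_sum_smul_eigProj]
    exact Finset.sum_congr rfl fun i _ => by ring
  rw [h2, Matrix.trace_add, Matrix.trace_sub, Matrix.trace_sub, h5, hN, trace_sum_smul_eigProj,
    Matrix.trace_mul_comm (gramPinv u)]
  ring

theorem frobSq_shape (ψ : (Fin (min p m) → ℝ) → Fin (min p m) → ℝ) (u : Fin m → Fin p → ℝ) :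
    frobSq (shape ψ u) = ∑ i, ψ (eigval u) i ^ 2 := by
  have h1 : frobSq (shape ψ u) = (shape ψ u * (shape ψ u)ᵀ).trace := by
    simp [frobSq, Matrix.trace, Matrix.mul_apply, sq]
  have h2 : (shape ψ u)ᵀ = shape ψ u := by
    rw [shape_eq_sum, Matrix.transpose_sum]
    exact Finset.sum_congr rfl fun i _ => by rw [Matrix.transpose_smul, eigProj_transpose]
  rw [h1, h2, shape_eq_sum, sum_smul_eigProj_mul, trace_sum_smul_eigProj]
  exact Finset.sum_congr rfl fun i _ => by ring

/-- The second order part of the loss is controlled by the Frobenius norms. -/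
theorem sum_sq_mul_le_frobSq (ψ : (Fin (min p m) → ℝ) → Fin (min p m) → ℝ)
    (u : Fin m → Fin p → ℝ) :
    ∑ i, ψ (eigval u) i ^ 2 * (eigval u i * (Sig⁻¹ * eigProj u i).trace) ≤
      frobSq (Sig⁻¹ * corr ψ u) + frobSq (shape ψ u) := by
  -- The sum is the Frobenius pairing of the two matrices whose norms are assumed square integrable;
  -- the arithmetic–geometric inequality entry by entry finishes.
  have h1 : (Sig⁻¹ * corr ψ u * shape ψ u).trace =
      ∑ i, ψ (eigval u) i ^ 2 * (eigval u i * (Sig⁻¹ * eigProj u i).trace) := by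
    rw [Matrix.mul_assoc, corr_eq_sum, shape_eq_sum, sum_smul_eigProj_mul,
      trace_mul_sum_smul_eigProj]
    exact Finset.sum_congr rfl fun i _ => by ring
  have h2 : (shape ψ u)ᵀ = shape ψ u := by
    rw [shape_eq_sum, Matrix.transpose_sum]
    exact Finset.sum_congr rfl fun i _ => by rw [Matrix.transpose_smul, eigProj_transpose]
  rw [← h1, Matrix.trace]
  simp only [frobSq, Matrix.diag_apply]
  rw [← Finset.sum_add_distrib]
  refine Finset.sum_le_sum fun a _ => ?_
  rw [Matrix.mul_apply, ← Finset.sum_add_distrib]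
  refine Finset.sum_le_sum fun b _ => ?_
  have h3 : shape ψ u b a = shape ψ u a b := by
    conv_lhs => rw [← h2]
    rfl
  rw [h3]
  nlinarith [sq_nonneg ((Sig⁻¹ * corr ψ u) a b - shape ψ u a b),
    sq_nonneg ((Sig⁻¹ * corr ψ u) a b + shape ψ u a b)]

/-- The trace is the quadratic form of `Σ⁻¹` at an eigenvector. Nonnegativity allows each summand of
the loss to be dominated by the whole sum. -/
theorem trace_inv_mul_eigProj_nonneg (hSig : Sig.PosDef) (u : Fin m → Fin p → ℝ)
    (i : Fin (min p m)) : 0 ≤ (Sig⁻¹ * eigProj u i).trace := by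
  have h1 : (Sig⁻¹ * eigProj u i).trace =
      (fun a => eigvec u a i) ⬝ᵥ Sig⁻¹ *ᵥ (fun a => eigvec u a i) := by
    simp only [Matrix.trace, Matrix.diag_apply, Matrix.mul_apply, eigProj_apply, dotProduct,
      Matrix.mulVec, Finset.mul_sum]
    exact Finset.sum_congr rfl fun a _ => Finset.sum_congr rfl fun b _ => by ring
  rw [h1]
  simpa using hSig.inv.posSemidef.dotProduct_mulVec_nonneg fun a => eigvec u a i

/-- The Stein–Haff divergence of `2 Ψ + Ψ²`. -/
theorem haffDiv_eq_gPsi {ψ : (Fin (min p m) → ℝ) → Fin (min p m) → ℝ} {l : Fin (min p m) → ℝ}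
    (hψ : DifferentiableAt ℝ ψ l) (lam : ℝ) :
    haffDiv m p (fun l i => 2 * ψ l i + ψ l i ^ 2) l =
      gPsi m p lam ψ l + 2 * ((max p m : ℕ) : ℝ) * lam := by
  have hpart : ∀ i, partialDiag (fun l i => 2 * ψ l i + ψ l i ^ 2) l i =
      2 * (1 + ψ l i) * partialDiag ψ l i := by
    intro i
    have h := (differentiableAt_pi.mp hψ i).hasFDerivAt
    have h2 := (h.const_mul 2).add (h.pow 2)
    have h3 : fderiv ℝ (fun x => 2 * ψ x i + ψ x i ^ 2) l = _ := h2.fderiv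
    simp only [partialDiag]
    rw [h3]
    simp
    ring
  simp only [haffDiv, gPsi, hpart, sub_add_cancel]
  refine Finset.sum_congr rfl fun i _ => ?_
  ring

end

/-! ### Integrability under the elliptical law. -/

section

variable {q m p : ℕ} {Sig : Matrix (Fin p) (Fin p) ℝ}

theorem law_absolutelyContinuous (f : ℝ → ℝ) (θ : Matrix (Fin q) (Fin p) ℝ)
    (Sig : Matrix (Fin p) (Fin p) ℝ) : (law f θ Sig : Measure (Sample q m p)) ≪ volume :=
  withDensity_absolutelyContinuous _ _

theorem ae_law_mem_regular (f : ℝ → ℝ) (θ : Matrix (Fin q) (Fin p) ℝ)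
    (Sig : Matrix (Fin p) (Fin p) ℝ) :
    ∀ᵐ ω : Sample q m p ∂(law f θ Sig), ω.2 ∈ regular m p :=
  (law_absolutelyContinuous f θ Sig).ae_le (ae_snd_mem_regular q m p)

theorem estPsi_eq_sum (f : ℝ → ℝ) (ψ : (Fin (min p m) → ℝ) → Fin (min p m) → ℝ)
    (ω : Sample q m p) : estPsi f ψ ω =
      ∑ i, (eigval ω.2 i * (aOpt q m p f * (1 + ψ (eigval ω.2) i))) • eigProj ω.2 i := by
  rw [estPsi, gramMat_eq_sum, corr_eq_sum, ← Finset.sum_add_distrib, Finset.smul_sum]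
  refine Finset.sum_congr rfl fun i _ => ?_
  rw [← add_smul, smul_smul]
  congr 1
  ring

theorem estOpt_eq_sum (f : ℝ → ℝ) (ω : Sample q m p) : estOpt f ω =
    ∑ i, (eigval ω.2 i * aOpt q m p f) • eigProj ω.2 i := by
  rw [estOpt, gramMat_eq_sum, Finset.smul_sum]
  refine Finset.sum_congr rfl fun i _ => ?_
  rw [smul_smul, mul_comm]

/-- Integrability of the eigenvalue statistics that enter the losses. -/
theorem integrable_eigenvalue_statistics (hSig : Sig.PosDef)
    {μ : Measure (Sample q m p)} [IsFiniteMeasure μ] (hμ : μ ≪ volume)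
    {ψ : (Fin (min p m) → ℝ) → Fin (min p m) → ℝ} (hψ : ContinuousOn ψ (chamber (min p m)))
    (hmom1 : Integrable (fun ω : Sample q m p => (Sig⁻¹ * gramMat ω.2).trace) μ)
    (hmom3 : Integrable (fun ω : Sample q m p => frobSq (Sig⁻¹ * corr ψ ω.2)) μ)
    (hmom4 : Integrable (fun ω : Sample q m p => frobSq (shape ψ ω.2)) μ) (i : Fin (min p m)) :
    Integrable (fun ω => ψ (eigval ω.2) i) μ ∧ Integrable (fun ω => ψ (eigval ω.2) i ^ 2) μ ∧
    Integrable (fun ω => eigval ω.2 i * (Sig⁻¹ * eigProj ω.2 i).trace) μ ∧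
    Integrable (fun ω =>
      ψ (eigval ω.2) i * (eigval ω.2 i * (Sig⁻¹ * eigProj ω.2 i).trace)) μ ∧
    Integrable (fun ω =>
      ψ (eigval ω.2) i ^ 2 * (eigval ω.2 i * (Sig⁻¹ * eigProj ω.2 i).trace)) μ := by
  have hψm : AEStronglyMeasurable (fun ω : Sample q m p => ψ (eigval ω.2) i) μ :=
    ((aestronglyMeasurable_of_continuousOn_regular (continuousOn_comp_eigval
      (continuousOn_pi.mp hψ i))).comp_snd).mono_ac hμ
  have hxm : AEStronglyMeasurable (fun ω : Sample q m p =>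
      eigval ω.2 i * (Sig⁻¹ * eigProj ω.2 i).trace) μ :=
    ((aestronglyMeasurable_of_continuousOn_regular ((continuous_eigval_apply i).continuousOn.mul
      (continuousOn_trace_mul_eigProj Sig⁻¹ i))).comp_snd).mono_ac hμ
  have hx0 : ∀ (u : Fin m → Fin p → ℝ) j, 0 ≤ eigval u j * (Sig⁻¹ * eigProj u j).trace :=
    fun u j => mul_nonneg (eigval_nonneg u j) (trace_inv_mul_eigProj_nonneg hSig u j)
  have h2 : Integrable (fun ω : Sample q m p => ψ (eigval ω.2) i ^ 2) μ := by
    refine hmom4.mono' (hψm.pow 2) (Eventually.of_forall fun ω => ?_)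
    rw [Real.norm_of_nonneg (sq_nonneg _), frobSq_shape]
    exact Finset.single_le_sum (f := fun i => ψ (eigval ω.2) i ^ 2) (fun _ _ => sq_nonneg _)
      (Finset.mem_univ i)
  have h3 : Integrable (fun ω : Sample q m p => eigval ω.2 i * (Sig⁻¹ * eigProj ω.2 i).trace) μ := by
    refine hmom1.mono' hxm (Eventually.of_forall fun ω => ?_)
    rw [Real.norm_of_nonneg (hx0 _ _), gramMat_eq_sum, trace_mul_sum_smul_eigProj]
    exact Finset.single_le_sum (f := fun j => eigval ω.2 j * (Sig⁻¹ * eigProj ω.2 j).trace)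
      (fun j _ => hx0 _ j) (Finset.mem_univ i)
  have h5 : Integrable (fun ω : Sample q m p =>
      ψ (eigval ω.2) i ^ 2 * (eigval ω.2 i * (Sig⁻¹ * eigProj ω.2 i).trace)) μ := by
    refine (hmom3.add hmom4).mono' ((hψm.pow 2).mul hxm) (Eventually.of_forall fun ω => ?_)
    have h0 : ∀ j, 0 ≤ ψ (eigval ω.2) j ^ 2 * (eigval ω.2 j * (Sig⁻¹ * eigProj ω.2 j).trace) :=
      fun j => mul_nonneg (sq_nonneg _) (hx0 _ j)
    rw [Real.norm_of_nonneg (h0 i)]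
    exact (Finset.single_le_sum (f := fun j =>
      ψ (eigval ω.2) j ^ 2 * (eigval ω.2 j * (Sig⁻¹ * eigProj ω.2 j).trace))
      (fun j _ => h0 j) (Finset.mem_univ i)).trans (sum_sq_mul_le_frobSq ψ ω.2)
  -- The linear terms are interpolated between the constant and the quadratic ones, which the moment
  -- assumptions control.
  have habs : ∀ x : ℝ, |x| ≤ 1 + x ^ 2 := fun x =>
    abs_le.mpr ⟨by nlinarith [sq_nonneg (x + 1)], by nlinarith [sq_nonneg (x - 1)]⟩
  refine ⟨((integrable_const 1).add h2).mono' hψm (Eventually.of_forall fun ω => habs _), h2, h3,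
    (h3.add h5).mono' (hψm.mul hxm) (Eventually.of_forall fun ω => ?_), h5⟩
  rw [norm_mul, Real.norm_of_nonneg (hx0 _ _)]
  refine (mul_le_mul_of_nonneg_right (habs _) (hx0 _ _)).trans (le_of_eq ?_)
  simp only [Pi.add_apply]
  ring

end

end EllipticalCov

/-! ### The risk comparison. -/

theorem theorem1 (q m p : ℕ) (hq : 1 ≤ q)
    (f : ℝ → ℝ) (hf_meas : Measurable f) (hf_nonneg : ∀ t, 0 ≤ t → 0 ≤ f t)
    (θ : Matrix (Fin q) (Fin p) ℝ) (Sig : Matrix (Fin p) (Fin p) ℝ) (hSig : Sig.PosDef)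
    (hf_prob : IsProbabilityMeasure (law f θ Sig : Measure (Sample q m p)))
    (hK : KstarENN q m p f ≠ ∞)
    (ψ : (Fin (min p m) → ℝ) → Fin (min p m) → ℝ) (lam : ℝ) (hlam : 0 < lam)
    (hψ_diff : DifferentiableOn ℝ ψ (chamber (min p m)))
    (hψ_bdd : ∀ ε R : ℝ, 0 < ε → ∃ C : ℝ, ∀ l ∈ chamber (min p m),
      (∀ i, ε ≤ l i ∧ l i ≤ R) → ∀ i, |ψ l i| ≤ C)
    (hψ_trace : ∀ l ∈ chamber (min p m), lam ≤ (Matrix.diagonal (ψ l)).trace)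
    (hmom1 : Integrable (fun ω : Sample q m p => (Sig⁻¹ * gramMat ω.2).trace) (law f θ Sig))
    (hmom2 : Integrable (fun ω : Sample q m p => (Sig * gramPinv ω.2).trace) (law f θ Sig))
    (hmom3 : Integrable (fun ω : Sample q m p => frobSq (Sig⁻¹ * corr ψ ω.2)) (law f θ Sig))
    (hmom4 : Integrable (fun ω : Sample q m p => frobSq (shape ψ ω.2)) (law f θ Sig)) :
    (Integrable (loss Sig (estPsi f ψ : Sample q m p → _)) (law f θ Sig) ∧
      Integrable (loss Sig (estOpt f : Sample q m p → _)) (law f θ Sig)) ∧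
    (Integrable (fun ω : Sample q m p => gPsi m p lam ψ (eigval ω.2)) (lawStar f θ Sig) →
      risk f θ Sig (estPsi f ψ : Sample q m p → _) - risk f θ Sig (estOpt f : Sample q m p → _)
        ≤ aOpt q m p f ^ 2 * Kstar q m p f *
          ∫ ω : Sample q m p, gPsi m p lam ψ (eigval ω.2) ∂(lawStar f θ Sig)) ∧
    ((∀ l ∈ chamber (min p m), gPsi m p lam ψ l ≤ 0) →
      risk f θ Sig (estPsi f ψ : Sample q m p → _)
        ≤ risk f θ Sig (estOpt f : Sample q m p → _)) := by

  -- For `r = 0` the trace is an empty sum, which cannot reach `λ > 0`.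
  have hr : 0 < min p m := by
    by_contra h
    have hr0 : min p m = 0 := Nat.eq_zero_of_not_pos h
    have hempty : IsEmpty (Fin (min p m)) := by rw [hr0]; infer_instance
    have := hψ_trace (fun _ => 0) ⟨fun i => hempty.elim i, fun i => hempty.elim i⟩
    rw [Matrix.trace_diagonal, Finset.univ_eq_empty, Finset.sum_empty] at this
    linarith
  have hqp : 0 < q * p := Nat.mul_pos hq (hr.trans_le (min_le_left p m))
  have hv : (0 : ℝ) < ((max p m : ℕ) : ℝ) := by
    exact_mod_cast hr.trans_le ((min_le_left p m).trans (le_max_left p m))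
  set a := aOpt q m p f with ha
  have ha0 : 0 ≤ a := by
    rw [ha, aOpt]
    exact div_nonneg zero_le_one (mul_nonneg ENNReal.toReal_nonneg hv.le)
  have hreg := ae_law_mem_regular (m := m) f θ Sig
  have hstat := integrable_eigenvalue_statistics hSig (law_absolutelyContinuous (m := m) f θ Sig)
    hψ_diff.continuousOn hmom1 hmom3 hmom4
  have hlossPsi : ∀ᵐ ω : Sample q m p ∂(law f θ Sig), loss Sig (estPsi f ψ) ω =
      ∑ i, (a * (1 + ψ (eigval ω.2) i)) ^ 2 * (eigval ω.2 i * (Sig⁻¹ * eigProj ω.2 i).trace) -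
        2 * ∑ i, a * (1 + ψ (eigval ω.2) i) + (Sig * gramPinv ω.2).trace := by
    filter_upwards [hreg] with ω hω
    rw [loss, estPsi_eq_sum]
    exact loss_orthogonally_invariant hSig hω _
  have hlossOpt : ∀ᵐ ω : Sample q m p ∂(law f θ Sig), loss Sig (estOpt f) ω =
      ∑ i, a ^ 2 * (eigval ω.2 i * (Sig⁻¹ * eigProj ω.2 i).trace) -
        2 * ∑ _i : Fin (min p m), a + (Sig * gramPinv ω.2).trace := by
    filter_upwards [hreg] with ω hω
    rw [loss, estOpt_eq_sum]
    exact loss_orthogonally_invariant hSig hω fun _ => a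
  have hintPsi : Integrable (loss Sig (estPsi f ψ : Sample q m p → _)) (law f θ Sig) := by
    refine Integrable.congr (((integrable_finsetSum Finset.univ fun i _ => ?_).sub
      ((integrable_finsetSum Finset.univ fun i _ => ?_).const_mul 2)).add hmom2)
      (hlossPsi.mono fun ω hω => hω.symm)
    · refine ((((hstat i).2.2.1).add (((hstat i).2.2.2.1).const_mul 2)).add
        ((hstat i).2.2.2.2)).const_mul (a ^ 2) |>.congr (Filter.Eventually.of_forall fun ω => ?_)
      simp only [Pi.add_apply]
      ring
    · exact ((integrable_const 1).add (hstat i).1).const_mul a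
  have hintOpt : Integrable (loss Sig (estOpt f : Sample q m p → _)) (law f θ Sig) :=
    Integrable.congr (((integrable_finsetSum Finset.univ fun i _ => ((hstat i).2.2.1).const_mul
      (a ^ 2)).sub ((integrable_finsetSum Finset.univ fun i _ => integrable_const a).const_mul 2)).add hmom2)
      (hlossOpt.mono fun ω hω => hω.symm)
  refine ⟨⟨hintPsi, hintOpt⟩, ?_⟩
  -- `φ = (1 + ψ)² - 1` is what remains of the quadratic part of the loss after subtracting that of
  -- `a_o S`.
  set φ : (Fin (min p m) → ℝ) → Fin (min p m) → ℝ := fun l i => 2 * ψ l i + ψ l i ^ 2 with hφ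
  have hdiffψ : ∀ l ∈ chamber (min p m), DifferentiableAt ℝ ψ l := fun l hl =>
    (hψ_diff l hl).differentiableAt ((isOpen_chamber _).mem_nhds hl)
  have hφd : DifferentiableOn ℝ φ (chamber (min p m)) := by
    intro l hl
    refine (differentiableAt_pi.mpr fun i => ?_).differentiableWithinAt
    have := differentiableAt_pi.mp (hdiffψ l hl) i
    exact (this.const_mul 2).add (this.pow 2)
  have hbox : ∀ ε R : ℝ, 0 < ε → ∃ C : ℝ, ∀ l ∈ chamber (min p m),
      (∀ i, ε ≤ l i ∧ l i ≤ R) → ∀ i, |φ l i| ≤ C := by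
    intro ε R hε
    obtain ⟨C, hC⟩ := hψ_bdd ε R hε
    refine ⟨2 * C + C ^ 2, fun l hl hlR i => ?_⟩
    have h1 := hC l hl hlR i
    have h2 : ψ l i ^ 2 ≤ C ^ 2 := sq_le_sq.mpr (h1.trans (le_abs_self C))
    obtain ⟨h3, h4⟩ := abs_le.mp h1
    exact abs_le.mpr ⟨by simp only [hφ]; nlinarith [sq_nonneg (ψ l i), sq_nonneg C],
      by simp only [hφ]; linarith⟩
  have hφi : ∀ i, Integrable (fun ω : Sample q m p => φ (eigval ω.2) i) (law f θ Sig) := fun i =>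
    ((hstat i).1.const_mul 2).add (hstat i).2.1
  have hwi : Integrable (fun ω : Sample q m p => haffWeight Sig φ ω.2) (law f θ Sig) := by
    refine integrable_finsetSum Finset.univ fun i _ => ?_
    refine (((hstat i).2.2.2.1).const_mul 2).add ((hstat i).2.2.2.2) |>.congr
      (Filter.Eventually.of_forall fun ω => ?_)
    simp only [Pi.add_apply, hφ]
    ring
  have hψi : Integrable (fun ω : Sample q m p => ∑ i, ψ (eigval ω.2) i) (law f θ Sig) :=
    integrable_finsetSum Finset.univ fun i _ => (hstat i).1
  have hrisk : risk f θ Sig (estPsi f ψ : Sample q m p → _) -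
      risk f θ Sig (estOpt f : Sample q m p → _) =
      a ^ 2 * ∫ ω : Sample q m p, haffWeight Sig φ ω.2 ∂(law f θ Sig) -
        2 * a * ∫ ω : Sample q m p, ∑ i, ψ (eigval ω.2) i ∂(law f θ Sig) := by
    rw [risk, risk, ← integral_sub hintPsi hintOpt, ← integral_const_mul, ← integral_const_mul,
      ← integral_sub (hwi.const_mul _) (hψi.const_mul _)]
    refine integral_congr_ae ?_
    filter_upwards [hlossPsi, hlossOpt] with ω h1 h2
    rw [h1, h2]
    simp only [haffWeight, hφ, Finset.mul_sum]
    rw [add_sub_add_right_eq_sub, sub_sub_sub_comm, ← Finset.sum_sub_distrib,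
      ← Finset.sum_sub_distrib]
    congr 1
    · exact Finset.sum_congr rfl fun i _ => by ring
    · exact Finset.sum_congr rfl fun i _ => by ring
  have htrace : lam ≤ ∫ ω : Sample q m p, ∑ i, ψ (eigval ω.2) i ∂(law f θ Sig) := by
    have h1 : ∫ _ω : Sample q m p, lam ∂(law f θ Sig) = lam := by simp
    rw [← h1]
    refine integral_mono_ae (integrable_const _) hψi ?_
    filter_upwards [hreg] with ω hω
    have := hψ_trace _ hω
    rwa [Matrix.trace_diagonal] at this
  -- If `K* = 0` then `a_o = 0` by the convention `1 / 0 = 0`; both estimators are zero and the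
  -- risks coincide.
  by_cases hK0 : KstarENN q m p f = 0
  · have haz : a = 0 := by
      rw [ha, aOpt, Kstar, hK0]
      simp
    rw [haz, sq, zero_mul, zero_mul, mul_zero, zero_mul, sub_zero] at hrisk
    refine ⟨fun _ => ?_, fun _ => by linarith⟩
    rw [hrisk, haz, sq, zero_mul, zero_mul, zero_mul]
  have hKpos : 0 < Kstar q m p f := ENNReal.toReal_pos hK0 hK
  have hprob := isProbabilityMeasure_lawStar hSig θ hK hK0
  -- The relation `a K* v = 1` matches the constant `2vλ` inside the majorant with the bound on the
  -- trace term.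
  have haK : a ^ 2 * (Kstar q m p f * (2 * ((max p m : ℕ) : ℝ) * lam)) = 2 * a * lam := by
    have : a * (Kstar q m p f * ((max p m : ℕ) : ℝ)) = 1 := by
      rw [ha, aOpt]
      exact one_div_mul_cancel (mul_pos hKpos hv).ne'
    linear_combination 2 * a * lam * this
  have hmain : ∀ h : (Fin (min p m) → ℝ) → ℝ, (∀ l ∈ chamber (min p m), haffDiv m p φ l ≤ h l) →
      Integrable (fun ω : Sample q m p => h (eigval ω.2)) (lawStar f θ Sig) →
      risk f θ Sig (estPsi f ψ : Sample q m p → _) - risk f θ Sig (estOpt f : Sample q m p → _) ≤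
      a ^ 2 * (Kstar q m p f * ∫ ω : Sample q m p, h (eigval ω.2) ∂(lawStar f θ Sig)) -
        2 * a * lam := by
    intro h hh hhi
    rw [hrisk]
    refine sub_le_sub (mul_le_mul_of_nonneg_left ?_ (sq_nonneg a))
      (mul_le_mul_of_nonneg_left htrace (by positivity))
    exact integral_haffWeight_law_le hqp hSig hφd hbox hh θ hf_meas hf_nonneg hK hK0 hwi hφi hhi
  refine ⟨fun hg => ?_, fun hg => ?_⟩
  · have h1 := hmain (fun l => gPsi m p lam ψ l + 2 * ((max p m : ℕ) : ℝ) * lam)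
      (fun l hl => (haffDiv_eq_gPsi (hdiffψ l hl) lam).le) (hg.add (integrable_const _))
    rw [integral_add hg (integrable_const _), integral_const, probReal_univ, one_smul, mul_add,
      mul_add, haK] at h1
    linarith
  -- When `g(Ψ) ≤ 0` the constant `2vλ` itself majorizes the divergence and is integrable under the
  -- probability law, so integrability of `g(Ψ)` plays no role.
  · have h1 := hmain (fun _ => 2 * ((max p m : ℕ) : ℝ) * lam) (fun l hl => by
      have h2 := haffDiv_eq_gPsi (hdiffψ l hl) lam
      have h3 := hg l hl
      simp only [hφ]
      linarith) (integrable_const _)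
    rw [integral_const, probReal_univ, one_smul, haK] at h1
    linarith
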